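/- Let $d\ge 1$, let $t_0'<t'$ be real numbers, and let $m$ be a complex measure on the Borel sets of $\mathbf R^d\times[t_0',t']$ whose total variation $|m|$ satisfies $$\int_{\mathbf R^d\times[t_0',t']} e^{C|\alpha|}\,d|m|(\alpha,\tau)<\infty\qquad\text{for all } C>0 .$$ Assume that $m$ has one of the following two special forms. (1) $dm(\alpha,\tau)=\sum_{j=1}^k dm_j(\alpha)\,\rho_j(\tau)\,d\tau$, where $k\in\mathbf N$, the $\rho_j:\mathbf R\to\mathbf C$ are continuous, and the $m_j$ are complex measures on the Borel sets of $\mathbf R^d$ with $\int_{\mathbf R^d} e^{C|\alpha|}\,d|m_j|(\alpha)<\infty$ for all $C>0$. In this case put $$V(x,t)=\sum_{j=1}^k\int_{\mathbf R^d}e^{\alpha\cdot x}\,dm_j(\alpha)\,\rho_j(t).$$ (2) $dm(\alpha,\tau)=\rho(\alpha,\tau)\,d^d\alpha\,d\tau$, where $\rho:\mathbf R^d\times[t_0',t']\to\mathbf C$ is measurable, $\rho(\alpha,\cdot)$ is continuous on $[t_0',t']$ for every $\alpha\in\mathbf R^d$, and $$\int_{\mathbf R^d}e^{C|\alpha|}\sup_{\tau\in[t_0',t']}|\rho(\alpha,\tau)|\,d^d\alpha<\infty\qquad\text{for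 all }C>0 .$$ In this case put $$V(x,t)=\int_{\mathbf R^d}e^{\alpha\cdot x}\rho(\alpha,t)\,d^d\alpha .$$ Let $g\in\mathbf C$ and let $\theta:\mathbf R\to\mathbf C^d$ be a Schwartz function. Write $z\cdot w=\sum_k z_kw_k$ and $z^2=z\cdot z$ for $z,w\in\mathbf C^d$ (no complex conjugation), and let $\mathbf 1_{(\tau,t]}$ be the indicator function of $(\tau,t]$. For $x,x_0\in\mathbf R^d$ and $t_0'<t_0<t<t'$ let $$\begin{aligned} K^{(\theta)}(x,t\mid x_0,t_0)=\sum_{n=0}^\infty&\frac{(-ig)^n}{n!}\,\bigl(2\pi i(t-t_0)\bigr)^{-d/2}\exp\bigl(ix_0\cdot\theta(t_0)-ix\cdot\theta(t)\bigr)\\ &\times\int_{[t_0,t]^n}\int_{\mathbf R^{dn}}\exp\Bigl\{-\tfrac i2\int_{t_0}^t\Bigl(\theta(s)+i\sum_{j=1}^n\alpha_j\mathbf 1_{(\tau_j,t]}(s)\Bigr)^2ds\Bigr\}\\ &\times\exp\Bigl\{-\frac1{2i(t-t_0)}\Bigl[\int_{t_0}^t\theta(s)\,ds+i\sum_{j=1}^n\alpha_j(t-\tau_j)+(x-x_0)\Bigr]^2\Bigr\}\\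 &\times\exp\Bigl(\sum_{j=1}^n\alpha_j\cdot x\Bigr)\prod_{j=1}^n dm(\alpha_j,\tau_j), \end{aligned}$$ with the principal branch of the power. Then, for all $x,x_0\in\mathbf R^d$ and all $t_0'<t_0<t<t'$, every integral with respect to the product measures and the series converge absolutely, the function $y\mapsto K^{(\theta)}(y,t\mid x_0,t_0)$ is twice continuously differentiable on $\mathbf R^d$, the function $s\mapsto K^{(\theta)}(x,s\mid x_0,t_0)$ is differentiable at $s=t$, and $K^{(\theta)}$ solves the Schrödinger equation $$\Bigl(i\frac{\partial}{\partial t}+\frac12\triangle_d-x\cdot\dot\theta(t)-g\,V(x,t)\Bigr)K^{(\theta)}(x,t\mid x_0,t_0)=0 .$$ -/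

import Mathlib

open MeasureTheory Set
open scoped SchwartzMap ENNReal

namespace LaplaceFeynman

/-- Position space `ℝ^d` with its Euclidean structure. -/
abbrev Pos (d : ℕ) : Type := EuclideanSpace ℝ (Fin d)

/-- The complexified test functions `S_{d,ℂ}`: Schwartz functions on the time axis with values
in `ℂ^d`. -/
abbrev TestFun (d : ℕ) : Type := 𝓢(ℝ, EuclideanSpace ℂ (Fin d))

/-- The pairing `x · z = ∑ₖ xₖ zₖ` of a real vector with a complex one. It is bilinear: nothing is
conjugated. -/
noncomputable def dotC {d : ℕ} (x : Pos d) (z : EuclideanSpace ℂ (Fin d)) : ℂ :=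
  ∑ k, (x k : ℂ) * z k

/-- Integration of complex functions against complex measures uses the multiplication of `ℂ`. -/
noncomputable abbrev mulC : ℂ →L[ℝ] ℂ →L[ℝ] ℂ := ContinuousLinearMap.mul ℝ ℂ

/-- `∫ exp (C |α|) d|μ|(α) < ∞` for all `C > 0`, where `|μ|` is the total variation. -/
def ExpMoments {d : ℕ} (μ : ComplexMeasure (Pos d)) : Prop :=
  ∀ C : ℝ, 0 < C → ∫⁻ α, ENNReal.ofReal (Real.exp (C * ‖α‖)) ∂μ.variation < ∞

/-- `∫∫ exp (C |α|) d|m|(α, τ) < ∞` for all `C > 0`, where `|m|` is the total variation. -/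
def SpaceTimeExpMoments {d : ℕ} (m : ComplexMeasure (Pos d × ℝ)) : Prop :=
  ∀ C : ℝ, 0 < C → ∫⁻ p, ENNReal.ofReal (Real.exp (C * ‖p.1‖)) ∂m.variation < ∞

/-- The `n`-fold product `m ⊗ ⋯ ⊗ m` of a complex measure with finite total variation: if
`dm = h d|m|` (polar decomposition), then `dm^{⊗ n} = ∏ⱼ h(pⱼ) d|m|^{⊗ n}`. -/
noncomputable def productMeasure {X : Type*} [MeasurableSpace X] (m : ComplexMeasure X) (n : ℕ) :
    ComplexMeasure (Fin n → X) :=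
  (Measure.pi fun _ : Fin n => m.variation).withDensityᵥ
    fun p => ∏ j, m.rnDeriv m.variation (p j)

/-- The first special form `dm(α, τ) = ∑ⱼ dmⱼ(α) ρⱼ(τ) dτ` on `ℝ^d × [a, b]`, with potential
`V(x, t) = ∑ⱼ ∫ exp (α · x) dmⱼ(α) ρⱼ(t)`. A complex measure on `ℝ^d × [a, b]` is regarded as a
complex measure on `ℝ^d × ℝ` that vanishes off this strip. -/
def FirstForm {d : ℕ} (a b : ℝ) (m : ComplexMeasure (Pos d × ℝ)) (V : Pos d → ℝ → ℂ) : Prop :=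
  ∃ (k : ℕ) (μ : Fin k → ComplexMeasure (Pos d)) (ρ : Fin k → ℝ → ℂ),
    (∀ j, ExpMoments (μ j)) ∧
    (∀ j, Continuous (ρ j)) ∧
    m = ∑ j, (μ j).prod ((volume.restrict (Icc a b)).withDensityᵥ (ρ j)) mulC ∧
    ∀ x, ∀ t ∈ Icc a b,
      V x t = ∑ j, (∫ᵛ α, Complex.exp (inner ℝ α x : ℝ) ∂[mulC; μ j]) * ρ j t

/-- The second special form `dm(α, τ) = ρ(α, τ) dα dτ` on `ℝ^d × [a, b]`, with potential
`V(x, t) = ∫ exp (α · x) ρ(α, t) dα`. Only the values of `ρ` on `ℝ^d × [a, b]` matter. -/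
def SecondForm {d : ℕ} (a b : ℝ) (m : ComplexMeasure (Pos d × ℝ)) (V : Pos d → ℝ → ℂ) : Prop :=
  ∃ ρ : Pos d → ℝ → ℂ,
    Measurable (Function.uncurry ρ) ∧
    (∀ α, ContinuousOn (ρ α) (Icc a b)) ∧
    (∀ C : ℝ, 0 < C →
      ∫⁻ α, ENNReal.ofReal (Real.exp (C * ‖α‖)) * (⨆ τ ∈ Icc a b, ‖ρ α τ‖ₑ) < ∞) ∧
    m = (volume.restrict (univ ×ˢ Icc a b)).withDensityᵥ (Function.uncurry ρ) ∧
    ∀ x, ∀ t ∈ Icc a b, V x t = ∫ α, Complex.exp (inner ℝ α x : ℝ) * ρ α t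

/-- The integrand of the `n`-th term of the propagator, at the point `p j = (αⱼ, τⱼ)`. -/
noncomputable def integrand {d : ℕ} (θ : TestFun d) (x : Pos d) (t : ℝ) (x₀ : Pos d) (t₀ : ℝ)
    (n : ℕ) (p : Fin n → Pos d × ℝ) : ℂ :=
  Complex.exp (-(Complex.I / 2) * ∫ s in t₀..t, ∑ k,
      (θ s k + Complex.I * ∑ j, (((p j).1 k * (Ioc (p j).2 t).indicator 1 s : ℝ) : ℂ)) ^ 2) *
  Complex.exp (-(1 / (2 * Complex.I * ((t - t₀ : ℝ) : ℂ))) * ∑ k,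
      ((∫ s in t₀..t, θ s k) + Complex.I * ∑ j, (((p j).1 k * (t - (p j).2) : ℝ) : ℂ)
        + ((x k - x₀ k : ℝ) : ℂ)) ^ 2) *
  Complex.exp ((∑ j, inner ℝ (p j).1 x : ℝ) : ℂ)

/-- The set of all `(αⱼ, τⱼ)ⱼ` with `τⱼ ∈ [t₀, t]` for every `j`. -/
def timeBox (d : ℕ) (t₀ t : ℝ) (n : ℕ) : Set (Fin n → Pos d × ℝ) :=
  {p | ∀ j, (p j).2 ∈ Icc t₀ t}

/-- The `n`-th term of the series for the propagator `K^(θ)(x, t | x₀, t₀)`. The power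
`(2πi(t - t₀))^(-d/2)` is taken with the principal branch. -/
noncomputable def propagatorTerm {d : ℕ} (m : ComplexMeasure (Pos d × ℝ)) (g : ℂ) (θ : TestFun d)
    (x : Pos d) (t : ℝ) (x₀ : Pos d) (t₀ : ℝ) (n : ℕ) : ℂ :=
  (-Complex.I * g) ^ n / (n.factorial : ℂ) *
  (2 * (Real.pi : ℂ) * Complex.I * ((t - t₀ : ℝ) : ℂ)) ^ (-((d : ℂ) / 2)) *
  Complex.exp (Complex.I * dotC x₀ (θ t₀) - Complex.I * dotC x (θ t)) *
  ∫ᵛ p in timeBox d t₀ t n, integrand θ x t x₀ t₀ n p ∂[mulC; productMeasure m n]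

/-- The propagator `K^(θ)(x, t | x₀, t₀)` with coupling constant `g`. -/
noncomputable def propagator {d : ℕ} (m : ComplexMeasure (Pos d × ℝ)) (g : ℂ) (θ : TestFun d)
    (x : Pos d) (t : ℝ) (x₀ : Pos d) (t₀ : ℝ) : ℂ :=
  ∑' n, propagatorTerm m g θ x t x₀ t₀ n

/-- The function `K` of space and time is a classical solution at `(x, t)` of
`(i ∂ₜ + ½ Δ - W) K = 0`: it is twice continuously differentiable in space at time `t`,
differentiable in time at `(x, t)`, and the equation holds there. -/
def SolvesSchrodingerAt {d : ℕ} (K : Pos d → ℝ → ℂ) (W : Pos d → ℝ → ℂ) (x : Pos d) (t : ℝ) :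
    Prop :=
  ContDiff ℝ 2 (fun y => K y t) ∧
  DifferentiableAt ℝ (fun s => K x s) t ∧
  Complex.I * deriv (fun s => K x s) t + (1 / 2) * Laplacian.laplacian (fun y => K y t) x
    - W x t * K x t = 0

end LaplaceFeynman

/-! Expanding the squares in the integrand shows that, up to a factor free of `x` and `t`, the
points `(αⱼ, τⱼ)` enter only through `S = ∑ αⱼ` and `M = ∑ τⱼ αⱼ` (`prefactor_mul_integrand`). What
depends on `x` and `t` is a free kernel `k_t(x; S, M)` with sources; the remainder is `selfAction`.
The whole series thus becomes one integral, over finite configurations with the measure `∑ |m|^{⊗ n}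
/ n!`, of `k_t` times a weight, restricted to configurations whose latest time is at most `t`
(`hasSum_propagatorTerm`).

Convergence: since the `αⱼ` are real, all terms of the exponent that are quadratic in them are
purely imaginary. Moduli therefore grow at most exponentially in `∑ |αⱼ|` (`re_coordPhase_le`,
`exists_configWeight_bound`), and the exponential moments of `|m|` suffice.

Space: `k_t` is a source-free Gaussian factor times `exp (β · x)` with real `β` linear in the
sources, so the propagator is a smooth factor times a Laplace transform
(`contDiff_integral_freeKernel`), and the Laplacian may be taken under the integral. For fixed
sources `k_t` solves the equation with potential `x · θ'` (`freeKernel_schrodinger`).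

Time enters twice, in `k_t` and in the constraint on the latest time. Varying `k_t` gives its rate
under the integral. For the constraint, the kernel is frozen at `t` and the latest point is singled
out (`integral_freeKernel_indicator_eq`); the integral becomes a constant plus `∫ Φ(τ) dτ` over
`[t₀, s]` with `Φ` continuous at `t`, so its derivative is `Φ(t)`. A source inserted exactly at time
`t` multiplies the kernel by `exp (α · x)`, because the self-interactions cancel
(`insertKernel_now`); hence `Φ(t) = -i g V K`. The special forms of `m` serve to provide a density
continuous in `τ`, abstracted in `HasTimeDensity`. -/

namespace LaplaceFeynman

/-! ### Complex measures: densities, polar decomposition, product measures. -/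

section ComplexMeasures

variable {X : Type*} [MeasurableSpace X]

/-- Integrability against the variation of `F dν` is integrability of the product with `F`. -/
lemma integrable_variation_withDensityᵥ_iff {ν : Measure X} {F : X → ℂ} (hF : Integrable F ν)
    {f : X → ℂ} :
    Integrable f (ν.withDensityᵥ F).variation ↔ Integrable (fun x => f x * F x) ν := by
  rw [Measure.variation_withDensityᵥ hF]
  have h1 : (fun x => ‖F x‖ₑ) = fun x => ((‖F x‖₊ : NNReal) : ℝ≥0∞) := by
    ext x; rw [enorm_eq_nnnorm]
  rw [h1, integrable_withDensity_iff_integrable_smul₀ hF.aestronglyMeasurable.nnnorm.aemeasurable]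
  have hn : ∀ x, ‖(‖F x‖₊ • f x : ℂ)‖ = ‖f x * F x‖ := fun x => by
    rw [norm_mul, NNReal.smul_def, norm_smul]; simp [mul_comm]
  have hFm := hF.aestronglyMeasurable
  constructor
  · intro h
    refine h.congr' ?_ (Filter.Eventually.of_forall hn)
    -- The norms agree, so only measurability must be transferred. Multiplication by the phase `F /
    -- |F|` does it; where `F` vanishes the convention `0 / 0 = 0` is harmless.
    have h2 : (fun x => f x * F x) = fun x => (F x / (‖F x‖ : ℂ)) * (‖F x‖₊ • f x : ℂ) := by
      ext x
      by_cases h0 : F x = 0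
      · simp [h0]
      · have : (‖F x‖ : ℂ) ≠ 0 := by simpa using h0
        rw [NNReal.smul_def, Complex.real_smul, coe_nnnorm]
        field_simp
    rw [h2]
    exact (hFm.div₀ (Complex.continuous_ofReal.comp_aestronglyMeasurable hFm.norm)).mul
      h.aestronglyMeasurable
  · intro h
    refine h.congr' ?_ (Filter.Eventually.of_forall fun x => (hn x).symm)
    have h2 : (fun x => (‖F x‖₊ • f x : ℂ)) = fun x => ((‖F x‖ : ℂ) / F x) * (f x * F x) := by
      ext x
      by_cases h0 : F x = 0
      · simp [h0]
      · rw [NNReal.smul_def, Complex.real_smul, coe_nnnorm]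
        field_simp
    rw [h2]
    exact ((Complex.continuous_ofReal.comp_aestronglyMeasurable hFm.norm).div₀ hFm).mul
      h.aestronglyMeasurable

/-- The integral against `F dν` is the integral of the product with `F`. -/
lemma integral_withDensityᵥ {ν : Measure X} {F : X → ℂ} (hF : Integrable F ν)
    {f : X → ℂ} (hf : Integrable f (ν.withDensityᵥ F).variation) :
    ∫ᵛ x, f x ∂[mulC; ν.withDensityᵥ F] = ∫ x, f x * F x ∂ν := by
  set m := ν.withDensityᵥ F with hm
  have hfin : IsFiniteMeasure m.variation := by
    rw [hm, Measure.variation_withDensityᵥ hF]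
    exact isFiniteMeasure_withDensity hF.2.ne
  have hprod : ∀ {g : X → ℂ}, Integrable g m.variation → Integrable (fun x => g x * F x) ν :=
    fun h => (integrable_variation_withDensityᵥ_iff hF).1 h
  have hac : ∀ {f g : X → ℂ}, f =ᵐ[m.variation] g →
      (fun x => f x * F x) =ᵐ[ν] fun x => g x * F x := by
    intro f g h
    rw [hm, Measure.variation_withDensityᵥ hF, Filter.EventuallyEq, ae_withDensity_iff'
      hF.aestronglyMeasurable.enorm] at h
    filter_upwards [h] with x hx
    by_cases h0 : F x = 0
    · simp [h0]
    · rw [hx (by simpa using h0)]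
  have hbound : ∀ {g : X → ℂ}, Integrable g m.variation →
      ‖∫ x, g x * F x ∂ν‖ ≤ ∫ x, ‖g x‖ ∂m.variation := by
    intro g hg
    refine (norm_integral_le_integral_norm _).trans (le_of_eq ?_)
    have h1 : (fun x => ‖F x‖ₑ) = fun x => ((‖F x‖₊ : NNReal) : ℝ≥0∞) := by
      ext x; rw [enorm_eq_nnnorm]
    rw [hm, Measure.variation_withDensityᵥ hF, h1, integral_withDensity_eq_integral_smul₀
      hF.aestronglyMeasurable.nnnorm.aemeasurable]
    refine integral_congr_ae (Filter.Eventually.of_forall fun x => ?_)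
    simp [NNReal.smul_def, mul_comm]
  refine Integrable.induction (P := fun f => ∫ᵛ x, f x ∂[mulC; m] = ∫ x, f x * F x ∂ν)
    ?_ ?_ ?_ ?_ hf
  · intro c s hs _
    rw [VectorMeasure.integral_indicator_const _ hs, ContinuousLinearMap.mul_apply',
      hm, withDensityᵥ_apply hF hs, ← integral_const_mul, ← integral_indicator hs]
    refine integral_congr_ae (Filter.Eventually.of_forall fun x => ?_)
    by_cases hx : x ∈ s <;> simp [hx]
  · intro f g _ hf hg h1 h2
    simp only [Pi.add_apply, add_mul]
    rw [VectorMeasure.integral_fun_add hf hg, h1, h2, integral_add (hprod hf) (hprod hg)]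
  -- Both sides are continuous on `L¹(|F| dν)`; the right-hand side is 1-Lipschitz by `hbound`.
  · refine isClosed_eq VectorMeasure.continuous_integral ?_
    refine (LipschitzWith.of_dist_le_mul (K := 1) fun f g => ?_).continuous
    have hfi := L1.integrable_coeFn f
    have hgi := L1.integrable_coeFn g
    rw [dist_eq_norm, ← integral_sub (hprod hfi) (hprod hgi), L1.dist_eq_integral_dist,
      NNReal.coe_one, one_mul]
    simp only [dist_eq_norm, ← sub_mul]
    exact hbound (hfi.sub hgi)
  · intro f g hfg hf h
    rw [← VectorMeasure.integral_congr_ae hfg, h]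
    exact integral_congr_ae (hac hfg)

/-- The Radon-Nikodym theorem for complex measures. -/
lemma withDensityᵥ_rnDeriv_eq (c : ComplexMeasure X) (μ : Measure X) [SigmaFinite μ]
    (h : c.variation ≪ μ) : μ.withDensityᵥ (c.rnDeriv μ) = c := by
  -- Since `|c s|` is at most the variation of `s`, the real and imaginary parts of `c` are
  -- absolutely continuous too, and the theorem for signed measures applies to each.
  have hz : ∀ s, μ s = 0 → c s = 0 := fun s hs => by
    simpa using (VectorMeasure.enorm_measure_le_variation c s).trans (h hs).le
  have hre : (ComplexMeasure.re c) ≪ᵥ μ.toENNRealVectorMeasure :=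
    VectorMeasure.AbsolutelyContinuous.mk fun s hs h0 => by
      rw [Measure.toENNRealVectorMeasure_apply_measurable hs] at h0
      exact congrArg Complex.re (hz s h0)
  have him : (ComplexMeasure.im c) ≪ᵥ μ.toENNRealVectorMeasure :=
    VectorMeasure.AbsolutelyContinuous.mk fun s hs h0 => by
      rw [Measure.toENNRealVectorMeasure_apply_measurable hs] at h0
      exact congrArg Complex.im (hz s h0)
  ext s hs : 1
  conv_rhs => rw [← c.toComplexMeasure_to_signedMeasure]
  rw [SignedMeasure.toComplexMeasure_apply]
  apply Complex.ext
  · rw [withDensityᵥ_apply (c.integrable_rnDeriv μ) hs, ← RCLike.re_eq_complex_re,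
      ← integral_re (c.integrable_rnDeriv μ).integrableOn, RCLike.re_eq_complex_re]
    change ∫ x in s, (ComplexMeasure.re c).rnDeriv μ x ∂μ = _
    rw [← withDensityᵥ_apply (SignedMeasure.integrable_rnDeriv _ _) hs,
      SignedMeasure.withDensityᵥ_rnDeriv_eq _ _ hre]
  · rw [withDensityᵥ_apply (c.integrable_rnDeriv μ) hs, ← RCLike.im_eq_complex_im,
      ← integral_im (c.integrable_rnDeriv μ).integrableOn, RCLike.im_eq_complex_im]
    change ∫ x in s, (ComplexMeasure.im c).rnDeriv μ x ∂μ = _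
    rw [← withDensityᵥ_apply (SignedMeasure.integrable_rnDeriv _ _) hs,
      SignedMeasure.withDensityᵥ_rnDeriv_eq _ _ him]

/-- In the polar decomposition `dm = h d|m|` the density has modulus one. -/
lemma ae_norm_rnDeriv_variation (m : ComplexMeasure X) [IsFiniteMeasure m.variation] :
    ∀ᵐ x ∂m.variation, ‖m.rnDeriv m.variation x‖ = 1 := by
  -- The variation of `h d|m|` is `|h| d|m|`; as `h d|m| = m`, the densities `|h|` and `1` define
  -- the same measure.
  have h1 := Measure.variation_withDensityᵥ (m.integrable_rnDeriv m.variation)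
  rw [withDensityᵥ_rnDeriv_eq m m.variation Measure.AbsolutelyContinuous.rfl] at h1
  have h2 : m.variation.withDensity (fun x => ‖m.rnDeriv m.variation x‖ₑ)
      = m.variation.withDensity 1 := by rw [← h1, withDensity_one]
  have h3 := (withDensity_eq_iff_of_sigmaFinite
    (m.integrable_rnDeriv m.variation).aestronglyMeasurable.enorm
    (aemeasurable_const (b := (1 : ℝ≥0∞)))).1 h2
  filter_upwards [h3] with x hx
  have := congrArg ENNReal.toReal hx
  simpa using this

lemma measurable_rnDeriv_complexMeasure (c : ComplexMeasure X) (μ : Measure X) :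
    Measurable (c.rnDeriv μ) := by
  have : c.rnDeriv μ = fun x => ((ComplexMeasure.re c).rnDeriv μ x : ℂ)
      + ((ComplexMeasure.im c).rnDeriv μ x : ℂ) * Complex.I := by
    ext x
    apply Complex.ext <;> simp [ComplexMeasure.rnDeriv]
  rw [this]
  exact (Complex.measurable_ofReal.comp (SignedMeasure.measurable_rnDeriv _ _)).add
    ((Complex.measurable_ofReal.comp (SignedMeasure.measurable_rnDeriv _ _)).mul_const _)

/-- The phase `h` of the polar decomposition `dm = h d|m|`, normalised to be bounded by one. -/
noncomputable def polarPhase (m : ComplexMeasure X) : X → ℂ :=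
  {x | ‖m.rnDeriv m.variation x‖ ≤ 1}.indicator (m.rnDeriv m.variation)

lemma measurable_polarPhase (m : ComplexMeasure X) : Measurable (polarPhase m) :=
  (measurable_rnDeriv_complexMeasure _ _).indicator
    (measurableSet_le (measurable_rnDeriv_complexMeasure _ _).norm measurable_const)

/-- The bound holds everywhere, not only almost everywhere, as the pointwise domination of
configuration weights requires. -/
lemma norm_polarPhase_le (m : ComplexMeasure X) (x : X) : ‖polarPhase m x‖ ≤ 1 := by
  unfold polarPhase
  by_cases h : x ∈ {x | ‖m.rnDeriv m.variation x‖ ≤ 1}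
  · rw [indicator_of_mem h]; exact h
  · rw [indicator_of_notMem h]; simp

lemma polarPhase_ae_eq (m : ComplexMeasure X) [IsFiniteMeasure m.variation] :
    polarPhase m =ᵐ[m.variation] m.rnDeriv m.variation := by
  filter_upwards [ae_norm_rnDeriv_variation m] with x hx
  exact indicator_of_mem (s := {x | ‖m.rnDeriv m.variation x‖ ≤ 1}) hx.le _

lemma withDensityᵥ_polarPhase (m : ComplexMeasure X) [IsFiniteMeasure m.variation] :
    m.variation.withDensityᵥ (polarPhase m) = m := by
  rw [WithDensityᵥEq.congr_ae (polarPhase_ae_eq m),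
    withDensityᵥ_rnDeriv_eq m m.variation Measure.AbsolutelyContinuous.rfl]

lemma integrable_polarPhase (m : ComplexMeasure X) [IsFiniteMeasure m.variation] :
    Integrable (polarPhase m) m.variation :=
  (m.integrable_rnDeriv m.variation).congr (polarPhase_ae_eq m).symm

/-- Coordinate evaluations are quasi measure preserving, so changing `h` on an `|m|`-null set
changes the product only on a null set. -/
lemma productMeasure_eq_polarPhase (m : ComplexMeasure X) [IsFiniteMeasure m.variation] (n : ℕ) :
    productMeasure m n = (Measure.pi fun _ : Fin n => m.variation).withDensityᵥ
      fun p => ∏ j, polarPhase m (p j) := by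
  refine WithDensityᵥEq.congr_ae ?_
  have h : ∀ j : Fin n, ∀ᵐ p ∂(Measure.pi fun _ : Fin n => m.variation),
      polarPhase m (p j) = m.rnDeriv m.variation (p j) := fun j =>
    (Measure.quasiMeasurePreserving_eval (fun _ : Fin n => m.variation) j).ae (polarPhase_ae_eq m)
  filter_upwards [ae_all_iff.2 h] with p hp
  exact Finset.prod_congr rfl fun j _ => (hp j).symm

lemma integrable_prod_polarPhase (m : ComplexMeasure X) [IsFiniteMeasure m.variation] (n : ℕ) :
    Integrable (fun p : Fin n → X => ∏ j, polarPhase m (p j))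
      (Measure.pi fun _ : Fin n => m.variation) :=
  Integrable.of_bound (Finset.measurable_fun_prod _ fun j _ =>
    (measurable_polarPhase m).comp (measurable_pi_apply j)).aestronglyMeasurable 1
    (Filter.Eventually.of_forall fun p => by
      rw [norm_prod]
      exact Finset.prod_le_one (fun _ _ => norm_nonneg _) fun j _ => norm_polarPhase_le m _)

/-- The density `∏ h(pⱼ)` has modulus at most one, so multiplying by it preserves integrability for
`|m|^{⊗ n}`. -/
lemma integrableOn_productMeasure (m : ComplexMeasure X) [IsFiniteMeasure m.variation] {n : ℕ}
    {s : Set (Fin n → X)} (hs : MeasurableSet s) {f : (Fin n → X) → ℂ}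
    (hf : IntegrableOn f s (Measure.pi fun _ : Fin n => m.variation)) :
    (productMeasure m n).IntegrableOn f s := by
  have hi := integrable_prod_polarPhase m n
  rw [VectorMeasure.IntegrableOn, VectorMeasure.Integrable, VectorMeasure.variation_restrict hs,
    ← IntegrableOn, ← integrable_indicator_iff hs, productMeasure_eq_polarPhase,
    integrable_variation_withDensityᵥ_iff hi]
  refine ((integrable_indicator_iff hs).2 hf).mul_bdd (c := 1) hi.aestronglyMeasurable
    (Filter.Eventually.of_forall fun p => ?_)
  rw [norm_prod]
  exact Finset.prod_le_one (fun _ _ => norm_nonneg _) fun j _ => norm_polarPhase_le m _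

lemma setIntegral_productMeasure (m : ComplexMeasure X) [IsFiniteMeasure m.variation] {n : ℕ}
    {s : Set (Fin n → X)} (hs : MeasurableSet s) {f : (Fin n → X) → ℂ}
    (hf : IntegrableOn f s (Measure.pi fun _ : Fin n => m.variation)) :
    ∫ᵛ p in s, f p ∂[mulC; productMeasure m n]
      = ∫ p, s.indicator f p * ∏ j, polarPhase m (p j)
          ∂(Measure.pi fun _ : Fin n => m.variation) := by
  have hi := integrable_prod_polarPhase m n
  have h1 := integrableOn_productMeasure m hs hf
  rw [← VectorMeasure.integral_indicator hs]
  rw [VectorMeasure.IntegrableOn, VectorMeasure.Integrable, VectorMeasure.variation_restrict hs,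
    ← IntegrableOn, ← integrable_indicator_iff hs] at h1
  rw [productMeasure_eq_polarPhase] at h1 ⊢
  exact integral_withDensityᵥ hi h1

end ComplexMeasures

/-! ### Both special forms as densities that are continuous in time. -/

section Densities

variable {d : ℕ}

/-- `dm(α, τ) = F(α, τ) dλ(α) dτ` on `ℝ^d × [a, b]` with `F` continuous in time and dominated by a
function of `α` with exponential moments, and `V` is the Laplace transform of `F`. -/
structure HasTimeDensity (a b : ℝ) (m : ComplexMeasure (Pos d × ℝ)) (V : Pos d → ℝ → ℂ)
    (lam : Measure (Pos d)) (F : Pos d → ℝ → ℂ) (G : Pos d → ℝ) : Prop where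
  measurable : Measurable (Function.uncurry F)
  continuousOn : ∀ α, ContinuousOn (F α) (Icc a b)
  norm_le : ∀ α, ∀ τ ∈ Icc a b, ‖F α τ‖ ≤ G α
  integrable_exp_mul : ∀ C : ℝ, Integrable (fun α => Real.exp (C * ‖α‖) * G α) lam
  eq_withDensityᵥ :
    m = (lam.prod (volume.restrict (Icc a b))).withDensityᵥ (Function.uncurry F)
  potential_eq : ∀ x, ∀ t ∈ Icc a b,
    V x t = ∫ α, Complex.exp (inner ℝ α x : ℝ) * F α t ∂lam

lemma isFiniteMeasure_variation_of_spaceTimeExpMoments {m : ComplexMeasure (Pos d × ℝ)}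
    (hm : SpaceTimeExpMoments m) : IsFiniteMeasure m.variation := by
  refine ⟨lt_of_le_of_lt ?_ (hm 1 one_pos)⟩
  rw [← lintegral_one]
  refine lintegral_mono fun p => ?_
  simp only [one_mul, ENNReal.one_le_ofReal]
  exact Real.one_le_exp (norm_nonneg _)

lemma isFiniteMeasure_variation_of_expMoments {μ : ComplexMeasure (Pos d)}
    (h : ExpMoments μ) : IsFiniteMeasure μ.variation := by
  refine ⟨lt_of_le_of_lt ?_ (h 1 one_pos)⟩
  rw [← lintegral_one]
  refine lintegral_mono fun p => ?_
  simp only [one_mul, ENNReal.one_le_ofReal]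
  exact Real.one_le_exp (norm_nonneg _)

lemma integrable_exp_mul_of_lintegral {lam : Measure (Pos d)} {G : Pos d → ℝ}
    (hG : Measurable G) (h : ∀ C : ℝ, 0 < C →
      ∫⁻ α, ENNReal.ofReal (Real.exp (C * ‖α‖)) * ‖G α‖ₑ ∂lam < ∞) (C : ℝ) :
    Integrable (fun α => Real.exp (C * ‖α‖) * G α) lam := by
  -- Moments are assumed for positive constants only; `max C 1` is positive and dominates `C`.
  refine ⟨by fun_prop, lt_of_le_of_lt ?_ (h (max C 1) (by positivity))⟩
  refine lintegral_mono fun α => ?_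
  rw [enorm_mul, ← ofReal_norm, Real.norm_eq_abs, Real.abs_exp]
  gcongr
  exact le_max_left _ _

lemma prod_withDensityᵥ {X Y : Type*} [MeasurableSpace X] [MeasurableSpace Y] {μ : Measure X}
    {ν : Measure Y} [SFinite μ] [SFinite ν] {f : X → ℂ} {g : Y → ℂ} (hf : Integrable f μ)
    (hg : Integrable g ν) :
    (μ.withDensityᵥ f).prod (ν.withDensityᵥ g) mulC
      = (μ.prod ν).withDensityᵥ fun p => f p.1 * g p.2 := by
  refine VectorMeasure.prod_eq_of_forall_apply_prod fun s t hs ht => ?_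
  rw [withDensityᵥ_apply (hf.mul_prod hg) (hs.prod ht), withDensityᵥ_apply hf hs,
    withDensityᵥ_apply hg ht, setIntegral_prod_mul]
  rfl

lemma sum_withDensityᵥ {X ι : Type*} [MeasurableSpace X] [Fintype ι] {μ : Measure X}
    {f : ι → X → ℂ} (hf : ∀ i, Integrable (f i) μ) :
    ∑ i, μ.withDensityᵥ (f i) = μ.withDensityᵥ fun x => ∑ i, f i x := by
  ext s hs : 1
  rw [withDensityᵥ_apply (integrable_finsetSum _ fun i _ => hf i) hs,
    integral_finsetSum _ fun i _ => (hf i).integrableOn]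
  rw [FunLike.coe_sum, Finset.sum_apply]
  exact Finset.sum_congr rfl fun i _ => withDensityᵥ_apply (hf i) hs

/-- The sum `λ` of the variations dominates every `μⱼ`, so all of them have densities `Hⱼ` against
one finite measure. Then `F = ∑ Hⱼ ρⱼ`, dominated through bounds of the `ρⱼ` on the compact
interval; `|μⱼ| = |Hⱼ| λ` transfers the moments. -/
lemma FirstForm.exists_hasTimeDensity {a b : ℝ} {m : ComplexMeasure (Pos d × ℝ)}
    {V : Pos d → ℝ → ℂ} (h : FirstForm a b m V) :
    ∃ lam F G, SigmaFinite lam ∧ HasTimeDensity a b m V lam F G := by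
  obtain ⟨k, μ, ρ, hμ, hρ, hm, hV⟩ := h
  have hfin : ∀ j, IsFiniteMeasure (μ j).variation := fun j =>
    isFiniteMeasure_variation_of_expMoments (hμ j)
  set lam : Measure (Pos d) := ∑ j, (μ j).variation with hlam
  have hlamfin : IsFiniteMeasure lam := by
    refine ⟨?_⟩
    rw [hlam, Measure.finsetSum_apply]
    exact ENNReal.sum_lt_top.2 fun j _ => measure_lt_top _ _
  have hac : ∀ j, (μ j).variation ≪ lam := fun j => by
    refine Measure.AbsolutelyContinuous.mk fun s hs h0 => ?_
    rw [hlam, Measure.finsetSum_apply, Finset.sum_eq_zero_iff] at h0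
    exact h0 j (Finset.mem_univ _)
  set H : Fin k → Pos d → ℂ := fun j => (μ j).rnDeriv lam with hH
  have hHi : ∀ j, Integrable (H j) lam := fun j => (μ j).integrable_rnDeriv lam
  have hHm : ∀ j, Measurable (H j) := fun j => measurable_rnDeriv_complexMeasure _ _
  have hHeq : ∀ j, lam.withDensityᵥ (H j) = μ j := fun j =>
    withDensityᵥ_rnDeriv_eq _ _ (hac j)
  have hvar : ∀ j, (μ j).variation = lam.withDensity fun α => ‖H j α‖ₑ := fun j => by
    rw [← Measure.variation_withDensityᵥ (hHi j), hHeq]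
  have hB : ∀ j, ∃ B, ∀ τ ∈ Icc a b, ‖ρ j τ‖ ≤ B := fun j =>
    isCompact_Icc.exists_bound_of_continuousOn (hρ j).continuousOn
  choose B hB using hB
  have hexp : ∀ j C, Integrable (fun α => Real.exp (C * ‖α‖) * ‖H j α‖) lam := fun j =>
    integrable_exp_mul_of_lintegral (hHm j).norm fun C hC => by
      have h1 := hμ j C hC
      rw [hvar, lintegral_withDensity_eq_lintegral_mul _ (hHm j).enorm (by fun_prop)] at h1
      refine lt_of_le_of_lt (le_of_eq (lintegral_congr fun α => ?_)) h1
      simp [mul_comm]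
  have hρi : ∀ j, Integrable (ρ j) (volume.restrict (Icc a b)) := fun j =>
    (hρ j).continuousOn.integrableOn_compact isCompact_Icc
  refine ⟨lam, fun α τ => ∑ j, H j α * ρ j τ, fun α => ∑ j, ‖H j α‖ * |B j|, inferInstance,
    ⟨?_, ?_, ?_, ?_, ?_, ?_⟩⟩
  · refine Finset.measurable_fun_sum _ fun j _ => ?_
    exact ((hHm j).comp measurable_fst).mul ((hρ j).measurable.comp measurable_snd)
  · exact fun α => (continuous_finsetSum _ fun j _ =>
      continuous_const.mul (hρ j)).continuousOn
  · intro α τ hτ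
    refine (norm_sum_le _ _).trans (Finset.sum_le_sum fun j _ => ?_)
    rw [norm_mul]
    exact mul_le_mul_of_nonneg_left ((hB j τ hτ).trans (le_abs_self _)) (norm_nonneg _)
  · intro C
    have : (fun α : Pos d => Real.exp (C * ‖α‖) * ∑ j, ‖H j α‖ * |B j|)
        = fun α => ∑ j, (Real.exp (C * ‖α‖) * ‖H j α‖) * |B j| := by
      ext α; rw [Finset.mul_sum]; exact Finset.sum_congr rfl fun j _ => by ring
    rw [this]
    exact integrable_finsetSum _ fun j _ => (hexp j C).mul_const _
  · rw [hm]
    have h1 := sum_withDensityᵥ (μ := lam.prod (volume.restrict (Icc a b)))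
      (f := fun j p => H j p.1 * ρ j p.2) fun j => (hHi j).mul_prod (hρi j)
    refine Eq.trans (Finset.sum_congr rfl fun j _ => ?_) h1
    rw [← prod_withDensityᵥ (hHi j) (hρi j), hHeq]
  · intro x t ht
    have hint : ∀ j, Integrable (fun α => Complex.exp (inner ℝ α x : ℝ) * H j α) lam := by
      intro j
      refine (hexp j ‖x‖).mono' ?_ (Filter.Eventually.of_forall fun α => ?_)
      · exact ((by fun_prop : Measurable fun α : Pos d =>
          Complex.exp (inner ℝ α x : ℝ)).mul (hHm j)).aestronglyMeasurable
      · rw [norm_mul, Complex.norm_exp, Complex.ofReal_re]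
        gcongr
        rw [mul_comm]
        exact real_inner_le_norm _ _
    rw [hV x t ht]
    simp only [Finset.mul_sum, ← mul_assoc]
    rw [integral_finsetSum _ fun j _ => (hint j).mul_const _]
    refine Finset.sum_congr rfl fun j _ => ?_
    rw [integral_mul_const]
    congr 1
    rw [← hHeq j]
    exact integral_withDensityᵥ (hHi j) ((integrable_variation_withDensityᵥ_iff (hHi j)).2 (hint j))

/-- Continuity and density of the rationals reduce the supremum to a countable one, which makes it
measurable in `α`. Projecting the rationals to `[a, b]` covers irrational endpoints and the case `a
= b`. -/
lemma biSup_enorm_eq_iSup_rat {a b : ℝ} (hab : a ≤ b) {f : ℝ → ℂ}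
    (hf : ContinuousOn f (Icc a b)) :
    ⨆ τ ∈ Icc a b, ‖f τ‖ₑ = ⨆ q : ℚ, ‖f (projIcc a b hab q)‖ₑ := by
  refine le_antisymm (iSup₂_le fun τ hτ => ?_)
    (iSup_le fun q => le_iSup₂_of_le _ (projIcc a b hab q).2 le_rfl)
  have hc : Continuous fun s : ℝ => ‖f (projIcc a b hab s)‖ₑ :=
    (hf.domRestrict.comp continuous_projIcc).enorm
  have hcl : IsClosed {s : ℝ | ‖f (projIcc a b hab s)‖ₑ ≤ ⨆ q : ℚ, ‖f (projIcc a b hab q)‖ₑ} :=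
    isClosed_le hc continuous_const
  have hmem : τ ∈ closure (range ((↑) : ℚ → ℝ)) := by
    rw [Rat.isDenseEmbedding_coe_real.dense.closure_eq]; trivial
  have h1 := closure_minimal (by
    rintro _ ⟨q, rfl⟩
    exact le_iSup (fun q : ℚ => ‖f (projIcc a b hab q)‖ₑ) q) hcl hmem
  simpa [projIcc_of_mem hab hτ] using h1

/-- Here `λ` is Lebesgue measure, `F = ρ`, and `G` is the supremum of `|ρ(α, ·)|`, finite by
compactness. -/
lemma SecondForm.exists_hasTimeDensity {a b : ℝ} (hab : a ≤ b) {m : ComplexMeasure (Pos d × ℝ)}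
    {V : Pos d → ℝ → ℂ} (h : SecondForm a b m V) :
    ∃ lam F G, SigmaFinite lam ∧ HasTimeDensity a b m V lam F G := by
  obtain ⟨ρ, hρm, hρc, hmom, hm, hV⟩ := h
  have hG : Measurable fun α => ⨆ τ ∈ Icc a b, ‖ρ α τ‖ₑ := by
    simp_rw [fun α => biSup_enorm_eq_iSup_rat hab (hρc α)]
    refine Measurable.iSup fun q => Measurable.enorm ?_
    exact hρm.comp (measurable_id.prodMk measurable_const)
  have hfin : ∀ α, ⨆ τ ∈ Icc a b, ‖ρ α τ‖ₑ ≠ ∞ := fun α => by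
    obtain ⟨B, hB⟩ := isCompact_Icc.exists_bound_of_continuousOn (hρc α)
    refine ne_top_of_le_ne_top (ENNReal.ofReal_ne_top (r := B)) (iSup₂_le fun τ hτ => ?_)
    rw [← ofReal_norm]
    exact ENNReal.ofReal_le_ofReal (hB τ hτ)
  refine ⟨volume, ρ, fun α => (⨆ τ ∈ Icc a b, ‖ρ α τ‖ₑ).toReal, inferInstance,
    ⟨hρm, hρc, fun α τ hτ => ?_, ?_, ?_, hV⟩⟩
  · rw [← toReal_enorm]
    exact ENNReal.toReal_mono (hfin α) (le_iSup₂ (f := fun τ (_ : τ ∈ Icc a b) => ‖ρ α τ‖ₑ) τ hτ)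
  · refine integrable_exp_mul_of_lintegral hG.ennreal_toReal fun C hC => ?_
    simp only [Real.enorm_of_nonneg ENNReal.toReal_nonneg, ENNReal.ofReal_toReal (hfin _)]
    exact hmom C hC
  · rw [hm, Measure.volume_eq_prod, ← Measure.prod_restrict, Measure.restrict_univ]

lemma HasTimeDensity.integrable {a b : ℝ} {m : ComplexMeasure (Pos d × ℝ)} {V : Pos d → ℝ → ℂ}
    {lam : Measure (Pos d)} [SigmaFinite lam] {F : Pos d → ℝ → ℂ} {G : Pos d → ℝ}
    (h : HasTimeDensity a b m V lam F G) :
    Integrable (Function.uncurry F) (lam.prod (volume.restrict (Icc a b))) := by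
  have h0 : Integrable G lam := by simpa using h.integrable_exp_mul 0
  have h1 : Integrable (fun p : Pos d × ℝ => G p.1 * (1 : ℝ))
      (lam.prod (volume.restrict (Icc a b))) := h0.mul_prod (integrable_const 1)
  refine h1.mono' h.measurable.aestronglyMeasurable ?_
  have h2 : ∀ᵐ p ∂(lam.prod (volume.restrict (Icc a b))), p.2 ∈ Icc a b :=
    Measure.quasiMeasurePreserving_snd.ae (ae_restrict_mem measurableSet_Icc)
  filter_upwards [h2] with p hp
  simpa [Function.uncurry] using h.norm_le p.1 p.2 hp

/-- Integrals against `h d|m| = dm` are integrals against the density. -/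
lemma HasTimeDensity.integral_mul_polarPhase {a b : ℝ} {m : ComplexMeasure (Pos d × ℝ)}
    [IsFiniteMeasure m.variation] {V : Pos d → ℝ → ℂ}
    {lam : Measure (Pos d)} [SigmaFinite lam] {F : Pos d → ℝ → ℂ} {G : Pos d → ℝ}
    (h : HasTimeDensity a b m V lam F G) {f : Pos d × ℝ → ℂ} (hf : Integrable f m.variation) :
    Integrable (fun p => f p * F p.1 p.2) (lam.prod (volume.restrict (Icc a b))) ∧
    ∫ p, f p * polarPhase m p ∂m.variation
      = ∫ p, f p * F p.1 p.2 ∂(lam.prod (volume.restrict (Icc a b))) := by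
  have h1 := integral_withDensityᵥ (integrable_polarPhase m) (f := f)
    (by rwa [withDensityᵥ_polarPhase])
  have hf' := hf
  rw [withDensityᵥ_polarPhase] at h1
  rw [h.eq_withDensityᵥ] at hf'
  have h2 := integral_withDensityᵥ h.integrable hf'
  rw [← h.eq_withDensityᵥ] at h2
  exact ⟨(integrable_variation_withDensityᵥ_iff h.integrable).1 hf', h1.symm.trans h2⟩

/-- `|m|` does not charge a single instant. -/
lemma HasTimeDensity.variation_snd_singleton {a b : ℝ} {m : ComplexMeasure (Pos d × ℝ)}
    {V : Pos d → ℝ → ℂ} {lam : Measure (Pos d)} [SigmaFinite lam] {F : Pos d → ℝ → ℂ}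
    {G : Pos d → ℝ} (h : HasTimeDensity a b m V lam F G) (c : ℝ) :
    ∀ᵐ p ∂m.variation, p.2 ≠ c := by
  rw [h.eq_withDensityᵥ, Measure.variation_withDensityᵥ h.integrable]
  refine (withDensity_absolutelyContinuous _ _).ae_le ?_
  refine Measure.quasiMeasurePreserving_snd.ae (p := fun t => t ≠ c) ?_
  exact Measure.ae_ne _ c

end Densities

/-! ### The exponential of a measure on finite configurations. -/

section Configurations

/-- Finite ordered configurations of points of `X`. -/
abbrev Config (X : Type*) : Type _ := Σ n : ℕ, (Fin n → X)

variable {X : Type*} [MeasurableSpace X]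

/-- The inclusion of the configurations of `n` points. -/
abbrev configMk (n : ℕ) (p : Fin n → X) : Config X := ⟨n, p⟩

omit [MeasurableSpace X] in
lemma configMk_injective (n : ℕ) : Function.Injective (configMk (X := X) n) := fun p q h => by
  simpa [configMk] using h

lemma measurableSet_config_iff {s : Set (Config X)} :
    MeasurableSet s ↔ ∀ n, MeasurableSet (configMk n ⁻¹' s) := by
  rw [MeasurableSpace.measurableSet_iInf]
  rfl

lemma measurable_config_iff {Y : Type*} [MeasurableSpace Y] {f : Config X → Y} :
    Measurable f ↔ ∀ n, Measurable fun p : Fin n → X => f ⟨n, p⟩ := by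
  constructor
  · exact fun h n s hs => measurableSet_config_iff.1 (h hs) n
  · exact fun h s hs => measurableSet_config_iff.2 fun n => h n hs

lemma measurableEmbedding_configMk (n : ℕ) :
    MeasurableEmbedding (configMk (X := X) n) where
  injective := configMk_injective n
  measurable := measurable_config_iff.1 measurable_id n
  measurableSet_image' := fun s hs => by
    refine measurableSet_config_iff.2 fun k => ?_
    by_cases h : n = k
    · subst h
      rwa [preimage_image_eq _ (configMk_injective n)]
    · convert! MeasurableSet.empty
      exact preimage_image_sigmaMk_of_ne (α := fun n => Fin n → X) (Ne.symm h) s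

/-- The exponential `∑ₙ ν^{⊗ n} / n!` of a measure. -/
noncomputable def configMeasure (ν : Measure X) : Measure (Config X) :=
  Measure.sum fun n : ℕ => ENNReal.ofReal ((n.factorial : ℝ)⁻¹) •
    (Measure.pi fun _ : Fin n => ν).map (configMk n)

variable {ν : Measure X}

lemma integral_configMeasure_component {E : Type*} [NormedAddCommGroup E] [NormedSpace ℝ E]
    (n : ℕ) (f : Config X → E) :
    ∫ p, f p ∂(ENNReal.ofReal ((n.factorial : ℝ)⁻¹) •
      (Measure.pi fun _ : Fin n => ν).map (configMk n))
      = (n.factorial : ℝ)⁻¹ • ∫ p, f ⟨n, p⟩ ∂(Measure.pi fun _ : Fin n => ν) := by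
  rw [integral_smul_measure, (measurableEmbedding_configMk n).integral_map,
    ENNReal.toReal_ofReal (by positivity)]

lemma integrable_configMeasure_component_iff {E : Type*} [NormedAddCommGroup E]
    (n : ℕ) (f : Config X → E) :
    Integrable f (ENNReal.ofReal ((n.factorial : ℝ)⁻¹) •
      (Measure.pi fun _ : Fin n => ν).map (configMk n))
      ↔ Integrable (fun p => f ⟨n, p⟩) (Measure.pi fun _ : Fin n => ν) := by
  rw [integrable_smul_measure (by simp; positivity) ENNReal.ofReal_ne_top,
    (measurableEmbedding_configMk n).integrable_map_iff]
  rfl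

lemma hasSum_integral_configMeasure {E : Type*} [NormedAddCommGroup E] [NormedSpace ℝ E]
    {f : Config X → E} (hf : Integrable f (configMeasure ν)) :
    HasSum (fun n : ℕ => (n.factorial : ℝ)⁻¹ • ∫ p, f ⟨n, p⟩ ∂(Measure.pi fun _ : Fin n => ν))
      (∫ p, f p ∂(configMeasure ν)) := by
  have := hasSum_integral_measure hf
  simp only [integral_configMeasure_component] at this
  exact this

lemma integrable_component {E : Type*} [NormedAddCommGroup E]
    {f : Config X → E} (hf : Integrable f (configMeasure ν)) (n : ℕ) :
    Integrable (fun p => f ⟨n, p⟩) (Measure.pi fun _ : Fin n => ν) :=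
  (integrable_configMeasure_component_iff n f).1 (hf.mono_measure (Measure.le_sum _ n))

variable [IsFiniteMeasure ν]

instance : SFinite (configMeasure ν) := by
  unfold configMeasure
  have : ∀ n : ℕ, IsFiniteMeasure (ENNReal.ofReal ((n.factorial : ℝ)⁻¹) •
      (Measure.pi fun _ : Fin n => ν).map (configMk (X := X) n)) := fun n =>
    Measure.smul_finite _ ENNReal.ofReal_ne_top
  infer_instance

/-- The exponential of an integrable function is integrable. -/
lemma integrable_prod_configMeasure {a : X → ℝ} (ha : Integrable a ν) :
    Integrable (fun p : Config X => ∏ j, a (p.2 j)) (configMeasure ν) := by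
  refine integrable_sum_measure (fun n => ?_) ?_
  · rw [integrable_configMeasure_component_iff]
    exact Integrable.fintype_prod (μ := fun _ : Fin n => ν) (f := fun _ => a) fun _ => ha
  -- The component of `n` points contributes the `n`-th term of the exponential series of `∫ |a|
  -- dν`.
  · have h1 : ∀ n : ℕ, ∫ p : Fin n → X, ∏ j, ‖a (p j)‖ ∂(Measure.pi fun _ : Fin n => ν)
        = (∫ x, ‖a x‖ ∂ν) ^ n := fun n => by
      rw [integral_fintype_prod_eq_pow (ι := Fin n) (fun x => ‖a x‖), Fintype.card_fin]
    simp only [integral_configMeasure_component, norm_prod, h1, smul_eq_mul]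
    simpa [div_eq_inv_mul] using Real.summable_pow_div_factorial (∫ x, ‖a x‖ ∂ν)

lemma ae_configMeasure {P : X → Prop} (hP : ∀ᵐ x ∂ν, P x) :
    ∀ᵐ p ∂(configMeasure ν), ∀ j, P (p.2 j) := by
  unfold configMeasure
  rw [Measure.ae_sum_iff]
  refine fun n => Measure.ae_smul_measure ?_ _
  rw [(measurableEmbedding_configMk n).ae_map_iff]
  exact ae_all_iff.2 fun j => (Measure.quasiMeasurePreserving_eval (fun _ : Fin n => ν) j).ae hP

/-- Two independent points have different times if no time is charged. -/
lemma ae_pi_ne_of_ne {T : X → ℝ} (hT : Measurable T) (hT0 : ∀ c, ∀ᵐ x ∂ν, T x ≠ c) {n : ℕ}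
    {i j : Fin n} (hij : i ≠ j) :
    ∀ᵐ p ∂(Measure.pi fun _ : Fin n => ν), T (p i) ≠ T (p j) := by
  cases n with
  | zero => exact i.elim0
  | succ n =>
    obtain ⟨k, rfl⟩ := Fin.exists_succAbove_eq hij.symm
    have h1 := measurePreserving_piFinSuccAbove (fun _ : Fin (n + 1) => ν) i
    have h2 : ∀ᵐ q ∂(ν.prod (Measure.pi fun _ : Fin n => ν)), T q.1 ≠ T (q.2 k) := by
      have hmeas : MeasurableSet {q : X × (Fin n → X) | T q.1 ≠ T (q.2 k)} :=
        (measurableSet_eq_fun (hT.comp measurable_fst)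
          (hT.comp ((measurable_pi_apply k).comp measurable_snd))).compl
      -- Fubini: with the other points fixed, the split-off point only has to avoid the single time
      -- `T (p k)`, a null event by `hT0`. The factors are swapped so that this point is the inner
      -- variable.
      have h3 : ∀ᵐ q ∂((Measure.pi fun _ : Fin n => ν).prod ν), T q.2 ≠ T (q.1 k) := by
        rw [Measure.ae_prod_iff_ae_ae (p := fun q : (Fin n → X) × X => T q.2 ≠ T (q.1 k))
          (measurable_swap hmeas)]
        exact Filter.Eventually.of_forall fun p => hT0 (T (p k))
      exact (Measure.measurePreserving_swap (μ := ν)).quasiMeasurePreserving.ae h3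
    exact h1.quasiMeasurePreserving.ae h2

/-- Adding a point to a configuration. -/
def Config.insert (x : X) (p : Config X) : Config X := ⟨p.1 + 1, Fin.cons x p.2⟩

open Classical in
/-- A symmetric function of `n + 1` points is integrated by singling out the latest point. -/
lemma integral_pi_succ_latest {T : X → ℝ} (hT : Measurable T) (hT0 : ∀ c, ∀ᵐ x ∂ν, T x ≠ c)
    {n : ℕ} {f : (Fin (n + 1) → X) → ℂ}
    (hf : Integrable f (Measure.pi fun _ : Fin (n + 1) => ν))
    (hsymm : ∀ j x p, f (Fin.insertNth j x p) = f (Fin.cons x p)) :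
    ∫ p, f p ∂(Measure.pi fun _ : Fin (n + 1) => ν) = ((n + 1 : ℕ) : ℂ) *
      ∫ p, ∫ x, (if ∀ k, T (p k) < T x then f (Fin.cons x p) else 0) ∂ν
        ∂(Measure.pi fun _ : Fin n => ν) := by
  -- `A j` is the event that the point `j` is strictly the latest. Coinciding times form a null set,
  -- so these `n + 1` events partition the space almost everywhere.
  set A : Fin (n + 1) → Set (Fin (n + 1) → X) :=
    fun j => {p | ∀ k : Fin n, T (p (j.succAbove k)) < T (p j)} with hA
  have hAm : ∀ j, MeasurableSet (A j) := fun j => by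
    have : A j = ⋂ k : Fin n, {p | T (p (j.succAbove k)) < T (p j)} := by
      ext p; simp [hA]
    rw [this]
    exact MeasurableSet.iInter fun k => measurableSet_lt
      (hT.comp (measurable_pi_apply _)) (hT.comp (measurable_pi_apply _))
  have hdecomp : f =ᵐ[Measure.pi fun _ : Fin (n + 1) => ν]
      fun p => ∑ j, (A j).indicator f p := by
    have hne : ∀ᵐ p ∂(Measure.pi fun _ : Fin (n + 1) => ν), ∀ i j, i ≠ j → T (p i) ≠ T (p j) := by
      rw [ae_all_iff]; intro i
      rw [ae_all_iff]; intro j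
      by_cases hij : i = j
      · simp [hij]
      · filter_upwards [ae_pi_ne_of_ne hT hT0 hij] with p hp _ using hp
    filter_upwards [hne] with p hp
    obtain ⟨j₀, -, hj₀⟩ := Finset.exists_max_image Finset.univ (fun j => T (p j))
      ⟨0, Finset.mem_univ _⟩
    have hmem : p ∈ A j₀ := fun k =>
      lt_of_le_of_ne (hj₀ _ (Finset.mem_univ _)) (hp _ _ (Fin.succAbove_ne j₀ k))
    rw [Finset.sum_eq_single j₀, indicator_of_mem hmem]
    · intro j _ hj
      refine indicator_of_notMem (fun hjA => ?_) _
      obtain ⟨k, hk⟩ := Fin.exists_succAbove_eq hj.symm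
      have := hjA k
      rw [hk] at this
      exact absurd (hj₀ j (Finset.mem_univ _)) (not_le.2 this)
    · intro h; exact absurd (Finset.mem_univ _) h
  -- Splitting off the coordinate `j` preserves the product measure, and by symmetry of `f` the
  -- result does not depend on `j`; hence the factor `n + 1`.
  have hterm : ∀ j, ∫ p, (A j).indicator f p ∂(Measure.pi fun _ : Fin (n + 1) => ν)
      = ∫ p, ∫ x, (if ∀ k, T (p k) < T x then f (Fin.cons x p) else 0) ∂ν
        ∂(Measure.pi fun _ : Fin n => ν) := fun j => by
    have h1 := (measurePreserving_piFinSuccAbove (fun _ : Fin (n + 1) => ν) j).symm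
    have hint := (h1.integrable_comp_emb (MeasurableEquiv.measurableEmbedding _)).2
      (hf.indicator (hAm j))
    rw [← h1.integral_comp']
    refine (integral_prod_symm _ hint).trans ?_
    refine integral_congr_ae (Filter.Eventually.of_forall fun p =>
      integral_congr_ae (Filter.Eventually.of_forall fun x => ?_))
    change (A j).indicator f (Fin.insertNth j x p) = _
    have hiff : Fin.insertNth j x p ∈ A j ↔ ∀ k, T (p k) < T x := by
      simp [hA]
    by_cases h : ∀ k, T (p k) < T x
    · rw [indicator_of_mem (hiff.2 h), hsymm]; exact (if_pos h).symm
    · rw [indicator_of_notMem (fun h' => h (hiff.1 h'))]; exact (if_neg h).symm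
  rw [integral_congr_ae hdecomp, integral_finsetSum _ fun j _ => hf.indicator (hAm j),
    Finset.sum_congr rfl fun j _ => hterm j]
  simp

open Classical in
/-- A symmetric function of a configuration is integrated by singling out the latest point. -/
lemma integral_configMeasure_latest {T : X → ℝ} (hT : Measurable T)
    (hT0 : ∀ c, ∀ᵐ x ∂ν, T x ≠ c) {f : Config X → ℂ} (hf : Integrable f (configMeasure ν))
    (hsymm : ∀ n j x (p : Fin n → X), f ⟨n + 1, Fin.insertNth j x p⟩ = f (Config.insert x ⟨n, p⟩))
    (hint : Integrable (fun p : Config X =>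
      ∫ x, (if ∀ k, T (p.2 k) < T x then f (Config.insert x p) else 0) ∂ν) (configMeasure ν)) :
    ∫ p, f p ∂(configMeasure ν) = f ⟨0, Fin.elim0⟩ + ∫ p : Config X,
      ∫ x, (if ∀ k, T (p.2 k) < T x then f (Config.insert x p) else 0) ∂ν ∂(configMeasure ν) := by
  have h1 := hasSum_integral_configMeasure hf
  have h2 := hasSum_integral_configMeasure hint
  -- `(n + 1) / (n + 1)! = 1 / n!`: the terms with `n + 1` points become the exponential series over
  -- the `n` earlier points, and the empty configuration is left over.
  have h3 : ∀ n : ℕ, ((n + 1).factorial : ℝ)⁻¹ •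
      ∫ p, f ⟨n + 1, p⟩ ∂(Measure.pi fun _ : Fin (n + 1) => ν) = (n.factorial : ℝ)⁻¹ •
      ∫ p : Fin n → X, ∫ x, (if ∀ k, T (p k) < T x then f (Config.insert x ⟨n, p⟩) else 0) ∂ν
        ∂(Measure.pi fun _ : Fin n => ν) := fun n => by
    rw [integral_pi_succ_latest hT hT0 (integrable_component hf (n + 1)) (hsymm n),
      Nat.factorial_succ, Complex.real_smul, Complex.real_smul, ← mul_assoc]
    congr 1
    have h4 : ((n + 1 : ℕ) : ℂ) ≠ 0 := Nat.cast_ne_zero.2 (Nat.succ_ne_zero n)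
    push_cast at h4 ⊢
    field_simp
  have h5 := (hasSum_nat_add_iff' 1).2 h1
  simp only [h3, Finset.range_one, Finset.sum_singleton] at h5
  have h6 : ∫ p, f ⟨0, p⟩ ∂(Measure.pi fun _ : Fin 0 => ν) = f ⟨0, Fin.elim0⟩ := by
    have : ∀ p : Fin 0 → X, f ⟨0, p⟩ = f ⟨0, Fin.elim0⟩ := fun p => by
      rw [Subsingleton.elim p Fin.elim0]
    simp [this, measureReal_def]
  rw [h6] at h5
  have h7 := h5.unique h2
  simp only [Nat.factorial_zero, Nat.cast_one, inv_one, one_smul] at h7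
  rw [← h7]
  ring

end Configurations

/-! ### The phase in one coordinate: Hamilton-Jacobi identity and growth bounds. -/

section CoordinatePhase

open Complex

/-- One coordinate of the logarithm of the free propagator with sources. Here `v`, `Θ`, `q` stand
for the current value of the test function, its integral, and the integral of its square, `T` is
the elapsed time, and the sources enter through `S = ∑ αⱼ` and `M = ∑ αⱼ τⱼ`. -/
noncomputable def coordPhase (v Θ q : ℂ) (T s x y S M : ℝ) : ℂ :=
  -I * x * v - I / 2 * q + S * Θ + I / 2 * S ^ 2 * s
    + I / (2 * T) * (Θ + I * (S * s - M) + (x - y)) ^ 2 + S * x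

/-- The time derivative of `coordPhase`; `a` is the derivative of the test function. -/
noncomputable def coordRate (a v Θ : ℂ) (T s x y S M : ℝ) : ℂ :=
  -I * x * a - I / 2 * (v + I * S) ^ 2 - I / (2 * T ^ 2) * (Θ + I * (S * s - M) + (x - y)) ^ 2
    + I / T * (Θ + I * (S * s - M) + (x - y)) * (v + I * S)

/-- The derivative of `coordPhase` in the position. -/
noncomputable def coordMomentum (v Θ : ℂ) (T s x y S M : ℝ) : ℂ :=
  -I * (v + I * S) + I / T * (Θ + I * (S * s - M) + (x - y))

/-- The Hamilton-Jacobi equation for the logarithm of the kernel, with linear potential `x a`. After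
abbreviating the bracket by `w` it is a polynomial identity in `w` and `v + I S`. -/
lemma coordRate_add_momentum_sq (a v Θ : ℂ) {T : ℝ} (hT : T ≠ 0) (s x y S M : ℝ) :
    I * coordRate a v Θ T s x y S M + 1 / 2 * coordMomentum v Θ T s x y S M ^ 2 = x * a := by
  have hT' : (T : ℂ) ≠ 0 := ofReal_ne_zero.2 hT
  unfold coordRate coordMomentum
  generalize Θ + I * (S * s - M) + ((x : ℂ) - y) = w
  field_simp
  ring_nf
  have h2 : I ^ 2 = -1 := I_sq
  simp only [h2]
  ring

/-- Differentiating `S Θ` and `I/2 S² s` yields exactly the terms that complete `-I/2 v²` to `-I/2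
(v + I S)²`. -/
lemma hasDerivAt_coordPhase {v Θ q : ℝ → ℂ} {a : ℂ} {s t₀ : ℝ} (hs : s ≠ t₀)
    (hv : HasDerivAt v a s) (hΘ : HasDerivAt Θ (v s) s) (hq : HasDerivAt q (v s ^ 2) s)
    (x y S M : ℝ) :
    HasDerivAt (fun u => coordPhase (v u) (Θ u) (q u) (u - t₀) u x y S M)
      (coordRate a (v s) (Θ s) (s - t₀) s x y S M) s := by
  have hT : ((s - t₀ : ℝ) : ℂ) ≠ 0 := ofReal_ne_zero.2 (sub_ne_zero.2 hs)
  have hid : HasDerivAt (fun u : ℝ => (u : ℂ)) 1 s := (hasDerivAt_id s).ofReal_comp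
  have hTd : HasDerivAt (fun u : ℝ => ((u - t₀ : ℝ) : ℂ)) 1 s := by
    simpa using ((hasDerivAt_id s).sub_const t₀).ofReal_comp
  have hw : HasDerivAt (fun u : ℝ => Θ u + I * (S * u - M) + ((x : ℂ) - y)) (v s + I * (S * 1)) s :=
    (hΘ.add (((hid.const_mul (S : ℂ)).sub_const (M : ℂ)).const_mul I)).add_const _
  have hinv := (hTd.const_mul 2).fun_inv (mul_ne_zero two_ne_zero hT)
  have h := (((((hv.const_mul (-I * x)).sub (hq.const_mul (I / 2))).add (hΘ.const_mul (S : ℂ))).add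
    (hid.const_mul (I / 2 * (S : ℂ) ^ 2))).add ((hinv.const_mul I).mul (hw.pow 2))).add_const
    ((S : ℂ) * x)
  unfold coordPhase
  simp only [div_eq_mul_inv] at h ⊢
  refine h.congr_deriv ?_
  unfold coordRate
  push_cast at hT ⊢
  field_simp
  have h2 : I ^ 2 = -1 := I_sq
  have h3 : I ^ 3 = -I := by rw [pow_succ, h2]; ring
  simp only [Pi.pow_apply]
  field_simp
  ring_nf
  simp only [h2, h3]
  ring

lemma hasDerivAt_coordPhase_pos (v Θ q : ℂ) {T : ℝ} (hT : T ≠ 0) (s x y S M : ℝ) :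
    HasDerivAt (fun u : ℝ => coordPhase v Θ q T s (x + u) y S M)
      (coordMomentum v Θ T s x y S M) 0 := by
  have hT' : (T : ℂ) ≠ 0 := ofReal_ne_zero.2 hT
  have hid : HasDerivAt (fun u : ℝ => ((x + u : ℝ) : ℂ)) 1 0 := by
    simpa using ((hasDerivAt_id (0 : ℝ)).const_add x).ofReal_comp
  have hw : HasDerivAt (fun u : ℝ => Θ + I * (S * s - M) + (((x + u : ℝ) : ℂ) - y)) 1 0 :=
    (hid.sub_const (y : ℂ)).const_add _
  have h := (((((((hid.const_mul (-I)).mul_const v).sub_const (I / 2 * q)).add_const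
    ((S : ℂ) * Θ)).add_const (I / 2 * (S : ℂ) ^ 2 * s))).add ((hw.pow 2).const_mul
      (I / (2 * T)))).add (hid.const_mul (S : ℂ))
  unfold coordPhase
  refine h.congr_deriv ?_
  unfold coordMomentum
  push_cast
  field_simp
  ring_nf
  simp only [I_sq]
  ring

lemma hasDerivAt_coordMomentum_pos (v Θ : ℂ) (T s x y S M : ℝ) :
    HasDerivAt (fun u : ℝ => coordMomentum v Θ T s (x + u) y S M) (I / T) 0 := by
  have hid : HasDerivAt (fun u : ℝ => ((x + u : ℝ) : ℂ)) 1 0 := by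
    simpa using ((hasDerivAt_id (0 : ℝ)).const_add x).ofReal_comp
  have hw : HasDerivAt (fun u : ℝ => Θ + I * (S * s - M) + (((x + u : ℝ) : ℂ) - y)) 1 0 :=
    (hid.sub_const (y : ℂ)).const_add _
  have h := (hw.const_mul (I / T)).const_add (-I * (v + I * S))
  rw [mul_one] at h
  exact h

/-- Writing the bracket as `z + I r` with `r = S s - M` real, both terms quadratic in the sources,
`I/2 S² s` and `-I r² / (2T)`, are purely imaginary. The real part is therefore at most linear in
`|S|` and `|M|`, which is what lets exponential moments control Gaussian-looking terms. The constant
`20` is generous. -/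
lemma re_coordPhase_le {v Θ q : ℂ} {T s x y S M B : ℝ} (hT : 0 < T) (hB : 1 ≤ B) (hv : ‖v‖ ≤ B)
    (hΘ : ‖Θ‖ ≤ B) (hq : ‖q‖ ≤ B) (hs : |s| ≤ B) (hTB : T⁻¹ ≤ B) (hx : |x| ≤ B) (hy : |y| ≤ B) :
    (coordPhase v Θ q T s x y S M).re ≤ 20 * B ^ 3 * (1 + |S| + |M|) := by
  set z : ℂ := Θ + (x - y) with hz
  set r : ℝ := S * s - M with hr
  have hzB : ‖z‖ ≤ 3 * B := by
    have h1 : ‖((x : ℂ) - y)‖ ≤ |x| + |y| := by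
      refine (norm_sub_le _ _).trans ?_
      rw [norm_real, norm_real, Real.norm_eq_abs, Real.norm_eq_abs]
    linarith [norm_add_le Θ ((x : ℂ) - y)]
  have hrB : |r| ≤ B * |S| + |M| := by
    refine (abs_sub _ _).trans ?_
    rw [abs_mul, mul_comm]
    gcongr
  have hid : coordPhase v Θ q T s x y S M = -I * x * v - I / 2 * q + S * Θ + S * x
      + I / 2 * T⁻¹ * z ^ 2 - T⁻¹ * r * z + ((S ^ 2 * s / 2 - T⁻¹ * r ^ 2 / 2 : ℝ) : ℂ) * I := by
    have hT' : (T : ℂ) ≠ 0 := ofReal_ne_zero.2 hT.ne'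
    rw [coordPhase, hz, hr]
    push_cast
    field_simp
    ring_nf
    have h2 : I ^ 2 = -1 := I_sq
    have h3 : I ^ 3 = -I := by rw [pow_succ, h2]; ring
    simp only [h2, h3]
    ring
  have hre : (coordPhase v Θ q T s x y S M).re ≤ ‖-I * x * v - I / 2 * q + S * Θ + S * x
      + I / 2 * T⁻¹ * z ^ 2 - T⁻¹ * r * z‖ := by
    rw [hid, add_re, re_ofReal_mul, I_re, mul_zero, add_zero]
    exact re_le_norm _
  refine hre.trans ?_
  have hn : ‖-I * x * v - I / 2 * q + S * Θ + S * x + I / 2 * T⁻¹ * z ^ 2 - T⁻¹ * r * z‖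
      ≤ |x| * ‖v‖ + 1 / 2 * ‖q‖ + |S| * ‖Θ‖ + |S| * |x| + 1 / 2 * T⁻¹ * ‖z‖ ^ 2
        + T⁻¹ * |r| * ‖z‖ := by
    refine (norm_sub_le _ _).trans (add_le_add ((norm_add_le _ _).trans (add_le_add
      ((norm_add_le _ _).trans (add_le_add ((norm_add_le _ _).trans (add_le_add
      ((norm_sub_le _ _).trans (add_le_add ?_ ?_)) ?_)) ?_)) ?_)) ?_) <;>
    simp [abs_of_pos hT]
  refine hn.trans ?_
  have hT0 : 0 ≤ T⁻¹ := by positivity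
  have hB0 : 0 ≤ B := by linarith
  calc |x| * ‖v‖ + 1 / 2 * ‖q‖ + |S| * ‖Θ‖ + |S| * |x| + 1 / 2 * T⁻¹ * ‖z‖ ^ 2
        + T⁻¹ * |r| * ‖z‖
      ≤ B * B + 1 / 2 * B + |S| * B + |S| * B + 1 / 2 * B * (3 * B) ^ 2
        + B * (B * |S| + |M|) * (3 * B) := by gcongr
    _ = (B ^ 2 + B / 2 + 9 / 2 * B ^ 3) + (2 * B + 3 * B ^ 3) * |S| + 3 * B ^ 2 * |M| := by ring
    _ ≤ 20 * B ^ 3 + 20 * B ^ 3 * |S| + 20 * B ^ 3 * |M| := by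
      have h2 : B ≤ B ^ 3 := le_self_pow₀ hB (by norm_num)
      have h3 : B ^ 2 ≤ B ^ 3 := pow_le_pow_right₀ hB (by norm_num)
      gcongr <;> linarith
    _ = _ := by ring

/-- No cancellation is needed here: the rate is a quadratic polynomial in the sources, later
absorbed by an exponential. -/
lemma norm_coordRate_le {a v Θ : ℂ} {T s x y S M B : ℝ} (hT : 0 < T) (hB : 1 ≤ B) (ha : ‖a‖ ≤ B)
    (hv : ‖v‖ ≤ B) (hΘ : ‖Θ‖ ≤ B) (hs : |s| ≤ B) (hTB : T⁻¹ ≤ B) (hx : |x| ≤ B) (hy : |y| ≤ B) :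
    ‖coordRate a v Θ T s x y S M‖ ≤ 20 * B ^ 4 * (1 + |S| + |M|) ^ 2 := by
  set w : ℂ := Θ + I * (S * s - M) + (x - y) with hw
  set u : ℂ := v + I * S with hu
  set L := 1 + |S| + |M| with hL
  have hB0 : 0 ≤ B := by linarith
  have hL1 : 1 ≤ L := by linarith [abs_nonneg S, abs_nonneg M]
  have hwB : ‖w‖ ≤ 3 * B * L := by
    have h1 : ‖((x : ℂ) - y)‖ ≤ |x| + |y| := by
      refine (norm_sub_le _ _).trans ?_
      rw [norm_real, norm_real, Real.norm_eq_abs, Real.norm_eq_abs]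
    have h2 : ‖I * ((S : ℂ) * s - M)‖ ≤ B * |S| + |M| := by
      rw [norm_mul, norm_I, one_mul]
      refine (norm_sub_le _ _).trans ?_
      rw [norm_mul, norm_real, norm_real, norm_real, Real.norm_eq_abs, Real.norm_eq_abs,
        Real.norm_eq_abs, mul_comm]
      gcongr
    have h3 : ‖w‖ ≤ ‖Θ‖ + ‖I * ((S : ℂ) * s - M)‖ + ‖((x : ℂ) - y)‖ := norm_add₃_le
    have h4 : |M| ≤ B * |M| := le_mul_of_one_le_left (abs_nonneg _) hB
    calc ‖w‖ ≤ 3 * B + B * |S| + B * |M| := by linarith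
      _ ≤ 3 * B + 3 * B * |S| + 3 * B * |M| := by gcongr <;> linarith
      _ = 3 * B * L := by rw [hL]; ring
  have huB : ‖u‖ ≤ B * L := by
    have h1 : ‖u‖ ≤ ‖v‖ + |S| := by
      refine (norm_add_le _ _).trans ?_
      rw [norm_mul, norm_I, one_mul, norm_real, Real.norm_eq_abs]
    have h2 : |S| ≤ B * |S| := le_mul_of_one_le_left (abs_nonneg _) hB
    have h3 : 0 ≤ B * |M| := by positivity
    rw [hL]; linarith
  have hT0 : 0 ≤ T⁻¹ := by positivity
  have hn : ‖coordRate a v Θ T s x y S M‖ ≤ |x| * ‖a‖ + 1 / 2 * ‖u‖ ^ 2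
      + 1 / 2 * T⁻¹ ^ 2 * ‖w‖ ^ 2 + T⁻¹ * ‖w‖ * ‖u‖ := by
    rw [coordRate, ← hw, ← hu]
    refine (norm_add_le _ _).trans (add_le_add ((norm_sub_le _ _).trans (add_le_add
      ((norm_sub_le _ _).trans (add_le_add ?_ ?_)) ?_)) ?_)
    · simp
    · simp
    · simp [mul_comm]
    · simp [abs_of_pos hT]
  refine hn.trans ?_
  calc |x| * ‖a‖ + 1 / 2 * ‖u‖ ^ 2 + 1 / 2 * T⁻¹ ^ 2 * ‖w‖ ^ 2 + T⁻¹ * ‖w‖ * ‖u‖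
      ≤ B * B + 1 / 2 * (B * L) ^ 2 + 1 / 2 * B ^ 2 * (3 * B * L) ^ 2
        + B * (3 * B * L) * (B * L) := by gcongr
    _ = B ^ 2 * 1 + (B ^ 2 / 2 + 9 / 2 * B ^ 4 + 3 * B ^ 3) * L ^ 2 := by ring
    _ ≤ B ^ 4 * L ^ 2 + (B ^ 4 / 2 + 9 / 2 * B ^ 4 + 3 * B ^ 4) * L ^ 2 := by
      have h2 : B ^ 2 ≤ B ^ 4 := pow_le_pow_right₀ hB (by norm_num)
      have h3 : B ^ 3 ≤ B ^ 4 := pow_le_pow_right₀ hB (by norm_num)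
      have h4 : 1 ≤ L ^ 2 := one_le_pow₀ hL1
      gcongr
    _ ≤ 20 * B ^ 4 * L ^ 2 := by
      have : 0 ≤ B ^ 4 * L ^ 2 := by positivity
      linarith

end CoordinatePhase

/-! ### The free kernel with sources: derivatives, equation, bounds, factorisations. -/

section FreeKernel

open Complex Filter Topology

variable {d : ℕ}

lemma hasDerivAt_testFun_apply (θ : TestFun d) (s : ℝ) (k : Fin d) :
    HasDerivAt (fun u => θ u k) (deriv (⇑θ) s k) s := by
  have h : HasDerivAt (⇑θ) (deriv (⇑θ) s) s := θ.differentiableAt.hasDerivAt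
  exact (((EuclideanSpace.proj (𝕜 := ℂ) k).restrictScalars ℝ).hasFDerivAt.comp_hasDerivAt s h)

lemma continuous_testFun_apply (θ : TestFun d) (k : Fin d) : Continuous fun u => θ u k :=
  (EuclideanSpace.proj (𝕜 := ℂ) k).continuous.comp θ.continuous

lemma continuous_deriv_testFun_apply (θ : TestFun d) (k : Fin d) :
    Continuous fun u => deriv (⇑θ) u k :=
  (EuclideanSpace.proj (𝕜 := ℂ) k).continuous.comp ((θ.smooth 1).continuous_deriv le_rfl)

/-- The time integral of a coordinate of the test function. -/
noncomputable def accum (θ : TestFun d) (t₀ : ℝ) (k : Fin d) (s : ℝ) : ℂ := ∫ u in t₀..s, θ u k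

/-- The time integral of the square of a coordinate of the test function. -/
noncomputable def accumSq (θ : TestFun d) (t₀ : ℝ) (k : Fin d) (s : ℝ) : ℂ :=
  ∫ u in t₀..s, θ u k ^ 2

lemma hasDerivAt_accum (θ : TestFun d) (t₀ : ℝ) (k : Fin d) (s : ℝ) :
    HasDerivAt (accum θ t₀ k) (θ s k) s :=
  (continuous_testFun_apply θ k).integral_hasStrictDerivAt t₀ s |>.hasDerivAt

lemma hasDerivAt_accumSq (θ : TestFun d) (t₀ : ℝ) (k : Fin d) (s : ℝ) :
    HasDerivAt (accumSq θ t₀ k) (θ s k ^ 2) s :=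
  ((continuous_testFun_apply θ k).pow 2).integral_hasStrictDerivAt t₀ s |>.hasDerivAt

lemma continuous_accum (θ : TestFun d) (t₀ : ℝ) (k : Fin d) : Continuous (accum θ t₀ k) :=
  continuous_iff_continuousAt.2 fun s => (hasDerivAt_accum θ t₀ k s).continuousAt

lemma continuous_accumSq (θ : TestFun d) (t₀ : ℝ) (k : Fin d) : Continuous (accumSq θ t₀ k) :=
  continuous_iff_continuousAt.2 fun s => (hasDerivAt_accumSq θ t₀ k s).continuousAt

variable (θ : TestFun d) (x₀ : Pos d) (t₀ : ℝ)

/-- The free propagator with sources; `S = ∑ αⱼ` and `M = ∑ αⱼ τⱼ`. -/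
noncomputable def freeKernel (x : Pos d) (s : ℝ) (S M : Pos d) : ℂ :=
  (2 * (Real.pi : ℂ) * I * ((s - t₀ : ℝ) : ℂ)) ^ (-((d : ℂ) / 2)) *
    cexp (I * dotC x₀ (θ t₀) + ∑ k, coordPhase (θ s k) (accum θ t₀ k s) (accumSq θ t₀ k s)
      (s - t₀) s (x k) (x₀ k) (S k) (M k))

/-- The logarithmic time derivative of `freeKernel`. -/
noncomputable def freeRate (x : Pos d) (s : ℝ) (S M : Pos d) : ℂ :=
  -((d : ℂ) / 2) / ((s - t₀ : ℝ) : ℂ) + ∑ k, coordRate (deriv (⇑θ) s k) (θ s k) (accum θ t₀ k s)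
    (s - t₀) s (x k) (x₀ k) (S k) (M k)

/-- The logarithmic derivative of `freeKernel` in the direction of a coordinate. -/
noncomputable def freeMomentum (k : Fin d) (x : Pos d) (s : ℝ) (S M : Pos d) : ℂ :=
  coordMomentum (θ s k) (accum θ t₀ k s) (s - t₀) s (x k) (x₀ k) (S k) (M k)

variable {t₀}

lemma hasDerivAt_prefactor {s : ℝ} (hs : t₀ < s) (c : ℂ) :
    HasDerivAt (fun u : ℝ => (2 * (Real.pi : ℂ) * I * ((u - t₀ : ℝ) : ℂ)) ^ c)
      ((2 * (Real.pi : ℂ) * I * ((s - t₀ : ℝ) : ℂ)) ^ c * (c / ((s - t₀ : ℝ) : ℂ))) s := by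
  have hT : 0 < s - t₀ := sub_pos.2 hs
  have hTd : HasDerivAt (fun u : ℝ => ((u - t₀ : ℝ) : ℂ)) 1 s := by
    simpa using ((hasDerivAt_id s).sub_const t₀).ofReal_comp
  have h1 := hTd.const_mul (2 * (Real.pi : ℂ) * I)
  have him : (2 * (Real.pi : ℂ) * I * ((s - t₀ : ℝ) : ℂ)).im = 2 * Real.pi * (s - t₀) := by
    simp
  -- For `s > t₀` the base lies on the positive imaginary axis, off the branch cut.
  have hmem : 2 * (Real.pi : ℂ) * I * ((s - t₀ : ℝ) : ℂ) ∈ slitPlane := by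
    refine mem_slitPlane_iff.2 (Or.inr ?_)
    rw [him]; positivity
  have hT' : ((s - t₀ : ℝ) : ℂ) ≠ 0 := ofReal_ne_zero.2 hT.ne'
  have hpi : (Real.pi : ℂ) ≠ 0 := ofReal_ne_zero.2 Real.pi_ne_zero
  refine (((hasDerivAt_id _).cpow_const (c := c) hmem).comp s h1).congr_deriv ?_
  simp only [id_eq]
  rw [cpow_sub _ _ (slitPlane_ne_zero hmem), cpow_one]
  have := I_ne_zero
  field_simp

lemma hasDerivAt_freeKernel {s : ℝ} (hs : t₀ < s) (x S M : Pos d) :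
    HasDerivAt (fun u => freeKernel θ x₀ t₀ x u S M)
      (freeKernel θ x₀ t₀ x s S M * freeRate θ x₀ t₀ x s S M) s := by
  have h1 := hasDerivAt_prefactor hs (-((d : ℂ) / 2))
  have h2 := HasDerivAt.fun_sum (u := Finset.univ) fun (k : Fin d) _ =>
    hasDerivAt_coordPhase (t₀ := t₀) hs.ne' (hasDerivAt_testFun_apply θ s k)
      (hasDerivAt_accum θ t₀ k s) (hasDerivAt_accumSq θ t₀ k s) (x k) (x₀ k) (S k) (M k)
  refine (h1.mul ((h2.const_add (I * dotC x₀ (θ t₀))).cexp)).congr_deriv ?_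
  unfold freeKernel freeRate
  ring

lemma hasDerivAt_freeKernel_line {s : ℝ} (hs : t₀ < s) (k : Fin d) (x S M : Pos d) :
    HasDerivAt (fun u : ℝ => freeKernel θ x₀ t₀ (x + u • EuclideanSpace.single k (1 : ℝ)) s S M)
      (freeKernel θ x₀ t₀ x s S M * freeMomentum θ x₀ t₀ k x s S M) 0 := by
  have hT : s - t₀ ≠ 0 := (sub_pos.2 hs).ne'
  have h2 : HasDerivAt (fun u : ℝ => ∑ j, coordPhase (θ s j) (accum θ t₀ j s) (accumSq θ t₀ j s)
      (s - t₀) s ((x + u • EuclideanSpace.single k (1 : ℝ) : Pos d) j) (x₀ j) (S j) (M j))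
      (∑ j, if j = k then freeMomentum θ x₀ t₀ k x s S M else 0) 0 := by
    refine HasDerivAt.fun_sum fun j _ => ?_
    by_cases hj : j = k
    · subst hj
      simpa [freeMomentum] using hasDerivAt_coordPhase_pos (θ s j) (accum θ t₀ j s)
        (accumSq θ t₀ j s) hT s (x j) (x₀ j) (S j) (M j)
    · simpa [hj] using hasDerivAt_const (0 : ℝ) (coordPhase (θ s j) (accum θ t₀ j s)
        (accumSq θ t₀ j s) (s - t₀) s (x j) (x₀ j) (S j) (M j))
  simp only [Finset.sum_ite_eq', Finset.mem_univ, if_true] at h2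
  refine (((h2.const_add (I * dotC x₀ (θ t₀))).cexp).const_mul _).congr_deriv ?_
  simp only [freeKernel, zero_smul, add_zero]
  ring

lemma hasDerivAt_freeKernel_mul_freeMomentum_line {s : ℝ} (hs : t₀ < s) (k : Fin d)
    (x S M : Pos d) :
    HasDerivAt (fun u : ℝ => freeKernel θ x₀ t₀ (x + u • EuclideanSpace.single k (1 : ℝ)) s S M *
        freeMomentum θ x₀ t₀ k (x + u • EuclideanSpace.single k (1 : ℝ)) s S M)
      (freeKernel θ x₀ t₀ x s S M *
        (freeMomentum θ x₀ t₀ k x s S M ^ 2 + I / ((s - t₀ : ℝ) : ℂ))) 0 := by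
  have h1 := hasDerivAt_freeKernel_line θ x₀ hs k x S M
  have h2 : HasDerivAt (fun u : ℝ =>
      freeMomentum θ x₀ t₀ k (x + u • EuclideanSpace.single k (1 : ℝ)) s S M)
      (I / ((s - t₀ : ℝ) : ℂ)) 0 := by
    simpa [freeMomentum] using hasDerivAt_coordMomentum_pos (θ s k) (accum θ t₀ k s) (s - t₀) s
      (x k) (x₀ k) (S k) (M k)
  refine (h1.mul h2).congr_deriv ?_
  simp only [zero_smul, add_zero]
  ring

/-- The free kernel solves the Schrödinger equation with the linear potential `x · θ'`. -/
lemma freeKernel_schrodinger {s : ℝ} (hs : t₀ < s) (x S M : Pos d) :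
    I * (freeKernel θ x₀ t₀ x s S M * freeRate θ x₀ t₀ x s S M) +
      1 / 2 * ∑ k, freeKernel θ x₀ t₀ x s S M *
        (freeMomentum θ x₀ t₀ k x s S M ^ 2 + I / ((s - t₀ : ℝ) : ℂ))
      = dotC x (deriv (⇑θ) s) * freeKernel θ x₀ t₀ x s S M := by
  have hT : s - t₀ ≠ 0 := (sub_pos.2 hs).ne'
  -- The Hamilton-Jacobi identity handles each coordinate. What is left is `I · (-d/2) / T` from the
  -- prefactor and `d/2 · I / T` from the second derivatives, which cancel.
  have h : ∀ k, (x k : ℂ) * deriv (⇑θ) s k = I * coordRate (deriv (⇑θ) s k) (θ s k)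
      (accum θ t₀ k s) (s - t₀) s (x k) (x₀ k) (S k) (M k)
      + 1 / 2 * freeMomentum θ x₀ t₀ k x s S M ^ 2 := fun k =>
    (coordRate_add_momentum_sq _ _ _ hT _ _ _ _ _).symm
  rw [dotC, Finset.sum_congr rfl fun k _ => h k, ← Finset.mul_sum, Finset.sum_add_distrib,
    Finset.sum_add_distrib, ← Finset.mul_sum, ← Finset.mul_sum, freeRate]
  simp only [Finset.sum_const, Finset.card_univ, Fintype.card_fin, nsmul_eq_mul]
  ring

lemma continuous_freeKernel_sources (x : Pos d) (s : ℝ) :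
    Continuous fun q : Pos d × Pos d => freeKernel θ x₀ t₀ x s q.1 q.2 := by
  unfold freeKernel coordPhase
  fun_prop

lemma continuous_freeRate_sources (x : Pos d) (s : ℝ) :
    Continuous fun q : Pos d × Pos d => freeRate θ x₀ t₀ x s q.1 q.2 := by
  unfold freeRate coordRate
  fun_prop

lemma continuous_freeMomentum_sources (k : Fin d) (x : Pos d) (s : ℝ) :
    Continuous fun q : Pos d × Pos d => freeMomentum θ x₀ t₀ k x s q.1 q.2 := by
  unfold freeMomentum coordMomentum
  fun_prop

lemma abs_coord_le (S : Pos d) (k : Fin d) : |S k| ≤ ‖S‖ := by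
  rw [← Real.norm_eq_abs]; exact PiLp.norm_apply_le S k

/-- Locally uniformly in time, the free kernel and its time derivative are exponentially bounded
in the sources. -/
lemma exists_freeKernel_bound (x : Pos d) {t₁ t₂ : ℝ} (h₁ : t₀ < t₁) :
    ∃ C, 0 ≤ C ∧ ∀ s ∈ Icc t₁ t₂, ∀ S M : Pos d,
      ‖freeKernel θ x₀ t₀ x s S M‖ ≤ C * Real.exp (C * (‖S‖ + ‖M‖)) ∧
      ‖freeKernel θ x₀ t₀ x s S M * freeRate θ x₀ t₀ x s S M‖
        ≤ C * Real.exp (C * (‖S‖ + ‖M‖)) := by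
  have hK : IsCompact (Icc t₁ t₂) := isCompact_Icc
  have hb : ∀ f : ℝ → ℂ, ContinuousOn f (Icc t₁ t₂) → ∃ B, ∀ s ∈ Icc t₁ t₂, ‖f s‖ ≤ B := fun f hf =>
    hK.exists_bound_of_continuousOn hf
  choose B₁ hB₁ using fun k => hb _ (continuous_testFun_apply θ k).continuousOn
  choose B₂ hB₂ using fun k => hb _ (continuous_deriv_testFun_apply θ k).continuousOn
  choose B₃ hB₃ using fun k => hb _ (continuous_accum θ t₀ k).continuousOn
  choose B₄ hB₄ using fun k => hb _ (continuous_accumSq θ t₀ k).continuousOn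
  obtain ⟨B₅, hB₅⟩ := hb (fun s => (s : ℂ)) continuous_ofReal.continuousOn
  obtain ⟨N, hN⟩ := hb (fun u : ℝ => (2 * (Real.pi : ℂ) * I * ((u - t₀ : ℝ) : ℂ)) ^
    (-((d : ℂ) / 2)) * cexp (I * dotC x₀ (θ t₀))) fun s hs =>
    ((hasDerivAt_prefactor (h₁.trans_le hs.1) _).continuousAt.mul
      continuousAt_const).continuousWithinAt
  -- One number bounds every quantity in the coordinate estimates; `(s - t₀)⁻¹` stays below `(t₁ -
  -- t₀)⁻¹` because `t₁ > t₀`.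
  set B : ℝ := 1 + ∑ k, (|B₁ k| + |B₂ k| + |B₃ k| + |B₄ k|) + |B₅| + (t₁ - t₀)⁻¹ + ‖x‖ + ‖x₀‖
    with hB
  have hT₁ : 0 < t₁ - t₀ := sub_pos.2 h₁
  have hsum0 : 0 ≤ ∑ k, (|B₁ k| + |B₂ k| + |B₃ k| + |B₄ k|) :=
    Finset.sum_nonneg fun k _ => by positivity
  have hsum : ∀ k, |B₁ k| + |B₂ k| + |B₃ k| + |B₄ k| ≤
      ∑ k, (|B₁ k| + |B₂ k| + |B₃ k| + |B₄ k|) := fun k =>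
    Finset.single_le_sum (f := fun k => |B₁ k| + |B₂ k| + |B₃ k| + |B₄ k|)
      (fun k _ => by positivity) (Finset.mem_univ k)
  have hinv0 : 0 ≤ (t₁ - t₀)⁻¹ := by positivity
  have hBk : ∀ k, 1 ≤ B ∧ B₁ k ≤ B ∧ B₂ k ≤ B ∧ B₃ k ≤ B ∧ B₄ k ≤ B := fun k => by
    have := hsum k
    refine ⟨?_, ?_, ?_, ?_, ?_⟩ <;>
    linarith [abs_nonneg (B₁ k), abs_nonneg (B₂ k), abs_nonneg (B₃ k), abs_nonneg (B₄ k),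
      abs_nonneg B₅, norm_nonneg x, norm_nonneg x₀, le_abs_self (B₁ k), le_abs_self (B₂ k),
      le_abs_self (B₃ k), le_abs_self (B₄ k)]
  have hB1 : 1 ≤ B := by linarith [abs_nonneg B₅, norm_nonneg x, norm_nonneg x₀]
  have hB5 : B₅ ≤ B := by linarith [le_abs_self B₅, norm_nonneg x, norm_nonneg x₀]
  have hBT : (t₁ - t₀)⁻¹ ≤ B := by linarith [abs_nonneg B₅, norm_nonneg x, norm_nonneg x₀]
  have hBx : ‖x‖ ≤ B := by linarith [abs_nonneg B₅, norm_nonneg x₀]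
  have hBx₀ : ‖x₀‖ ≤ B := by linarith [abs_nonneg B₅, norm_nonneg x]
  have hB0 : 0 ≤ B := by linarith
  set D : ℝ := d * (20 * B ^ 3) with hD
  have hD0 : 0 ≤ D := by positivity
  set R : ℝ := d * B + d * (20 * B ^ 4) with hR
  have hR0 : 0 ≤ R := by positivity
  -- `C` serves both as factor and as exponential rate: `D` is the rate of the kernel, and the
  -- additional `2` absorbs the quadratic growth `L ^ 2` of the logarithmic derivative.
  set C : ℝ := |N| * Real.exp D * (1 + R) + D + 2 with hC
  have hC0 : 0 ≤ |N| * Real.exp D * (1 + R) := by positivity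
  have hCnn : 0 ≤ C := by rw [hC]; positivity
  clear_value B D R C
  refine ⟨C, hCnn, fun s hs S M => ?_⟩
  have hsT : 0 < s - t₀ := sub_pos.2 (h₁.trans_le hs.1)
  have hsB : |s| ≤ B := by
    have := hB₅ s hs
    rw [norm_real, Real.norm_eq_abs] at this
    exact this.trans hB5
  have hTB : (s - t₀)⁻¹ ≤ B :=
    (inv_anti₀ hT₁ (by linarith [hs.1])).trans hBT
  have hL : ∀ k, 1 + |S k| + |M k| ≤ 1 + (‖S‖ + ‖M‖) := fun k => by
    linarith [abs_coord_le S k, abs_coord_le M k]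
  set L := 1 + (‖S‖ + ‖M‖) with hLdef
  have hL1 : 1 ≤ L := by linarith [norm_nonneg S, norm_nonneg M]
  have hker : ‖freeKernel θ x₀ t₀ x s S M‖ ≤ |N| * Real.exp D * Real.exp (D * (‖S‖ + ‖M‖)) := by
    rw [freeKernel, Complex.exp_add, ← mul_assoc, norm_mul, norm_exp, mul_assoc |N|,
      ← Real.exp_add]
    refine mul_le_mul ((hN s hs).trans (le_abs_self _)) (Real.exp_le_exp.2 ?_)
      (Real.exp_pos _).le (abs_nonneg _)
    rw [re_sum]
    have hk : ∀ k ∈ Finset.univ, (coordPhase (θ s k) (accum θ t₀ k s) (accumSq θ t₀ k s)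
        (s - t₀) s (x k) (x₀ k) (S k) (M k)).re ≤ 20 * B ^ 3 * L := fun k _ => by
      obtain ⟨h1, h2, h3, h4, h5⟩ := hBk k
      refine (re_coordPhase_le hsT h1 ((hB₁ k s hs).trans h2) ((hB₃ k s hs).trans h4)
        ((hB₄ k s hs).trans h5) hsB hTB ((abs_coord_le x k).trans hBx)
        ((abs_coord_le x₀ k).trans hBx₀)).trans ?_
      exact mul_le_mul_of_nonneg_left (hL k) (by positivity)
    refine (Finset.sum_le_card_nsmul _ _ _ hk).trans (le_of_eq ?_)
    rw [Finset.card_univ, Fintype.card_fin, nsmul_eq_mul, hD, hLdef]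
    ring
  have hrate : ‖freeRate θ x₀ t₀ x s S M‖ ≤ R * L ^ 2 := by
    have hk : ∀ k ∈ Finset.univ, ‖coordRate (deriv (⇑θ) s k) (θ s k) (accum θ t₀ k s)
        (s - t₀) s (x k) (x₀ k) (S k) (M k)‖ ≤ 20 * B ^ 4 * L ^ 2 := fun k _ => by
      obtain ⟨h1, h2, h3, h4, h5⟩ := hBk k
      refine (norm_coordRate_le hsT h1 ((hB₂ k s hs).trans h3) ((hB₁ k s hs).trans h2)
        ((hB₃ k s hs).trans h4) hsB hTB ((abs_coord_le x k).trans hBx)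
        ((abs_coord_le x₀ k).trans hBx₀)).trans ?_
      have := hL k
      gcongr
    have h1 : ‖-((d : ℂ) / 2) / ((s - t₀ : ℝ) : ℂ)‖ ≤ d * B := by
      rw [norm_div, norm_neg, norm_div, norm_real, Real.norm_of_nonneg hsT.le, div_eq_mul_inv]
      simp only [norm_natCast, Complex.norm_two]
      have : (d : ℝ) / 2 ≤ d := half_le_self (by positivity)
      gcongr
    have h2 : (d : ℝ) * B ≤ d * B * L ^ 2 :=
      le_mul_of_one_le_right (by positivity) (one_le_pow₀ hL1)
    rw [freeRate]
    refine (norm_add_le _ _).trans ?_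
    refine (add_le_add (h1.trans h2) ((norm_sum_le _ _).trans
      (Finset.sum_le_card_nsmul _ _ _ hk))).trans (le_of_eq ?_)
    rw [Finset.card_univ, Fintype.card_fin, nsmul_eq_mul, hR]
    ring
  have hSM : 0 ≤ ‖S‖ + ‖M‖ := by positivity
  have hLexp : L ^ 2 ≤ Real.exp (2 * (‖S‖ + ‖M‖)) := by
    have h1 : L ≤ Real.exp (‖S‖ + ‖M‖) := by
      rw [hLdef, add_comm]; exact Real.add_one_le_exp _
    calc L ^ 2 ≤ Real.exp (‖S‖ + ‖M‖) ^ 2 := by gcongr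
      _ = _ := by rw [← Real.exp_nat_mul]; norm_num
  have hND : |N| * Real.exp D ≤ C := by
    have : |N| * Real.exp D ≤ |N| * Real.exp D * (1 + R) :=
      le_mul_of_one_le_right (by positivity) (by linarith)
    linarith
  constructor
  · refine hker.trans ?_
    have : D ≤ C := by linarith
    gcongr
  · rw [norm_mul]
    calc ‖freeKernel θ x₀ t₀ x s S M‖ * ‖freeRate θ x₀ t₀ x s S M‖
        ≤ (|N| * Real.exp D * Real.exp (D * (‖S‖ + ‖M‖))) *
          (R * Real.exp (2 * (‖S‖ + ‖M‖))) := by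
          refine mul_le_mul hker (hrate.trans ?_) (norm_nonneg _) (by positivity)
          gcongr
      _ = (|N| * Real.exp D * R) * Real.exp ((D + 2) * (‖S‖ + ‖M‖)) := by
          rw [show (D + 2) * (‖S‖ + ‖M‖) = D * (‖S‖ + ‖M‖) + 2 * (‖S‖ + ‖M‖) by ring,
            Real.exp_add]
          ring
      _ ≤ C * Real.exp (C * (‖S‖ + ‖M‖)) := by
          have h1 : |N| * Real.exp D * R ≤ C := by
            have : |N| * Real.exp D * R ≤ |N| * Real.exp D * (1 + R) :=
              mul_le_mul_of_nonneg_left (by linarith) (by positivity)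
            linarith
          have h2 : D + 2 ≤ C := by linarith
          exact mul_le_mul h1 (Real.exp_le_exp.2 (mul_le_mul_of_nonneg_right h2 hSM))
            (Real.exp_pos _).le (by linarith)

/-- Adding a source at the current time multiplies the free kernel by a plane wave, up to the
self-interaction of the sources. -/
lemma freeKernel_add_source (x : Pos d) (s : ℝ) (S M α : Pos d) :
    freeKernel θ x₀ t₀ x s (S + α) (M + s • α) =
      cexp (inner ℝ α x : ℝ) * cexp (∑ k, (α k * accum θ t₀ k s +
        I / 2 * (s * (α k ^ 2 + 2 * α k * S k)))) * freeKernel θ x₀ t₀ x s S M := by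
  -- Adding `(α, s α)` to `(S, M)` leaves `S s - M` unchanged, so the term divided by `s - t₀` drops
  -- out of the comparison.
  have h : ∀ k, coordPhase (θ s k) (accum θ t₀ k s) (accumSq θ t₀ k s) (s - t₀) s (x k) (x₀ k)
      ((S + α) k) ((M + s • α) k) = (α k * x k : ℝ) + (α k * accum θ t₀ k s +
        I / 2 * (s * (α k ^ 2 + 2 * α k * S k))) + coordPhase (θ s k) (accum θ t₀ k s)
          (accumSq θ t₀ k s) (s - t₀) s (x k) (x₀ k) (S k) (M k) := fun k => by
    simp only [coordPhase, PiLp.add_apply, PiLp.smul_apply, smul_eq_mul]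
    push_cast
    ring
  have hin : (inner ℝ α x : ℝ) = ∑ k, α k * x k := by
    rw [PiLp.inner_apply]
    exact Finset.sum_congr rfl fun k _ => by simp [mul_comm]
  rw [freeKernel, Finset.sum_congr rfl fun k _ => h k, Finset.sum_add_distrib,
    Finset.sum_add_distrib, freeKernel, hin, ofReal_sum, Complex.exp_add, Complex.exp_add,
    Complex.exp_add, Complex.exp_add]
  ring

/-- The real exponent through which the sources couple to the position. -/
noncomputable def sourceDrift (t₀ s : ℝ) (S M : Pos d) : Pos d :=
  S - (s - t₀)⁻¹ • (s • S - M)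

/-- The Gaussian factor of the free kernel. -/
noncomputable def gaussFactor (t₀ s : ℝ) (y : Pos d) : ℂ :=
  cexp (∑ k, (-I * y k * θ s k +
    I / (2 * ((s - t₀ : ℝ) : ℂ)) * (y k ^ 2 + 2 * y k * (accum θ t₀ k s - x₀ k))))

/-- The terms quadratic in `y` do not involve the sources, and the cross terms of `y` with the
sources are real. An integral over sources is thus a Gaussian factor times a genuine Laplace
transform in `y`. -/
lemma freeKernel_eq_gaussFactor_mul {s : ℝ} (hs : t₀ < s) (y S M : Pos d) :
    freeKernel θ x₀ t₀ y s S M = gaussFactor θ x₀ t₀ s y *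
      (cexp (inner ℝ (sourceDrift t₀ s S M) y : ℝ) * freeKernel θ x₀ t₀ 0 s S M) := by
  have hT : ((s - t₀ : ℝ) : ℂ) ≠ 0 := ofReal_ne_zero.2 (sub_pos.2 hs).ne'
  obtain ⟨g, hg⟩ : ∃ g : Fin d → ℂ, g = fun k => -I * y k * θ s k +
    I / (2 * ((s - t₀ : ℝ) : ℂ)) * (y k ^ 2 + 2 * y k * (accum θ t₀ k s - x₀ k)) := ⟨_, rfl⟩
  have h : ∀ k, coordPhase (θ s k) (accum θ t₀ k s) (accumSq θ t₀ k s) (s - t₀) s (y k) (x₀ k)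
      (S k) (M k) = g k + ((sourceDrift t₀ s S M k * y k : ℝ) + coordPhase (θ s k) (accum θ t₀ k s)
          (accumSq θ t₀ k s) (s - t₀) s ((0 : Pos d) k) (x₀ k) (S k) (M k)) := fun k => by
    simp only [hg, coordPhase, sourceDrift, PiLp.sub_apply, PiLp.smul_apply, smul_eq_mul,
      PiLp.zero_apply]
    push_cast at hT ⊢
    field_simp
    ring_nf
    simp only [I_sq]
    ring
  have hin : (inner ℝ (sourceDrift t₀ s S M) y : ℝ) = ∑ k, sourceDrift t₀ s S M k * y k := by
    rw [PiLp.inner_apply]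
    exact Finset.sum_congr rfl fun k _ => by simp [mul_comm]
  rw [freeKernel, Finset.sum_congr rfl fun k _ => h k, Finset.sum_add_distrib,
    Finset.sum_add_distrib, freeKernel, hin, ofReal_sum, Complex.exp_add, Complex.exp_add,
    Complex.exp_add, Complex.exp_add, gaussFactor]
  simp only [hg]
  ring

lemma contDiff_gaussFactor (s : ℝ) {n : WithTop ℕ∞} :
    ContDiff ℝ n (gaussFactor θ x₀ t₀ s) := by
  have h : ∀ k : Fin d, ContDiff ℝ n fun y : Pos d => ((y k : ℝ) : ℂ) := fun k =>
    ofRealCLM.contDiff.comp (EuclideanSpace.proj (𝕜 := ℝ) k).contDiff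
  refine ContDiff.cexp (ContDiff.sum fun k _ => ?_)
  exact ((contDiff_const.mul (h k)).mul contDiff_const).add
    (contDiff_const.mul (((h k).pow 2).add ((contDiff_const.mul (h k)).mul contDiff_const)))

end FreeKernel

/-! ### From the jumps of the test function to the total momentum and first moment. -/

section Sources

open Complex Filter Topology

lemma setIntegral_indicator_Ioc {u : ℝ → ℂ} {t₀ τ s : ℝ} (hτ : τ ∈ Icc t₀ s) :
    ∫ r in t₀..s, (((Ioc τ s).indicator 1 r : ℝ) : ℂ) * u r = ∫ r in τ..s, u r := by
  rw [intervalIntegral.integral_of_le (hτ.1.trans hτ.2), intervalIntegral.integral_of_le hτ.2]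
  have h : (fun r => (((Ioc τ s).indicator 1 r : ℝ) : ℂ) * u r) = (Ioc τ s).indicator u := by
    ext r
    by_cases hr : r ∈ Ioc τ s <;> simp [hr]
  rw [h, setIntegral_indicator measurableSet_Ioc,
    inter_eq_right.2 (Ioc_subset_Ioc_left hτ.1)]

lemma intervalIntegrable_indicator_mul {u : ℝ → ℂ} (hu : Continuous u) (t₀ τ s : ℝ) :
    IntervalIntegrable (fun r => (((Ioc τ s).indicator 1 r : ℝ) : ℂ) * u r) volume t₀ s := by
  have h : (fun r => (((Ioc τ s).indicator 1 r : ℝ) : ℂ) * u r) = (Ioc τ s).indicator u := by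
    ext r
    by_cases hr : r ∈ Ioc τ s <;> simp [hr]
  rw [h, intervalIntegrable_iff]
  exact ((intervalIntegrable_iff.1 (hu.intervalIntegrable t₀ s))).indicator measurableSet_Ioc

/-- Products of jumps start at the later time, the origin of `max` in `selfAction`. The trailing
factor `1` gives the shape of an indicator times a continuous function, as in the two preceding
lemmas. -/
lemma indicator_Ioc_mul_indicator_Ioc (τ τ' s r : ℝ) :
    (((Ioc τ s).indicator 1 r : ℝ) : ℂ) * (((Ioc τ' s).indicator 1 r : ℝ) : ℂ)
      = (((Ioc (max τ τ') s).indicator 1 r : ℝ) : ℂ) * 1 := by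
  have : Ioc (max τ τ') s = Ioc τ s ∩ Ioc τ' s := by rw [Ioc_inter_Ioc, min_self]
  rw [this]
  by_cases h1 : r ∈ Ioc τ s <;> by_cases h2 : r ∈ Ioc τ' s <;> simp [h1, h2]

/-- The time integral of the square of a test function with jump sources. -/
lemma integral_sq_add_sources {u : ℝ → ℂ} (hu : Continuous u) {t₀ s : ℝ} {n : ℕ}
    (α τ : Fin n → ℝ) (hτ : ∀ j, τ j ∈ Icc t₀ s) :
    IntervalIntegrable (fun r => (u r + I * ∑ j, ((α j * (Ioc (τ j) s).indicator 1 r : ℝ) : ℂ)) ^ 2)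
      volume t₀ s ∧
    ∫ r in t₀..s, (u r + I * ∑ j, ((α j * (Ioc (τ j) s).indicator 1 r : ℝ) : ℂ)) ^ 2
      = (∫ r in t₀..s, u r ^ 2) + 2 * I * ∑ j, α j * ((∫ r in t₀..s, u r) - ∫ r in t₀..τ j, u r)
        - ∑ i, ∑ j, ((α i * α j * (s - max (τ i) (τ j)) : ℝ) : ℂ) := by
  have hexp : ∀ r, (u r + I * ∑ j, ((α j * (Ioc (τ j) s).indicator 1 r : ℝ) : ℂ)) ^ 2
      = u r ^ 2 + ∑ j, (2 * I * α j) * ((((Ioc (τ j) s).indicator 1 r : ℝ) : ℂ) * u r)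
        - ∑ i, ∑ j, ((α i : ℂ) * α j) *
          ((((Ioc (max (τ i) (τ j)) s).indicator 1 r : ℝ) : ℂ) * 1) := fun r => by
    have h1 : ∑ i, ∑ j, ((α i : ℂ) * α j) *
        ((((Ioc (max (τ i) (τ j)) s).indicator 1 r : ℝ) : ℂ) * 1)
        = (∑ j, ((α j * (Ioc (τ j) s).indicator 1 r : ℝ) : ℂ)) ^ 2 := by
      rw [sq, Finset.sum_mul_sum]
      refine Finset.sum_congr rfl fun i _ => Finset.sum_congr rfl fun j _ => ?_
      rw [← indicator_Ioc_mul_indicator_Ioc]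
      push_cast
      ring
    have h2 : ∑ j, (2 * I * α j) * ((((Ioc (τ j) s).indicator 1 r : ℝ) : ℂ) * u r)
        = 2 * I * u r * ∑ j, ((α j * (Ioc (τ j) s).indicator 1 r : ℝ) : ℂ) := by
      rw [Finset.mul_sum]
      refine Finset.sum_congr rfl fun j _ => ?_
      push_cast
      ring
    rw [h1, h2, add_sq, mul_pow, I_sq]
    ring
  have hmax : ∀ i j, max (τ i) (τ j) ∈ Icc t₀ s := fun i j =>
    ⟨(hτ i).1.trans (le_max_left _ _), max_le (hτ i).2 (hτ j).2⟩
  have hi1 : ∀ j, IntervalIntegrable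
      (fun r => (2 * I * α j) * ((((Ioc (τ j) s).indicator 1 r : ℝ) : ℂ) * u r)) volume t₀ s :=
    fun j => (intervalIntegrable_indicator_mul hu _ _ _).const_mul _
  have hi2 : ∀ i j, IntervalIntegrable (fun r => ((α i : ℂ) * α j) *
      ((((Ioc (max (τ i) (τ j)) s).indicator 1 r : ℝ) : ℂ) * 1)) volume t₀ s :=
    fun i j => (intervalIntegrable_indicator_mul continuous_const _ _ _).const_mul _
  have hs1 : IntervalIntegrable (fun r => ∑ j, (2 * I * α j) *
      ((((Ioc (τ j) s).indicator 1 r : ℝ) : ℂ) * u r)) volume t₀ s := by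
    simpa only [Finset.sum_fn] using IntervalIntegrable.sum Finset.univ fun j _ => hi1 j
  have hs2 : ∀ i, IntervalIntegrable (fun r => ∑ j, ((α i : ℂ) * α j) *
      ((((Ioc (max (τ i) (τ j)) s).indicator 1 r : ℝ) : ℂ) * 1)) volume t₀ s := fun i => by
    simpa only [Finset.sum_fn] using IntervalIntegrable.sum Finset.univ fun j _ => hi2 i j
  have hs3 : IntervalIntegrable (fun r => ∑ i, ∑ j, ((α i : ℂ) * α j) *
      ((((Ioc (max (τ i) (τ j)) s).indicator 1 r : ℝ) : ℂ) * 1)) volume t₀ s := by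
    simpa only [Finset.sum_fn] using IntervalIntegrable.sum Finset.univ fun i _ => hs2 i
  have hs0 : IntervalIntegrable (fun r => u r ^ 2) volume t₀ s := (hu.pow 2).intervalIntegrable _ _
  simp only [hexp]
  refine ⟨(hs0.add hs1).sub hs3, ?_⟩
  rw [intervalIntegral.integral_sub (hs0.add hs1) hs3, intervalIntegral.integral_add hs0 hs1,
    intervalIntegral.integral_finsetSum fun j _ => hi1 j,
    intervalIntegral.integral_finsetSum fun i _ => hs2 i, Finset.mul_sum]
  congr 1
  · congr 1
    refine Finset.sum_congr rfl fun j _ => ?_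
    rw [intervalIntegral.integral_const_mul, setIntegral_indicator_Ioc (hτ j),
      intervalIntegral.integral_interval_sub_left (hu.intervalIntegrable _ _)
        (hu.intervalIntegrable _ _)]
    ring
  · refine Finset.sum_congr rfl fun i _ => ?_
    rw [intervalIntegral.integral_finsetSum fun j _ => hi2 i j]
    refine Finset.sum_congr rfl fun j _ => ?_
    rw [intervalIntegral.integral_const_mul, setIntegral_indicator_Ioc (hmax i j)]
    simp

variable {d : ℕ}

/-- The total momentum `∑ αⱼ` of a configuration. -/
noncomputable def totalMomentum (p : Config (Pos d × ℝ)) : Pos d := ∑ j, (p.2 j).1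

/-- The first moment `∑ τⱼ αⱼ` of a configuration. -/
noncomputable def firstMoment (p : Config (Pos d × ℝ)) : Pos d := ∑ j, (p.2 j).2 • (p.2 j).1

/-- The part of the exponent of the integrand that depends on neither position nor final time. -/
noncomputable def selfAction (θ : TestFun d) (t₀ : ℝ) (p : Config (Pos d × ℝ)) : ℂ :=
  -(∑ j, ∑ k, ((p.2 j).1 k : ℂ) * accum θ t₀ k (p.2 j).2)
    - I / 2 * ((∑ i, ∑ j, inner ℝ (p.2 i).1 (p.2 j).1 * max (p.2 i).2 (p.2 j).2 : ℝ) : ℂ)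

/-- The weight of a configuration with one-point factor `w`. -/
noncomputable def configWeight (θ : TestFun d) (t₀ : ℝ) (w : Pos d × ℝ → ℂ)
    (p : Config (Pos d × ℝ)) : ℂ :=
  (∏ j, w (p.2 j)) * cexp (selfAction θ t₀ p)

/-- The latest time of a configuration, or `a` if that is later. -/
noncomputable def latestTime (a : ℝ) (p : Config (Pos d × ℝ)) : ℝ :=
  Finset.univ.fold max a fun j => (p.2 j).2

lemma latestTime_le_iff {a s : ℝ} {p : Config (Pos d × ℝ)} :
    latestTime a p ≤ s ↔ a ≤ s ∧ ∀ j, (p.2 j).2 ≤ s := by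
  simp [latestTime, Finset.fold_max_le]

lemma latestTime_lt_iff {a s : ℝ} {p : Config (Pos d × ℝ)} :
    latestTime a p < s ↔ a < s ∧ ∀ j, (p.2 j).2 < s := by
  simp [latestTime, Finset.fold_max_lt]

/-- Otherwise every entry, and `a`, would lie strictly below their own maximum. -/
lemma latestTime_eq (a : ℝ) (p : Config (Pos d × ℝ)) :
    latestTime a p = a ∨ ∃ j, latestTime a p = (p.2 j).2 := by
  by_contra! h
  have h1 := (latestTime_le_iff (a := a) (p := p)).1 le_rfl
  have h2 : latestTime a p < latestTime a p :=
    latestTime_lt_iff.2 ⟨lt_of_le_of_ne h1.1 (Ne.symm h.1),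
      fun j => lt_of_le_of_ne (h1.2 j) (Ne.symm (h.2 j))⟩
  exact lt_irrefl _ h2

lemma measurable_latestTime (a : ℝ) : Measurable (latestTime (d := d) a) := by
  refine measurable_of_Iic fun s => measurableSet_config_iff.2 fun n => ?_
  have : configMk n ⁻¹' (latestTime (d := d) a ⁻¹' Iic s)
      = {p | a ≤ s} ∩ ⋂ j, {p : Fin n → Pos d × ℝ | (p j).2 ≤ s} := by
    ext p; simp [latestTime_le_iff]
  rw [this]
  exact (MeasurableSet.const _).inter (MeasurableSet.iInter fun j =>
    measurableSet_le (by fun_prop) measurable_const)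

lemma measurable_totalMomentum : Measurable (totalMomentum (d := d)) := by
  rw [measurable_config_iff]
  intro n
  have h : ∀ j : Fin n, Measurable fun p : Fin n → Pos d × ℝ => (p j).1 := fun j => by fun_prop
  exact Finset.measurable_fun_sum Finset.univ fun j _ => h j

lemma measurable_firstMoment : Measurable (firstMoment (d := d)) := by
  rw [measurable_config_iff]
  intro n
  have h : ∀ j : Fin n, Measurable fun p : Fin n → Pos d × ℝ => (p j).2 • (p j).1 :=
    fun j => by fun_prop
  exact Finset.measurable_fun_sum Finset.univ fun j _ => h j

lemma measurable_selfAction (θ : TestFun d) (t₀ : ℝ) : Measurable (selfAction θ t₀) := by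
  rw [measurable_config_iff]
  intro n
  have h : ∀ k, Measurable (accum θ t₀ k) := fun k => (continuous_accum θ t₀ k).measurable
  have h1 : ∀ (j : Fin n) (k : Fin d), Measurable fun p : Fin n → Pos d × ℝ =>
      ((p j).1 k : ℂ) * accum θ t₀ k (p j).2 := fun j k => by fun_prop
  have h2 : ∀ i j : Fin n, Measurable fun p : Fin n → Pos d × ℝ =>
      inner ℝ (p i).1 (p j).1 * max (p i).2 (p j).2 := fun i j => by fun_prop
  exact (Finset.measurable_fun_sum Finset.univ fun j _ =>
    Finset.measurable_fun_sum Finset.univ fun k _ => h1 j k).neg.sub (measurable_const.mul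
      (Complex.measurable_ofReal.comp (Finset.measurable_fun_sum Finset.univ fun i _ =>
        Finset.measurable_fun_sum Finset.univ fun j _ => h2 i j)))

lemma measurable_configWeight (θ : TestFun d) (t₀ : ℝ) {w : Pos d × ℝ → ℂ} (hw : Measurable w) :
    Measurable (configWeight θ t₀ w) := by
  refine Measurable.mul (measurable_config_iff.2 fun n => ?_) (measurable_selfAction θ t₀).cexp
  exact Finset.measurable_fun_prod Finset.univ fun j _ => hw.comp (measurable_pi_apply j)

/-- On the time box the integrand is the free kernel with sources, up to the self-action. -/
lemma prefactor_mul_integrand (θ : TestFun d) (x x₀ : Pos d) {t₀ s : ℝ} {n : ℕ}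
    {p : Fin n → Pos d × ℝ} (hp : p ∈ timeBox d t₀ s n) :
    (2 * (Real.pi : ℂ) * I * ((s - t₀ : ℝ) : ℂ)) ^ (-((d : ℂ) / 2)) *
        cexp (I * dotC x₀ (θ t₀) - I * dotC x (θ s)) * integrand θ x s x₀ t₀ n p
      = freeKernel θ x₀ t₀ x s (totalMomentum ⟨n, p⟩) (firstMoment ⟨n, p⟩) *
        cexp (selfAction θ t₀ ⟨n, p⟩) := by
  have hS : ∀ k, ((totalMomentum ⟨n, p⟩ : Pos d) k : ℂ) = ∑ j, ((p j).1 k : ℂ) := fun k => by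
    simp [totalMomentum]
  have hM : ∀ k, ((firstMoment ⟨n, p⟩ : Pos d) k : ℂ) = ∑ j, ((p j).2 : ℂ) * (p j).1 k :=
    fun k => by simp [firstMoment]
  have hint : ∫ r in t₀..s, ∑ k,
      (θ r k + I * ∑ j, (((p j).1 k * (Ioc (p j).2 s).indicator 1 r : ℝ) : ℂ)) ^ 2
      = ∑ k, (accumSq θ t₀ k s + 2 * I * ∑ j, ((p j).1 k : ℂ) *
        (accum θ t₀ k s - accum θ t₀ k (p j).2)
        - ∑ i, ∑ j, (((p i).1 k * (p j).1 k * (s - max (p i).2 (p j).2) : ℝ) : ℂ)) := by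
    rw [intervalIntegral.integral_finsetSum]
    · exact Finset.sum_congr rfl fun k _ => (integral_sq_add_sources
        (continuous_testFun_apply θ k) (fun j => (p j).1 k) (fun j => (p j).2) hp).2
    · exact fun k _ => (integral_sq_add_sources
        (continuous_testFun_apply θ k) (fun j => (p j).1 k) (fun j => (p j).2) hp).1
  have hlin : ∀ k, (∑ j, (((p j).1 k * (s - (p j).2) : ℝ) : ℂ))
      = (∑ j, ((p j).1 k : ℂ)) * s - ∑ j, ((p j).2 : ℂ) * (p j).1 k := fun k => by
    rw [Finset.sum_mul, ← Finset.sum_sub_distrib]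
    refine Finset.sum_congr rfl fun j _ => ?_
    push_cast; ring
  -- The part of the double sum that depends on the final time collapses to `S² s`; the `max` terms
  -- are constant in `s` and go into `selfAction`.
  have hquad : ∀ k, (∑ i, ∑ j, (((p i).1 k * (p j).1 k * (s - max (p i).2 (p j).2) : ℝ) : ℂ))
      = (∑ j, ((p j).1 k : ℂ)) ^ 2 * s
        - ∑ i, ∑ j, (((p i).1 k * (p j).1 k * max (p i).2 (p j).2 : ℝ) : ℂ) := fun k => by
    rw [sq, Finset.sum_mul_sum, Finset.sum_mul, ← Finset.sum_sub_distrib]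
    refine Finset.sum_congr rfl fun i _ => ?_
    rw [Finset.sum_mul, ← Finset.sum_sub_distrib]
    refine Finset.sum_congr rfl fun j _ => ?_
    push_cast; ring
  have hlinΘ : ∀ k, (∑ j, ((p j).1 k : ℂ) * (accum θ t₀ k s - accum θ t₀ k (p j).2))
      = (∑ j, ((p j).1 k : ℂ)) * accum θ t₀ k s
        - ∑ j, ((p j).1 k : ℂ) * accum θ t₀ k (p j).2 := fun k => by
    rw [Finset.sum_mul, ← Finset.sum_sub_distrib]
    exact Finset.sum_congr rfl fun j _ => by ring
  have hx : ((∑ j, inner ℝ (p j).1 x : ℝ) : ℂ) = ∑ k, (∑ j, ((p j).1 k : ℂ)) * x k := by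
    simp only [PiLp.inner_apply]
    push_cast
    rw [Finset.sum_comm]
    refine Finset.sum_congr rfl fun k _ => ?_
    rw [Finset.sum_mul]
    exact Finset.sum_congr rfl fun j _ => by simp [mul_comm]
  have hself : selfAction θ t₀ ⟨n, p⟩ = ∑ k, (-(∑ j, ((p j).1 k : ℂ) * accum θ t₀ k (p j).2)
      - I / 2 * ∑ i, ∑ j, (((p i).1 k * (p j).1 k * max (p i).2 (p j).2 : ℝ) : ℂ)) := by
    rw [selfAction, Finset.sum_sub_distrib, Finset.sum_neg_distrib, ← Finset.mul_sum]
    congr 1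
    · rw [Finset.sum_comm]
    · congr 1
      push_cast
      refine Eq.symm (Finset.sum_comm.trans (Finset.sum_congr rfl fun i _ =>
        Finset.sum_comm.trans (Finset.sum_congr rfl fun j _ => ?_)))
      rw [PiLp.inner_apply, ofReal_sum, Finset.sum_mul]
      exact Finset.sum_congr rfl fun k _ => by simp [mul_comm]
  rw [freeKernel]
  generalize (2 * (Real.pi : ℂ) * I * ((s - t₀ : ℝ) : ℂ)) ^ (-((d : ℂ) / 2)) = N
  rw [mul_assoc N, mul_assoc N]
  congr 1
  unfold integrand
  rw [← Complex.exp_add, ← Complex.exp_add, ← Complex.exp_add, ← Complex.exp_add]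
  congr 1
  have hd : dotC x (θ s) = ∑ k, (x k : ℂ) * θ s k := rfl
  rw [hint, hx, hself, hd]
  have hinv : (1 / (2 * I * ((s - t₀ : ℝ) : ℂ))) = -(I / (2 * ((s - t₀ : ℝ) : ℂ))) := by
    rw [one_div, mul_inv, mul_inv, inv_I, div_eq_mul_inv, mul_inv]
    ring
  rw [hinv]
  have hacc : ∀ k, ∫ r in t₀..s, θ r k = accum θ t₀ k s := fun k => rfl
  simp only [hlin, hquad, hlinΘ, hacc]
  rw [add_assoc (I * dotC x₀ (θ t₀)), ← Finset.sum_add_distrib,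
    sub_eq_add_neg (I * dotC x₀ (θ t₀)), add_assoc (I * dotC x₀ (θ t₀))]
  congr 1
  rw [← mul_neg, ← Finset.sum_neg_distrib, Finset.mul_sum, Finset.mul_sum, Finset.mul_sum,
    ← Finset.sum_add_distrib, ← Finset.sum_add_distrib, ← Finset.sum_add_distrib]
  refine Finset.sum_congr rfl fun k _ => ?_
  rw [coordPhase, hS, hM]
  push_cast
  ring_nf
  simp only [I_sq]
  ring

end Sources

/-! ### Adding one point to a configuration. -/

section Insertion

open Complex Filter Topology

variable {d : ℕ}

lemma sum_insertNth {X β : Type*} [AddCommMonoid β] {n : ℕ} (f : X → β) (j : Fin (n + 1)) (x : X)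
    (p : Fin n → X) :
    ∑ i, f (Fin.insertNth (α := fun _ => X) j x p i) = f x + ∑ i, f (p i) := by
  rw [Fin.sum_univ_succAbove _ j]
  simp

lemma prod_insertNth {X β : Type*} [CommMonoid β] {n : ℕ} (f : X → β) (j : Fin (n + 1)) (x : X)
    (p : Fin n → X) :
    ∏ i, f (Fin.insertNth (α := fun _ => X) j x p i) = f x * ∏ i, f (p i) := by
  rw [Fin.prod_univ_succAbove _ j]
  simp

lemma Config.insert_eq {X : Type*} {n : ℕ} (x : X) (p : Fin n → X) :
    Config.insert x ⟨n, p⟩ = ⟨n + 1, Fin.insertNth (α := fun _ => X) 0 x p⟩ := by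
  rw [Config.insert, Fin.insertNth_zero']

lemma totalMomentum_insertNth {n : ℕ} (j : Fin (n + 1)) (x : Pos d × ℝ) (p : Fin n → Pos d × ℝ) :
    totalMomentum ⟨n + 1, Fin.insertNth (α := fun _ => Pos d × ℝ) j x p⟩
      = totalMomentum ⟨n, p⟩ + x.1 :=
  (sum_insertNth (fun q : Pos d × ℝ => q.1) j x p).trans (add_comm _ _)

lemma firstMoment_insertNth {n : ℕ} (j : Fin (n + 1)) (x : Pos d × ℝ) (p : Fin n → Pos d × ℝ) :
    firstMoment ⟨n + 1, Fin.insertNth (α := fun _ => Pos d × ℝ) j x p⟩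
      = firstMoment ⟨n, p⟩ + x.2 • x.1 :=
  (sum_insertNth (fun q : Pos d × ℝ => q.2 • q.1) j x p).trans (add_comm _ _)

/-- In the symmetric double sum the new point is paired once with itself and twice with each old
point. -/
lemma selfAction_insertNth (θ : TestFun d) (t₀ : ℝ) {n : ℕ} (j : Fin (n + 1)) (x : Pos d × ℝ)
    (p : Fin n → Pos d × ℝ) :
    selfAction θ t₀ ⟨n + 1, Fin.insertNth (α := fun _ => Pos d × ℝ) j x p⟩
      = selfAction θ t₀ ⟨n, p⟩ - ∑ k, (x.1 k : ℂ) * accum θ t₀ k x.2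
        - I / 2 * ((inner ℝ x.1 x.1 * x.2
          + 2 * ∑ i, inner ℝ x.1 (p i).1 * max x.2 (p i).2 : ℝ) : ℂ) := by
  have h1 := sum_insertNth (fun q : Pos d × ℝ => ∑ k, (q.1 k : ℂ) * accum θ t₀ k q.2) j x p
  have h2 : (∑ i, ∑ l, inner ℝ (Fin.insertNth (α := fun _ => Pos d × ℝ) j x p i).1
      (Fin.insertNth (α := fun _ => Pos d × ℝ) j x p l).1 *
      max (Fin.insertNth (α := fun _ => Pos d × ℝ) j x p i).2
        (Fin.insertNth (α := fun _ => Pos d × ℝ) j x p l).2)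
      = (inner ℝ x.1 x.1 * x.2 + 2 * ∑ i, inner ℝ x.1 (p i).1 * max x.2 (p i).2)
        + ∑ i, ∑ l, inner ℝ (p i).1 (p l).1 * max (p i).2 (p l).2 := by
    have h3 : ∀ q : Pos d × ℝ, ∑ l, inner ℝ q.1
        (Fin.insertNth (α := fun _ => Pos d × ℝ) j x p l).1 *
        max q.2 (Fin.insertNth (α := fun _ => Pos d × ℝ) j x p l).2
        = inner ℝ q.1 x.1 * max q.2 x.2 + ∑ l, inner ℝ q.1 (p l).1 * max q.2 (p l).2 := fun q =>
      sum_insertNth (fun r : Pos d × ℝ => inner ℝ q.1 r.1 * max q.2 r.2) j x p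
    have h4 : ∑ i, inner ℝ (p i).1 x.1 * max (p i).2 x.2
        = ∑ i, inner ℝ x.1 (p i).1 * max x.2 (p i).2 :=
      Finset.sum_congr rfl fun i _ => by rw [real_inner_comm, max_comm]
    rw [Finset.sum_congr rfl fun i _ => h3 _, sum_insertNth (fun q : Pos d × ℝ =>
      inner ℝ q.1 x.1 * max q.2 x.2 + ∑ l, inner ℝ q.1 (p l).1 * max q.2 (p l).2) j x p,
      Finset.sum_add_distrib, h4, max_self]
    ring
  simp only [selfAction]
  rw [h1, h2]
  push_cast
  ring

lemma latestTime_insertNth (a : ℝ) {n : ℕ} (j : Fin (n + 1)) (x : Pos d × ℝ)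
    (p : Fin n → Pos d × ℝ) :
    latestTime a ⟨n + 1, Fin.insertNth (α := fun _ => Pos d × ℝ) j x p⟩
      = max x.2 (latestTime a ⟨n, p⟩) := by
  refine eq_of_forall_ge_iff fun s => ?_
  rw [max_le_iff, latestTime_le_iff, latestTime_le_iff, Fin.forall_iff_succAbove j]
  simp
  tauto

/-- The exponent produced by the self-interaction of a new source `α` at time `s`. -/
noncomputable def sourceExponent (θ : TestFun d) (t₀ : ℝ) (s : ℝ) (α S : Pos d) : ℂ :=
  ∑ k, (α k * accum θ t₀ k s + I / 2 * (s * (α k ^ 2 + 2 * α k * S k)))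

/-- If the new point is the latest, every `max` with it equals its own time and the interaction only
sees `totalMomentum p`. The exponent is that of `freeKernel_add_source` with the opposite sign, so
for an insertion at the current time the two cancel. -/
lemma selfAction_insert (θ : TestFun d) (t₀ : ℝ) (x : Pos d × ℝ) (p : Config (Pos d × ℝ))
    (h : ∀ j, (p.2 j).2 ≤ x.2) :
    selfAction θ t₀ (Config.insert x p)
      = selfAction θ t₀ p - sourceExponent θ t₀ x.2 x.1 (totalMomentum p) := by
  obtain ⟨n, p⟩ := p
  rw [Config.insert_eq, selfAction_insertNth, sub_sub]
  congr 1
  have h1 : ∑ i, inner ℝ x.1 (p i).1 * max x.2 (p i).2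
      = inner ℝ x.1 (totalMomentum ⟨n, p⟩) * x.2 := by
    rw [totalMomentum, inner_sum, Finset.sum_mul]
    exact Finset.sum_congr rfl fun i _ => by rw [max_eq_left (h i)]
  have h2 : ∀ y : Pos d, inner ℝ x.1 y = ∑ k, x.1 k * y k := fun y => by
    rw [PiLp.inner_apply]
    exact Finset.sum_congr rfl fun k _ => by simp [mul_comm]
  rw [h1, h2, h2, sourceExponent, Finset.sum_add_distrib]
  congr 1
  rw [← Finset.mul_sum, ← Finset.mul_sum, Finset.sum_add_distrib]
  push_cast
  have h3 : ∑ k, 2 * (x.1 k : ℂ) * (totalMomentum ⟨n, p⟩ : Pos d) k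
      = 2 * ∑ k, (x.1 k : ℂ) * (totalMomentum ⟨n, p⟩ : Pos d) k := by
    rw [Finset.mul_sum]; exact Finset.sum_congr rfl fun k _ => by ring
  have h4 : ∑ k, (x.1 k : ℂ) ^ 2 = ∑ k, (x.1 k : ℂ) * x.1 k :=
    Finset.sum_congr rfl fun k _ => sq _
  rw [h3, h4]
  ring

/-- Symmetry of the weight: the insertion formulas for the product and for `selfAction` do not
mention the position `j`. -/
lemma configWeight_insertNth (θ : TestFun d) (t₀ : ℝ) (w : Pos d × ℝ → ℂ) {n : ℕ}
    (j : Fin (n + 1)) (x : Pos d × ℝ) (p : Fin n → Pos d × ℝ) :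
    configWeight θ t₀ w ⟨n + 1, Fin.insertNth (α := fun _ => Pos d × ℝ) j x p⟩
      = configWeight θ t₀ w (Config.insert x ⟨n, p⟩) := by
  rw [Config.insert_eq, configWeight, configWeight, selfAction_insertNth, selfAction_insertNth]
  congr 1
  exact (prod_insertNth w j x p).trans (prod_insertNth w 0 x p).symm

lemma configWeight_insert (θ : TestFun d) (t₀ : ℝ) (w : Pos d × ℝ → ℂ) (x : Pos d × ℝ)
    (p : Config (Pos d × ℝ)) (h : ∀ j, (p.2 j).2 ≤ x.2) :
    configWeight θ t₀ w (Config.insert x p)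
      = w x * cexp (-sourceExponent θ t₀ x.2 x.1 (totalMomentum p)) * configWeight θ t₀ w p := by
  rw [configWeight, selfAction_insert θ t₀ x p h, configWeight, sub_eq_neg_add, Complex.exp_add]
  obtain ⟨n, p⟩ := p
  have h1 : ∏ j, w ((Config.insert x (⟨n, p⟩ : Config (Pos d × ℝ))).2 j) = w x * ∏ j, w (p j) := by
    rw [Config.insert_eq]
    exact prod_insertNth w 0 x p
  rw [h1]
  ring

lemma totalMomentum_insert (x : Pos d × ℝ) (p : Config (Pos d × ℝ)) :
    totalMomentum (Config.insert x p) = totalMomentum p + x.1 := by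
  obtain ⟨n, p⟩ := p
  rw [Config.insert_eq, totalMomentum_insertNth]

lemma firstMoment_insert (x : Pos d × ℝ) (p : Config (Pos d × ℝ)) :
    firstMoment (Config.insert x p) = firstMoment p + x.2 • x.1 := by
  obtain ⟨n, p⟩ := p
  rw [Config.insert_eq, firstMoment_insertNth]

lemma latestTime_insert (a : ℝ) (x : Pos d × ℝ) (p : Config (Pos d × ℝ)) :
    latestTime a (Config.insert x p) = max x.2 (latestTime a p) := by
  obtain ⟨n, p⟩ := p
  rw [Config.insert_eq, latestTime_insertNth]

end Insertion

/-! ### Domination of configuration weights by product weights. -/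

section Domination

open Complex Filter Topology

variable {d : ℕ}

/-- The dominating product weight of a configuration. -/
noncomputable def configDom (γ C : ℝ) (p : Config (Pos d × ℝ)) : ℝ :=
  ∏ j, (γ * Real.exp (C * ‖(p.2 j).1‖))

lemma configDom_nonneg {γ : ℝ} (hγ : 0 ≤ γ) (C : ℝ) (p : Config (Pos d × ℝ)) :
    0 ≤ configDom γ C p :=
  Finset.prod_nonneg fun _ _ => by positivity

lemma configDom_eq (γ C : ℝ) (p : Config (Pos d × ℝ)) :
    configDom γ C p = γ ^ p.1 * Real.exp (C * ∑ j, ‖(p.2 j).1‖) := by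
  rw [configDom, Finset.prod_mul_distrib, Finset.prod_const, Finset.card_univ, Fintype.card_fin,
    ← Real.exp_sum, Finset.mul_sum]

lemma integrable_exp_of_spaceTimeExpMoments {m : ComplexMeasure (Pos d × ℝ)}
    (hm : SpaceTimeExpMoments m) (C : ℝ) :
    Integrable (fun x : Pos d × ℝ => Real.exp (C * ‖x.1‖)) m.variation := by
  refine ⟨by fun_prop, lt_of_le_of_lt (lintegral_mono fun α => ?_) (hm (max C 1) (by positivity))⟩
  rw [← ofReal_norm, Real.norm_eq_abs, Real.abs_exp]
  gcongr
  exact le_max_left _ _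

lemma integrable_configDom {m : ComplexMeasure (Pos d × ℝ)} [IsFiniteMeasure m.variation]
    (hm : SpaceTimeExpMoments m) (γ C : ℝ) :
    Integrable (configDom (d := d) γ C) (configMeasure m.variation) :=
  integrable_prod_configMeasure (a := fun x : Pos d × ℝ => γ * Real.exp (C * ‖x.1‖))
    ((integrable_exp_of_spaceTimeExpMoments hm C).const_mul γ)

lemma exists_accum_bound (θ : TestFun d) (t₀ a b : ℝ) :
    ∃ c, 0 ≤ c ∧ ∀ τ ∈ Icc a b, ∀ α : Pos d,
      |(∑ k, (α k : ℂ) * accum θ t₀ k τ).re| ≤ c * ‖α‖ := by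
  choose B hB using fun k => isCompact_Icc.exists_bound_of_continuousOn (s := Icc a b)
    (continuous_accum θ t₀ k).continuousOn
  refine ⟨∑ k, |B k|, Finset.sum_nonneg fun _ _ => abs_nonneg _, fun τ hτ α => ?_⟩
  refine (abs_re_le_norm _).trans ((norm_sum_le _ _).trans ?_)
  rw [Finset.sum_mul]
  refine Finset.sum_le_sum fun k _ => ?_
  rw [norm_mul, norm_real, Real.norm_eq_abs, mul_comm]
  exact mul_le_mul ((hB k τ hτ).trans (le_abs_self _)) (abs_coord_le α k) (abs_nonneg _)
    (abs_nonneg _)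

/-- The part quadratic in the sources is purely imaginary; only the term linear in `α` affects the
modulus, so the bound is uniform in `S`. -/
lemma exists_sourceExponent_bound (θ : TestFun d) (t₀ a b : ℝ) :
    ∃ c, 0 ≤ c ∧ ∀ τ ∈ Icc a b, ∀ α S : Pos d,
      ‖cexp (-sourceExponent θ t₀ τ α S)‖ ≤ Real.exp (c * ‖α‖) := by
  obtain ⟨c, hc, h⟩ := exists_accum_bound θ t₀ a b
  refine ⟨c, hc, fun τ hτ α S => ?_⟩
  rw [norm_exp]
  refine Real.exp_le_exp.2 ?_
  have h1 : sourceExponent θ t₀ τ α S = ∑ k, (α k : ℂ) * accum θ t₀ k τ +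
      ((∑ k, 1 / 2 * (τ * (α k ^ 2 + 2 * α k * S k)) : ℝ) : ℂ) * I := by
    rw [sourceExponent, Finset.sum_add_distrib, ofReal_sum, Finset.sum_mul]
    congr 1
    refine Finset.sum_congr rfl fun k _ => ?_
    push_cast
    ring
  rw [h1, neg_re, add_re, re_ofReal_mul, I_re, mul_zero, add_zero]
  exact (neg_le_abs _).trans (h τ hτ α)

/-- The weight of a configuration supported in a strip is dominated by a product weight. -/
lemma exists_configWeight_bound (θ : TestFun d) (t₀ a b : ℝ) :
    ∃ c, 0 ≤ c ∧ ∀ (w : Pos d × ℝ → ℂ) (γ : ℝ), (∀ x, ‖w x‖ ≤ γ) →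
      (∀ x, x.2 ∉ Icc a b → w x = 0) → ∀ C, 0 ≤ C → ∀ p,
      ‖configWeight θ t₀ w p‖ * Real.exp (C * (‖totalMomentum p‖ + ‖firstMoment p‖))
        ≤ configDom γ (c * (1 + C)) p := by
  obtain ⟨c₁, hc₁, h⟩ := exists_accum_bound θ t₀ a b
  set c₂ : ℝ := |a| + |b| with hc₂
  have hc₂0 : 0 ≤ c₂ := by positivity
  -- `c₁` bounds the linear part of the self-action and `c₂` bounds `|τ|` on the strip, giving the
  -- rate `c₁ + C (1 + c₂) ≤ (c₁ + 1 + c₂) (1 + C)`.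
  refine ⟨c₁ + 1 + c₂, by positivity, fun w γ hγ hw C hC p => ?_⟩
  have hγ0 : 0 ≤ γ := (norm_nonneg _).trans (hγ (0, 0))
  by_cases hp : ∀ j, (p.2 j).2 ∈ Icc a b
  · set A := ∑ j, ‖(p.2 j).1‖ with hA
    have hA0 : 0 ≤ A := Finset.sum_nonneg fun _ _ => norm_nonneg _
    have hS : ‖totalMomentum p‖ ≤ A := norm_sum_le _ _
    have hM : ‖firstMoment p‖ ≤ c₂ * A := by
      rw [hA, Finset.mul_sum]
      refine (norm_sum_le _ _).trans (Finset.sum_le_sum fun j _ => ?_)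
      rw [norm_smul]
      refine mul_le_mul_of_nonneg_right ?_ (norm_nonneg _)
      rw [Real.norm_eq_abs, abs_le]
      have := hp j
      constructor
      · linarith [this.1, neg_abs_le a, abs_nonneg b]
      · linarith [this.2, le_abs_self b, abs_nonneg a]
    have hw1 : ‖∏ j, w (p.2 j)‖ ≤ γ ^ p.1 := by
      rw [norm_prod]
      refine (Finset.prod_le_prod (fun _ _ => norm_nonneg _) fun j _ => hγ _).trans (le_of_eq ?_)
      simp
    -- The double sum is real and carries the factor `I / 2`, hence does not contribute to the real
    -- part.
    have hre : (selfAction θ t₀ p).re ≤ c₁ * A := by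
      rw [selfAction, sub_re, mul_comm (I / 2), re_ofReal_mul, neg_re, re_sum]
      have hI : (I / 2).re = 0 := by simp
      rw [hI, mul_zero, sub_zero, hA, Finset.mul_sum, ← Finset.sum_neg_distrib]
      exact Finset.sum_le_sum fun j _ => (neg_le_abs _).trans (h _ (hp j) _)
    rw [configWeight, norm_mul, norm_exp, configDom_eq, mul_assoc, ← Real.exp_add]
    refine mul_le_mul hw1 (Real.exp_le_exp.2 ?_) (Real.exp_pos _).le (by positivity)
    calc (selfAction θ t₀ p).re + C * (‖totalMomentum p‖ + ‖firstMoment p‖)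
        ≤ c₁ * A + C * (A + c₂ * A) := by gcongr
      _ = (c₁ + C * (1 + c₂)) * A := by ring
      _ ≤ ((c₁ + 1 + c₂) * (1 + C)) * A := by
        refine mul_le_mul_of_nonneg_right ?_ hA0
        nlinarith [mul_nonneg hc₁ hC]
  · push Not at hp
    obtain ⟨j, hj⟩ := hp
    have : configWeight θ t₀ w p = 0 := by
      rw [configWeight, Finset.prod_eq_zero (Finset.mem_univ j) (hw _ hj), zero_mul]
    rw [this, norm_zero, zero_mul]
    exact configDom_nonneg hγ0 _ _

end Domination

/-! ### Integrals over random sources and smoothness of Laplace transforms. -/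

section SourceMoments

open Complex Filter Topology

variable {d : ℕ} {Ω : Type*} [MeasurableSpace Ω]

/-- The random sources `S` and `M` have all exponential moments with respect to `|W| dμ`. -/
structure HasSourceMoments (μ : Measure Ω) (S M : Ω → Pos d) (W : Ω → ℂ) : Prop where
  measurable_fst : Measurable S
  measurable_snd : Measurable M
  aestronglyMeasurable : AEStronglyMeasurable W μ
  integrable_exp : ∀ C : ℝ, Integrable (fun p => Real.exp (C * (‖S p‖ + ‖M p‖)) * ‖W p‖) μ

variable {μ : Measure Ω} {S M : Ω → Pos d} {W : Ω → ℂ}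

lemma HasSourceMoments.integrable_mul_of_norm_le (h : HasSourceMoments μ S M W) {k : Ω → ℂ}
    (hk : AEStronglyMeasurable k μ) {B C : ℝ}
    (hb : ∀ p, ‖k p‖ ≤ B * Real.exp (C * (‖S p‖ + ‖M p‖))) :
    Integrable (fun p => k p * W p) μ := by
  refine ((h.integrable_exp C).const_mul B).mono' (hk.mul h.aestronglyMeasurable)
    (Eventually.of_forall fun p => ?_)
  rw [norm_mul, ← mul_assoc]
  exact mul_le_mul_of_nonneg_right (hb p) (norm_nonneg _)

lemma HasSourceMoments.comp_sources (h : HasSourceMoments μ S M W) {k : Pos d → Pos d → ℂ}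
    (hk : Continuous fun q : Pos d × Pos d => k q.1 q.2) :
    AEStronglyMeasurable (fun p => k (S p) (M p)) μ :=
  (hk.measurable.comp (h.measurable_fst.prodMk h.measurable_snd)).aestronglyMeasurable

lemma HasSourceMoments.integrable_sources_mul (h : HasSourceMoments μ S M W)
    {k : Pos d → Pos d → ℂ} (hk : Continuous fun q : Pos d × Pos d => k q.1 q.2) {B C : ℝ}
    (hb : ∀ a b, ‖k a b‖ ≤ B * Real.exp (C * (‖a‖ + ‖b‖))) :
    Integrable (fun p => k (S p) (M p) * W p) μ :=
  h.integrable_mul_of_norm_le (h.comp_sources hk) fun _ => hb _ _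

lemma HasSourceMoments.indicator (h : HasSourceMoments μ S M W) {A : Set Ω}
    (hA : MeasurableSet A) : HasSourceMoments μ S M (A.indicator W) where
  measurable_fst := h.measurable_fst
  measurable_snd := h.measurable_snd
  aestronglyMeasurable := h.aestronglyMeasurable.indicator hA
  integrable_exp C := by
    refine ((h.integrable_exp C).indicator hA).congr (Eventually.of_forall fun p => ?_)
    by_cases hp : p ∈ A <;> simp [hp]

/-- A Laplace transform with all exponential moments is smooth. -/
lemma contDiff_integral_exp_inner {E : Type} [NormedAddCommGroup E] [InnerProductSpace ℝ E]
    {β : Ω → E} (hβ : AEStronglyMeasurable β μ) (n : ℕ) :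
    ∀ {F : Type} [NormedAddCommGroup F] [NormedSpace ℝ F] {w : Ω → F},
      AEStronglyMeasurable w μ → (∀ C : ℝ, Integrable (fun p => Real.exp (C * ‖β p‖) * ‖w p‖) μ) →
      ContDiff ℝ n fun y : E => ∫ p, Real.exp (inner ℝ (β p) y) • w p ∂μ := by
  have hmeas : ∀ {F : Type} [NormedAddCommGroup F] [NormedSpace ℝ F] {w : Ω → F},
      AEStronglyMeasurable w μ → ∀ y : E,
      AEStronglyMeasurable (fun p => Real.exp (inner ℝ (β p) y) • w p) μ := fun hw y =>
    (Real.continuous_exp.comp_aestronglyMeasurable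
      (hβ.inner aestronglyMeasurable_const)).smul hw
  have hle : ∀ (p : Ω) (y : E) (R : ℝ), ‖y‖ ≤ R → Real.exp (inner ℝ (β p) y)
      ≤ Real.exp (R * ‖β p‖) := fun p y R hy => by
    refine Real.exp_le_exp.2 ((real_inner_le_norm _ _).trans ?_)
    rw [mul_comm]
    exact mul_le_mul_of_nonneg_right hy (norm_nonneg _)
  -- The derivative is a transform of the same kind, with weight `⟨β, ·⟩ ⊗ w` of norm `‖β‖ ‖w‖`. The
  -- additional factor costs one unit of exponential rate, since `‖β‖ ≤ exp ‖β‖`.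
  have hder : ∀ {F : Type} [NormedAddCommGroup F] [NormedSpace ℝ F] {w : Ω → F},
      AEStronglyMeasurable w μ → (∀ C : ℝ, Integrable (fun p => Real.exp (C * ‖β p‖) * ‖w p‖) μ) →
      AEStronglyMeasurable (fun p => (innerSL ℝ (β p)).smulRight (w p)) μ ∧
      (∀ C : ℝ, Integrable (fun p => Real.exp (C * ‖β p‖) * (‖β p‖ * ‖w p‖)) μ) ∧
      ∀ y : E, HasFDerivAt (fun y : E => ∫ p, Real.exp (inner ℝ (β p) y) • w p ∂μ)
        (∫ p, Real.exp (inner ℝ (β p) y) • (innerSL ℝ (β p)).smulRight (w p) ∂μ) y := by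
    intro F _ _ w hw hint
    have h1 : AEStronglyMeasurable (fun p => (innerSL ℝ (β p)).smulRight (w p)) μ :=
      (ContinuousLinearMap.smulRightL ℝ E F).continuous₂.comp_aestronglyMeasurable₂
        ((innerSL ℝ).continuous.comp_aestronglyMeasurable hβ) hw
    have h2 : ∀ C : ℝ, Integrable (fun p => Real.exp (C * ‖β p‖) * (‖β p‖ * ‖w p‖)) μ := fun C => by
      refine (hint (C + 1)).mono' ((Real.continuous_exp.comp_aestronglyMeasurable
        (hβ.norm.const_mul C)).mul (hβ.norm.mul hw.norm)) (Eventually.of_forall fun p => ?_)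
      rw [Real.norm_of_nonneg (by positivity), ← mul_assoc, add_mul, one_mul, Real.exp_add]
      gcongr
      exact (by linarith [Real.add_one_le_exp ‖β p‖] : ‖β p‖ ≤ Real.exp ‖β p‖)
    refine ⟨h1, h2, fun y => ?_⟩
    refine hasFDerivAt_integral_of_dominated_of_fderiv_le
      (F' := fun y p => Real.exp (inner ℝ (β p) y) • (innerSL ℝ (β p)).smulRight (w p))
      (bound := fun p => Real.exp ((‖y‖ + 1) * ‖β p‖) * (‖β p‖ * ‖w p‖))
      (Metric.ball_mem_nhds y one_pos) (Eventually.of_forall fun z => hmeas hw z) ?_ (hmeas h1 y)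
      (Eventually.of_forall fun p z hz => ?_) (h2 _) (Eventually.of_forall fun p z _ => ?_)
    · refine (hint ‖y‖).mono' (hmeas hw y) (Eventually.of_forall fun p => ?_)
      rw [norm_smul, Real.norm_eq_abs, Real.abs_exp]
      exact mul_le_mul_of_nonneg_right (hle p y _ le_rfl) (norm_nonneg _)
    · rw [norm_smul, Real.norm_eq_abs, Real.abs_exp, ContinuousLinearMap.norm_smulRight_apply,
        innerSL_apply_norm]
      refine mul_le_mul_of_nonneg_right (hle p z _ ?_) (by positivity)
      have : ‖z - y‖ < 1 := by simpa [dist_eq_norm] using hz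
      linarith [norm_le_norm_add_norm_sub' z y]
    · have h3 : HasFDerivAt (fun z : E => Real.exp (inner ℝ (β p) z))
          (Real.exp (inner ℝ (β p) z) • innerSL ℝ (β p)) z :=
        ((innerSL ℝ (β p)).hasFDerivAt (x := z)).exp
      refine (h3.smul_const (w p)).congr_fderiv ?_
      ext v
      simp [smul_smul]
  -- The target space stays general in the induction, because the derivative takes values in the
  -- continuous linear maps from `E` to `F`.
  induction n with
  | zero =>
    intro F _ _ w hw hint
    rw [Nat.cast_zero, contDiff_zero]
    exact continuous_iff_continuousAt.2 fun y => ((hder hw hint).2.2 y).continuousAt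
  | succ n ih =>
    intro F _ _ w hw hint
    obtain ⟨h1, h2, h3⟩ := hder hw hint
    rw [Nat.cast_succ, contDiff_succ_iff_hasFDerivAt]
    refine ⟨_, ih h1 fun C => ?_, h3⟩
    simpa only [ContinuousLinearMap.norm_smulRight_apply, innerSL_apply_norm] using h2 C

end SourceMoments

/-! ### Spatial regularity and the Laplacian under the integral. -/

section Spatial

open Complex Filter Topology

variable {d : ℕ} {Ω : Type*} [MeasurableSpace Ω] {μ : Measure Ω} {S M : Ω → Pos d} {W : Ω → ℂ}

lemma exists_norm_sourceDrift_le (t₀ s : ℝ) :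
    ∃ c, 0 ≤ c ∧ ∀ a b : Pos d, ‖sourceDrift t₀ s a b‖ ≤ c * (‖a‖ + ‖b‖) := by
  refine ⟨1 + |(s - t₀)⁻¹| * (1 + |s|), by positivity, fun a b => ?_⟩
  have h1 : ‖s • a - b‖ ≤ |s| * ‖a‖ + ‖b‖ := by
    simpa [norm_smul] using norm_sub_le (s • a) b
  have h2 : ‖sourceDrift t₀ s a b‖ ≤ ‖a‖ + |(s - t₀)⁻¹| * ‖s • a - b‖ := by
    simpa only [norm_smul, Real.norm_eq_abs, sourceDrift] using
      norm_sub_le a ((s - t₀)⁻¹ • (s • a - b))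
  calc ‖sourceDrift t₀ s a b‖ ≤ ‖a‖ + |(s - t₀)⁻¹| * (|s| * ‖a‖ + ‖b‖) := h2.trans (by gcongr)
    _ ≤ ‖a‖ + ‖b‖ + |(s - t₀)⁻¹| * ((1 + |s|) * (‖a‖ + ‖b‖)) := by
      have h3 : |s| * ‖a‖ + ‖b‖ ≤ (1 + |s|) * (‖a‖ + ‖b‖) := by
        nlinarith [norm_nonneg a, norm_nonneg b, abs_nonneg s,
          mul_nonneg (abs_nonneg s) (norm_nonneg b)]
      have h4 := mul_le_mul_of_nonneg_left h3 (abs_nonneg (s - t₀)⁻¹)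
      linarith [norm_nonneg b]
    _ = _ := by ring

variable (θ : TestFun d) (x₀ : Pos d) {t₀ : ℝ}

/-- By the Gaussian factorisation the integral is a smooth function times the Laplace transform of
the kernel at position `0`; the drift is linear in the sources, so all moments are available. -/
lemma contDiff_integral_freeKernel (h : HasSourceMoments μ S M W) {s : ℝ} (hs : t₀ < s) :
    ContDiff ℝ 2 fun y => ∫ p, freeKernel θ x₀ t₀ y s (S p) (M p) * W p ∂μ := by
  have h1 : (fun y => ∫ p, freeKernel θ x₀ t₀ y s (S p) (M p) * W p ∂μ) = fun y =>
      gaussFactor θ x₀ t₀ s y * ∫ p, Real.exp (inner ℝ (sourceDrift t₀ s (S p) (M p)) y) •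
        (freeKernel θ x₀ t₀ 0 s (S p) (M p) * W p) ∂μ := by
    ext y
    rw [← integral_const_mul]
    congr 1
    ext p
    rw [freeKernel_eq_gaussFactor_mul θ x₀ hs, real_smul, ofReal_exp]
    ring
  have hβ : AEStronglyMeasurable (fun p => sourceDrift t₀ s (S p) (M p)) μ := by
    refine Measurable.aestronglyMeasurable ?_
    have := h.measurable_fst
    have := h.measurable_snd
    unfold sourceDrift
    fun_prop
  obtain ⟨c, hc, hβc⟩ := exists_norm_sourceDrift_le (d := d) t₀ s
  obtain ⟨C, hC, hb⟩ := exists_freeKernel_bound (t₂ := s) θ x₀ 0 hs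
  have hm := (h.comp_sources (continuous_freeKernel_sources θ x₀ (t₀ := t₀) 0 s)).mul
    h.aestronglyMeasurable
  rw [h1]
  refine (contDiff_gaussFactor θ x₀ s).mul (contDiff_integral_exp_inner hβ 2 hm fun D => ?_)
  refine ((h.integrable_exp (|D| * c + C)).const_mul C).mono'
    ((Real.continuous_exp.comp_aestronglyMeasurable (hβ.norm.const_mul D)).mul hm.norm)
    (Eventually.of_forall fun p => ?_)
  have h2 : D * ‖sourceDrift t₀ s (S p) (M p)‖ ≤ |D| * (c * (‖S p‖ + ‖M p‖)) :=
    mul_le_mul (le_abs_self D) (hβc _ _) (norm_nonneg _) (abs_nonneg _)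
  have h3 := (hb s (right_mem_Icc.2 le_rfl) (S p) (M p)).1
  rw [Real.norm_of_nonneg (by positivity), norm_mul, ← mul_assoc, ← mul_assoc]
  refine mul_le_mul_of_nonneg_right ?_ (norm_nonneg _)
  calc _ ≤ Real.exp (|D| * (c * (‖S p‖ + ‖M p‖))) * (C * Real.exp (C * (‖S p‖ + ‖M p‖))) := by
        gcongr
    _ = _ := by rw [mul_left_comm, ← Real.exp_add]; ring_nf

lemma exists_freeMomentum_bound (k : Fin d) (s : ℝ) (x : Pos d) :
    ∃ B, 0 ≤ B ∧ ∀ y, ‖y - x‖ ≤ 1 → ∀ a b : Pos d,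
      ‖freeMomentum θ x₀ t₀ k y s a b‖ ≤ B * Real.exp (‖a‖ + ‖b‖) := by
  set A : ℝ := ‖θ s k‖ + ‖I / ((s - t₀ : ℝ) : ℂ)‖ * (‖accum θ t₀ k s‖ + (‖x‖ + 1) + ‖x₀‖) with hA
  set D : ℝ := 1 + ‖I / ((s - t₀ : ℝ) : ℂ)‖ * (1 + |s|) with hD
  refine ⟨A + D, by positivity, fun y hy a b => ?_⟩
  have hyk : |y k| ≤ ‖x‖ + 1 := (abs_coord_le y k).trans
    (by linarith [norm_le_norm_add_norm_sub' y x])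
  have h1 : ‖accum θ t₀ k s + I * ((a k : ℂ) * s - b k) + (y k - x₀ k)‖
      ≤ ‖accum θ t₀ k s‖ + (‖a‖ * |s| + ‖b‖) + ((‖x‖ + 1) + ‖x₀‖) := by
    refine (norm_add₃_le).trans (add_le_add_three le_rfl ?_ ?_)
    · rw [norm_mul, norm_I, one_mul]
      refine (norm_sub_le _ _).trans (add_le_add ?_ ?_)
      · rw [norm_mul, norm_real, norm_real, Real.norm_eq_abs, Real.norm_eq_abs]
        exact mul_le_mul_of_nonneg_right (abs_coord_le a k) (abs_nonneg _)
      · rw [norm_real, Real.norm_eq_abs]; exact abs_coord_le b k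
    · refine (norm_sub_le _ _).trans (add_le_add ?_ ?_)
      · rw [norm_real, Real.norm_eq_abs]; exact hyk
      · rw [norm_real, Real.norm_eq_abs]; exact abs_coord_le x₀ k
  have h2 : ‖freeMomentum θ x₀ t₀ k y s a b‖ ≤ (‖θ s k‖ + ‖a‖) + ‖I / ((s - t₀ : ℝ) : ℂ)‖ *
      (‖accum θ t₀ k s‖ + (‖a‖ * |s| + ‖b‖) + ((‖x‖ + 1) + ‖x₀‖)) := by
    unfold freeMomentum coordMomentum
    refine (norm_add_le _ _).trans (add_le_add ?_ ?_)
    · rw [norm_mul, norm_neg, norm_I, one_mul]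
      refine (norm_add_le _ _).trans (add_le_add le_rfl ?_)
      rw [norm_mul, norm_I, one_mul, norm_real, Real.norm_eq_abs]
      exact abs_coord_le a k
    · rw [norm_mul]
      exact mul_le_mul_of_nonneg_left h1 (norm_nonneg _)
  have h3 : (‖θ s k‖ + ‖a‖) + ‖I / ((s - t₀ : ℝ) : ℂ)‖ *
      (‖accum θ t₀ k s‖ + (‖a‖ * |s| + ‖b‖) + ((‖x‖ + 1) + ‖x₀‖)) ≤ A + D * (‖a‖ + ‖b‖) := by
    have h5 : ‖a‖ * |s| + ‖b‖ ≤ (1 + |s|) * (‖a‖ + ‖b‖) := by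
      nlinarith [norm_nonneg a, norm_nonneg b, abs_nonneg s,
        mul_nonneg (abs_nonneg s) (norm_nonneg b)]
    have h6 := mul_le_mul_of_nonneg_left h5 (norm_nonneg (I / ((s - t₀ : ℝ) : ℂ)))
    rw [hA, hD]
    linarith [norm_nonneg b]
  have hA0 : 0 ≤ A := by positivity
  have hD0 : 0 ≤ D := by positivity
  have h7 : 1 ≤ Real.exp (‖a‖ + ‖b‖) := Real.one_le_exp (by positivity)
  have h8 : ‖a‖ + ‖b‖ ≤ Real.exp (‖a‖ + ‖b‖) := by linarith [Real.add_one_le_exp (‖a‖ + ‖b‖)]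
  calc _ ≤ A + D * (‖a‖ + ‖b‖) := h2.trans h3
    _ ≤ A * Real.exp (‖a‖ + ‖b‖) + D * Real.exp (‖a‖ + ‖b‖) :=
      add_le_add (le_mul_of_one_le_right hA0 h7) (mul_le_mul_of_nonneg_left h8 hD0)
    _ = _ := by ring

/-- `exists_freeKernel_bound` concerns one position. Factoring off the Gaussian, bounded on the
compact ball, reduces all `y` in the ball to position `0` at the price of a larger rate. -/
lemma exists_freeKernel_ball_bound {s : ℝ} (hs : t₀ < s) (x : Pos d) :
    ∃ C, 0 ≤ C ∧ ∀ y, ‖y - x‖ ≤ 1 → ∀ a b : Pos d,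
      ‖freeKernel θ x₀ t₀ y s a b‖ ≤ C * Real.exp (C * (‖a‖ + ‖b‖)) := by
  obtain ⟨c, hc, hβc⟩ := exists_norm_sourceDrift_le (d := d) t₀ s
  obtain ⟨C, hC, hb⟩ := exists_freeKernel_bound (t₂ := s) θ x₀ 0 hs
  obtain ⟨B, hB⟩ := (isCompact_closedBall x 1).exists_bound_of_continuousOn
    (contDiff_gaussFactor (t₀ := t₀) (n := 0) θ x₀ s).continuous.continuousOn
  have hB0 : 0 ≤ B := (norm_nonneg _).trans (hB x (Metric.mem_closedBall_self zero_le_one))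
  refine ⟨B * C + (c * (‖x‖ + 1) + C), by positivity, fun y hy a b => ?_⟩
  have hy' : ‖y‖ ≤ ‖x‖ + 1 := by linarith [norm_le_norm_add_norm_sub' y x]
  have h1 : ‖cexp (inner ℝ (sourceDrift t₀ s a b) y : ℝ)‖
      ≤ Real.exp (c * (‖a‖ + ‖b‖) * (‖x‖ + 1)) := by
    rw [norm_exp, ofReal_re]
    exact Real.exp_le_exp.2 ((real_inner_le_norm _ _).trans
      (mul_le_mul (hβc a b) hy' (norm_nonneg _) (by positivity)))
  have h2 := (hb s (right_mem_Icc.2 le_rfl) a b).1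
  have h3 := hB y (by simpa [dist_eq_norm] using hy)
  rw [freeKernel_eq_gaussFactor_mul θ x₀ hs, norm_mul, norm_mul]
  calc _ ≤ B * (Real.exp (c * (‖a‖ + ‖b‖) * (‖x‖ + 1)) * (C * Real.exp (C * (‖a‖ + ‖b‖)))) := by
        gcongr
    _ = B * C * Real.exp ((c * (‖x‖ + 1) + C) * (‖a‖ + ‖b‖)) := by
        rw [mul_left_comm (Real.exp _), ← Real.exp_add, ← mul_assoc]; ring_nf
    _ ≤ _ := by
        have : 0 ≤ c * (‖x‖ + 1) + C := by positivity
        have : 0 ≤ B * C := by positivity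
        exact mul_le_mul (by linarith) (Real.exp_le_exp.2
          (mul_le_mul_of_nonneg_right (by linarith) (by positivity))) (Real.exp_pos _).le
          (by positivity)

/-- Differentiation along a coordinate line of an integral over sources. -/
lemma hasDerivAt_integral_line (h : HasSourceMoments μ S M W) (k : Fin d) (x : Pos d)
    {f f' : Pos d → Pos d → Pos d → ℂ}
    (hf : ∀ y, Continuous fun q : Pos d × Pos d => f y q.1 q.2)
    (hf' : ∀ y, Continuous fun q : Pos d × Pos d => f' y q.1 q.2)
    (hd : ∀ y a b, HasDerivAt (fun u : ℝ => f (y + u • EuclideanSpace.single k (1 : ℝ)) a b)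
      (f' y a b) 0) {B C B' C' : ℝ}
    (hb : ∀ a b, ‖f x a b‖ ≤ B * Real.exp (C * (‖a‖ + ‖b‖)))
    (hb' : ∀ y, ‖y - x‖ ≤ 1 → ∀ a b, ‖f' y a b‖ ≤ B' * Real.exp (C' * (‖a‖ + ‖b‖))) :
    HasDerivAt (fun u : ℝ => ∫ p, f (x + u • EuclideanSpace.single k (1 : ℝ)) (S p) (M p) * W p ∂μ)
      (∫ p, f' x (S p) (M p) * W p ∂μ) 0 := by
  have hmain := hasDerivAt_integral_of_dominated_loc_of_deriv_le (μ := μ) (𝕜 := ℝ)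
    (F := fun (u : ℝ) p => f (x + u • EuclideanSpace.single k (1 : ℝ)) (S p) (M p) * W p)
    (F' := fun (u : ℝ) p => f' (x + u • EuclideanSpace.single k (1 : ℝ)) (S p) (M p) * W p)
    (x₀ := 0) (s := Metric.ball 0 1)
    (bound := fun p => B' * (Real.exp (C' * (‖S p‖ + ‖M p‖)) * ‖W p‖))
    (Metric.ball_mem_nhds 0 one_pos)
    (Eventually.of_forall fun u => (h.comp_sources (hf _)).mul h.aestronglyMeasurable)
    (by simpa using h.integrable_sources_mul (hf x) hb)
    ((h.comp_sources (hf' _)).mul h.aestronglyMeasurable)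
    (Eventually.of_forall fun p u hu => ?_) ((h.integrable_exp C').const_mul B')
    (Eventually.of_forall fun p u _ => ?_)
  · simpa using hmain.2
  · rw [norm_mul, ← mul_assoc]
    refine mul_le_mul_of_nonneg_right (hb' _ ?_ _ _) (norm_nonneg _)
    have : |u| < 1 := by simpa using hu
    simpa [norm_smul] using this.le
  · refine HasDerivAt.mul_const ?_ _
    have h1 := hd (x + u • EuclideanSpace.single k (1 : ℝ)) (S p) (M p)
    have h2 : HasDerivAt (fun v : ℝ => v - u) 1 u := (hasDerivAt_id u).sub_const u
    -- `hd` differentiates at parameter `0` only; based at the point reached at `u` and composed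
    -- with `v ↦ v - u`, it gives the derivative at `u`.
    rw [← sub_self u] at h1
    have h3 := h1.scomp (h := fun v : ℝ => v - u) u h2
    rw [one_smul] at h3
    refine h3.congr_of_eventuallyEq (Eventually.of_forall fun v => ?_)
    simp only [Function.comp]
    rw [add_assoc, ← add_smul]
    congr 4
    ring

/-- The Laplacian is the sum of second derivatives along coordinate lines, obtained by
differentiating twice under the integral. The regularity already proved identifies these line
derivatives with values of `fderiv`. -/
lemma laplacian_integral_freeKernel (h : HasSourceMoments μ S M W) {s : ℝ} (hs : t₀ < s)
    (x : Pos d) :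
    (∀ k, Integrable (fun p => freeKernel θ x₀ t₀ x s (S p) (M p) *
      (freeMomentum θ x₀ t₀ k x s (S p) (M p) ^ 2 + I / ((s - t₀ : ℝ) : ℂ)) * W p) μ) ∧
    Laplacian.laplacian (fun y => ∫ p, freeKernel θ x₀ t₀ y s (S p) (M p) * W p ∂μ) x
      = ∑ k, ∫ p, freeKernel θ x₀ t₀ x s (S p) (M p) *
        (freeMomentum θ x₀ t₀ k x s (S p) (M p) ^ 2 + I / ((s - t₀ : ℝ) : ℂ)) * W p ∂μ := by
  have hK := contDiff_integral_freeKernel θ x₀ h hs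
  set K : Pos d → ℂ := fun y => ∫ p, freeKernel θ x₀ t₀ y s (S p) (M p) * W p ∂μ with hKdef
  have hc0 := fun y => continuous_freeKernel_sources θ x₀ (t₀ := t₀) y s
  have hc1 := fun k y => continuous_freeMomentum_sources θ x₀ (t₀ := t₀) k y s
  have hb1 : ∀ (k : Fin d) (x : Pos d), ∃ B C, ∀ y, ‖y - x‖ ≤ 1 → ∀ a b : Pos d,
      ‖freeKernel θ x₀ t₀ y s a b * freeMomentum θ x₀ t₀ k y s a b‖
        ≤ B * Real.exp (C * (‖a‖ + ‖b‖)) := fun k x => by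
    obtain ⟨C, hC, h1⟩ := exists_freeKernel_ball_bound θ x₀ hs x
    obtain ⟨B, hB, h2⟩ := exists_freeMomentum_bound θ x₀ (t₀ := t₀) k s x
    refine ⟨C * B, C + 1, fun y hy a b => ?_⟩
    rw [norm_mul, add_mul, one_mul, Real.exp_add, mul_mul_mul_comm]
    exact mul_le_mul (h1 y hy a b) (h2 y hy a b) (norm_nonneg _) (by positivity)
  have hb2 : ∀ (k : Fin d) (x : Pos d), ∃ B C, ∀ y, ‖y - x‖ ≤ 1 → ∀ a b : Pos d,
      ‖freeKernel θ x₀ t₀ y s a b *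
        (freeMomentum θ x₀ t₀ k y s a b ^ 2 + I / ((s - t₀ : ℝ) : ℂ))‖
        ≤ B * Real.exp (C * (‖a‖ + ‖b‖)) := fun k x => by
    obtain ⟨C, hC, h1⟩ := exists_freeKernel_ball_bound θ x₀ hs x
    obtain ⟨B, hB, h2⟩ := exists_freeMomentum_bound θ x₀ (t₀ := t₀) k s x
    refine ⟨C * (B ^ 2 + ‖I / ((s - t₀ : ℝ) : ℂ)‖), C + 2, fun y hy a b => ?_⟩
    have h3 : ‖freeMomentum θ x₀ t₀ k y s a b ^ 2 + I / ((s - t₀ : ℝ) : ℂ)‖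
        ≤ (B ^ 2 + ‖I / ((s - t₀ : ℝ) : ℂ)‖) * Real.exp (2 * (‖a‖ + ‖b‖)) := by
      refine (norm_add_le _ _).trans ?_
      rw [add_mul, norm_pow, two_mul (‖a‖ + ‖b‖)]
      refine add_le_add ?_ (le_mul_of_one_le_right (norm_nonneg _)
        (Real.one_le_exp (by positivity)))
      rw [Real.exp_add, ← sq, ← mul_pow]
      exact pow_le_pow_left₀ (norm_nonneg _) (h2 y hy a b) 2
    rw [norm_mul, add_mul C, Real.exp_add, mul_mul_mul_comm]
    exact mul_le_mul (h1 y hy a b) h3 (norm_nonneg _) (by positivity)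
  have hd1 : ∀ (k : Fin d) (y : Pos d),
      HasDerivAt (fun u : ℝ => K (y + u • EuclideanSpace.single k (1 : ℝ)))
        (∫ p, freeKernel θ x₀ t₀ y s (S p) (M p) * freeMomentum θ x₀ t₀ k y s (S p) (M p)
          * W p ∂μ) 0 := fun k y => by
    obtain ⟨C, hC, h1⟩ := exists_freeKernel_ball_bound θ x₀ hs y
    obtain ⟨B', C', h2⟩ := hb1 k y
    exact hasDerivAt_integral_line h k y (f := fun y a b => freeKernel θ x₀ t₀ y s a b)
      (f' := fun y a b => freeKernel θ x₀ t₀ y s a b * freeMomentum θ x₀ t₀ k y s a b)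
      hc0 (fun y => (hc0 y).mul (hc1 k y))
      (fun y a b => hasDerivAt_freeKernel_line θ x₀ hs k y a b) (h1 y (by simp)) h2
  clear_value K
  have hd2 : ∀ k : Fin d, HasDerivAt (fun u : ℝ => ∫ p,
      freeKernel θ x₀ t₀ (x + u • EuclideanSpace.single k (1 : ℝ)) s (S p) (M p) *
      freeMomentum θ x₀ t₀ k (x + u • EuclideanSpace.single k (1 : ℝ)) s (S p) (M p) * W p ∂μ)
        (∫ p, freeKernel θ x₀ t₀ x s (S p) (M p) *
          (freeMomentum θ x₀ t₀ k x s (S p) (M p) ^ 2 + I / ((s - t₀ : ℝ) : ℂ)) * W p ∂μ) 0 :=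
    fun k => by
    obtain ⟨B, C, h1⟩ := hb1 k x
    obtain ⟨B', C', h2⟩ := hb2 k x
    exact hasDerivAt_integral_line h k x
      (f := fun y a b => freeKernel θ x₀ t₀ y s a b * freeMomentum θ x₀ t₀ k y s a b)
      (f' := fun y a b => freeKernel θ x₀ t₀ y s a b *
        (freeMomentum θ x₀ t₀ k y s a b ^ 2 + I / ((s - t₀ : ℝ) : ℂ)))
      (fun y => (hc0 y).mul (hc1 k y))
      (fun y => (hc0 y).mul (((hc1 k y).pow 2).add continuous_const))
      (fun y a b => hasDerivAt_freeKernel_mul_freeMomentum_line θ x₀ hs k y a b)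
      (h1 x (by simp)) h2
  have hline : ∀ (k : Fin d) (y : Pos d), HasDerivAt
      (fun u : ℝ => y + u • EuclideanSpace.single k (1 : ℝ)) (EuclideanSpace.single k (1 : ℝ)) 0 :=
    fun k y => by
      simpa using ((hasDerivAt_id (0 : ℝ)).smul_const (EuclideanSpace.single k (1 : ℝ))).const_add y
  refine ⟨fun k => ?_, ?_⟩
  · obtain ⟨B, C, h2⟩ := hb2 k x
    exact h.integrable_sources_mul (k := fun a b => freeKernel θ x₀ t₀ x s a b *
        (freeMomentum θ x₀ t₀ k x s a b ^ 2 + I / ((s - t₀ : ℝ) : ℂ)))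
      ((hc0 x).mul (((hc1 k x).pow 2).add continuous_const)) (h2 x (by simp))
  · rw [InnerProductSpace.laplacian_eq_iteratedFDeriv_orthonormalBasis K
      (EuclideanSpace.basisFun (Fin d) ℝ)]
    refine Finset.sum_congr rfl fun k _ => ?_
    rw [iteratedFDeriv_two_apply]
    simp only [EuclideanSpace.basisFun_apply, Matrix.cons_val_zero, Matrix.cons_val_one]
    -- The first derivative along the coordinate is needed at every `y`, so that it can be
    -- differentiated again along the line.
    have hf1 : ∀ y, fderiv ℝ K y (EuclideanSpace.single k (1 : ℝ))
        = ∫ p, freeKernel θ x₀ t₀ y s (S p) (M p) * freeMomentum θ x₀ t₀ k y s (S p) (M p)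
          * W p ∂μ := fun y => by
      have h1 : HasFDerivAt K (fderiv ℝ K y) (y + (0 : ℝ) • EuclideanSpace.single k (1 : ℝ)) := by
        simpa using (hK.differentiable (by norm_num) y).hasFDerivAt
      have h2 : HasDerivAt (fun u : ℝ => K (y + u • EuclideanSpace.single k (1 : ℝ)))
          (fderiv ℝ K y (EuclideanSpace.single k (1 : ℝ))) 0 :=
        h1.comp_hasDerivAt (0 : ℝ) (hline k y)
      exact h2.unique (hd1 k y)
    have hK' : Differentiable ℝ (fderiv ℝ K) :=
      (hK.fderiv_right (m := 1) (by norm_num)).differentiable (by norm_num)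
    have h2 : HasFDerivAt (fderiv ℝ K) (fderiv ℝ (fderiv ℝ K) x)
        (x + (0 : ℝ) • EuclideanSpace.single k (1 : ℝ)) := by
      simpa using (hK' x).hasFDerivAt
    have h4 : HasDerivAt (fun u : ℝ => fderiv ℝ K (x + u • EuclideanSpace.single k (1 : ℝ)))
        (fderiv ℝ (fderiv ℝ K) x (EuclideanSpace.single k (1 : ℝ))) 0 :=
      h2.comp_hasDerivAt (0 : ℝ) (hline k x)
    have h3 := h4.clm_apply (hasDerivAt_const (0 : ℝ) (EuclideanSpace.single k (1 : ℝ)))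
    simp only [map_zero, add_zero, hf1] at h3
    exact h3.unique (hd2 k)

end Spatial

/-! ### The propagator as a single integral over configurations. -/

section Propagator

open Complex Filter Topology

variable {d : ℕ} {m : ComplexMeasure (Pos d × ℝ)}

/-- The one-point weight `f` restricted to a time interval. -/
noncomputable def stripWeight (a b : ℝ) (f : Pos d × ℝ → ℂ) : Pos d × ℝ → ℂ :=
  {x | x.2 ∈ Icc a b}.indicator f

lemma stripWeight_of_mem {a b : ℝ} (f : Pos d × ℝ → ℂ) {x : Pos d × ℝ} (hx : x.2 ∈ Icc a b) :
    stripWeight a b f x = f x :=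
  indicator_of_mem (s := {x : Pos d × ℝ | x.2 ∈ Icc a b}) hx f

lemma stripWeight_of_notMem {a b : ℝ} (f : Pos d × ℝ → ℂ) {x : Pos d × ℝ} (hx : x.2 ∉ Icc a b) :
    stripWeight a b f x = 0 :=
  indicator_of_notMem (s := {x : Pos d × ℝ | x.2 ∈ Icc a b}) hx f

lemma measurable_stripWeight (a b : ℝ) {f : Pos d × ℝ → ℂ} (hf : Measurable f) :
    Measurable (stripWeight a b f) :=
  hf.indicator (measurable_snd measurableSet_Icc)

lemma norm_stripWeight_le (a b : ℝ) {f : Pos d × ℝ → ℂ} {γ : ℝ} (hf : ∀ x, ‖f x‖ ≤ γ)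
    (x : Pos d × ℝ) : ‖stripWeight a b f x‖ ≤ γ :=
  (norm_indicator_le_norm_self _ _).trans (hf x)

/-- The weight times any exponential of the sources is dominated by a product weight, and product
weights are integrable by the exponential series. -/
lemma hasSourceMoments_configWeight [IsFiniteMeasure m.variation] (hm : SpaceTimeExpMoments m)
    (θ : TestFun d) (t₀ a b : ℝ) {f : Pos d × ℝ → ℂ} (hf : Measurable f) {γ : ℝ}
    (hγ : ∀ x, ‖f x‖ ≤ γ) :
    HasSourceMoments (configMeasure m.variation) totalMomentum firstMoment
      (configWeight θ t₀ (stripWeight a b f)) where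
  measurable_fst := measurable_totalMomentum
  measurable_snd := measurable_firstMoment
  aestronglyMeasurable :=
    (measurable_configWeight θ t₀ (measurable_stripWeight a b hf)).aestronglyMeasurable
  integrable_exp C := by
    obtain ⟨c, hc, hb⟩ := exists_configWeight_bound θ t₀ a b
    refine (integrable_configDom hm γ (c * (1 + |C|))).mono' ?_ (Eventually.of_forall fun p => ?_)
    · have h1 := measurable_totalMomentum (d := d)
      have h2 := measurable_firstMoment (d := d)
      have h3 := measurable_configWeight θ t₀ (measurable_stripWeight a b hf)
      exact Measurable.aestronglyMeasurable (by fun_prop)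
    · rw [Real.norm_of_nonneg (by positivity), mul_comm]
      refine le_trans ?_ (hb _ γ (norm_stripWeight_le a b hγ)
        (fun x hx => stripWeight_of_notMem f hx) |C| (abs_nonneg C) p)
      gcongr
      exact le_abs_self C

lemma measurableSet_timeBox (t₀ s : ℝ) (n : ℕ) : MeasurableSet (timeBox d t₀ s n) := by
  have : timeBox d t₀ s n = ⋂ j, {p : Fin n → Pos d × ℝ | (p j).2 ∈ Icc t₀ s} := by
    ext p; simp [timeBox]
  rw [this]
  exact MeasurableSet.iInter fun j =>
    (measurable_snd.comp (measurable_pi_apply j)) measurableSet_Icc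

lemma measurableSet_latestTime_le (a s : ℝ) :
    MeasurableSet {p : Config (Pos d × ℝ) | latestTime a p ≤ s} :=
  measurableSet_le (measurable_latestTime a) measurable_const

lemma latestTime_le_iff_mem_timeBox {t₀ s : ℝ} (hs : t₀ ≤ s) {n : ℕ} {p : Fin n → Pos d × ℝ}
    (h0 : ∀ j, t₀ ≤ (p j).2) : latestTime t₀ ⟨n, p⟩ ≤ s ↔ p ∈ timeBox d t₀ s n := by
  rw [latestTime_le_iff]
  exact ⟨fun h j => ⟨h0 j, h.2 j⟩, fun h => ⟨hs, fun j => (h j).2⟩⟩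

/-- The integrand of the propagator over all configurations of sources. -/
noncomputable def configIntegrand (θ : TestFun d) (x₀ : Pos d) (t₀ : ℝ) (w : Pos d × ℝ → ℂ)
    (x : Pos d) (s : ℝ) (p : Config (Pos d × ℝ)) : ℂ :=
  freeKernel θ x₀ t₀ x s (totalMomentum p) (firstMoment p) *
    {p | latestTime t₀ p ≤ s}.indicator (configWeight θ t₀ w) p

/-- The strip `[t₀, b]` does not depend on `s`: it enforces `τⱼ ≥ t₀`, while the condition on the
latest time enforces `τⱼ ≤ s`. The moving domain is thereby encoded in a single indicator. -/
lemma configIntegrand_stripWeight (θ : TestFun d) (x₀ x : Pos d) {t₀ s b : ℝ} (hs : t₀ ≤ s)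
    (hsb : s ≤ b) (f : Pos d × ℝ → ℂ) (n : ℕ) (p : Fin n → Pos d × ℝ) :
    configIntegrand θ x₀ t₀ (stripWeight t₀ b f) x s ⟨n, p⟩
      = (2 * (Real.pi : ℂ) * I * ((s - t₀ : ℝ) : ℂ)) ^ (-((d : ℂ) / 2)) *
        cexp (I * dotC x₀ (θ t₀) - I * dotC x (θ s)) *
        ((timeBox d t₀ s n).indicator (integrand θ x s x₀ t₀ n) p * ∏ j, f (p j)) := by
  unfold configIntegrand
  by_cases hp : p ∈ timeBox d t₀ s n
  · have h1 : (⟨n, p⟩ : Config (Pos d × ℝ)) ∈ {p | latestTime t₀ p ≤ s} :=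
      (latestTime_le_iff_mem_timeBox hs fun j => (hp j).1).2 hp
    rw [indicator_of_mem h1, indicator_of_mem hp, ← mul_assoc _ (integrand _ _ _ _ _ _ _),
      prefactor_mul_integrand θ x x₀ hp, configWeight]
    have h2 : ∏ j, stripWeight t₀ b f (p j) = ∏ j, f (p j) :=
      Finset.prod_congr rfl fun j _ => stripWeight_of_mem f ⟨(hp j).1, (hp j).2.trans hsb⟩
    rw [h2]
    ring
  · rw [indicator_of_notMem hp, zero_mul, mul_zero, mul_eq_zero]
    refine Or.inr ?_
    by_cases h0 : ∀ j, t₀ ≤ (p j).2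
    · exact indicator_of_notMem (s := {p | latestTime t₀ p ≤ s})
        (fun h => hp ((latestTime_le_iff_mem_timeBox hs h0).1 h)) _
    · push Not at h0
      obtain ⟨j, hj⟩ := h0
      refine indicator_apply_eq_zero.2 fun _ => ?_
      have h1 : stripWeight t₀ b f (p j) = 0 := stripWeight_of_notMem f fun h => hj.not_ge h.1
      rw [configWeight, Finset.prod_eq_zero (Finset.mem_univ j) h1, zero_mul]

lemma integrable_configIntegrand {w : Pos d × ℝ → ℂ} {t₀ s : ℝ} (θ : TestFun d) (x₀ x : Pos d)
    (h : HasSourceMoments (configMeasure m.variation) totalMomentum firstMoment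
      (configWeight θ t₀ w)) (hs : t₀ < s) :
    Integrable (configIntegrand θ x₀ t₀ w x s) (configMeasure m.variation) := by
  obtain ⟨C, hC, hb⟩ := exists_freeKernel_bound (t₂ := s) θ x₀ x hs
  exact (h.indicator (measurableSet_latestTime_le t₀ s)).integrable_sources_mul
    (continuous_freeKernel_sources θ x₀ x s) fun a b => (hb s (right_mem_Icc.2 le_rfl) a b).1

/-- With one-point weight `1` on `[t₀, s]`, the `n`-point component of the configuration integrand
is the restricted integrand times a nonzero constant. -/
lemma integrableOn_integrand [IsFiniteMeasure m.variation] (hm : SpaceTimeExpMoments m)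
    (θ : TestFun d) (x₀ x : Pos d) {t₀ s : ℝ} (hs : t₀ < s) (n : ℕ) :
    IntegrableOn (integrand θ x s x₀ t₀ n) (timeBox d t₀ s n)
      (Measure.pi fun _ => m.variation) := by
  have h1 := hasSourceMoments_configWeight hm θ t₀ t₀ s (f := fun _ => 1) measurable_const (γ := 1)
    (by simp)
  have h2 := integrable_component (integrable_configIntegrand θ x₀ x h1 hs) n
  simp only [configIntegrand_stripWeight θ x₀ x hs.le le_rfl, Finset.prod_const_one, mul_one] at h2
  rw [← integrable_indicator_iff (measurableSet_timeBox t₀ s n)]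
  refine (integrable_const_mul_iff (IsUnit.mk0 _ (mul_ne_zero ?_ (exp_ne_zero _))) _).1 h2
  have : ((s - t₀ : ℝ) : ℂ) ≠ 0 := ofReal_ne_zero.2 (sub_pos.2 hs).ne'
  have hpi : (Real.pi : ℂ) ≠ 0 := ofReal_ne_zero.2 Real.pi_ne_zero
  rw [Ne, cpow_eq_zero_iff, not_and_or]
  exact Or.inl (mul_ne_zero (mul_ne_zero (mul_ne_zero two_ne_zero hpi) I_ne_zero) this)

lemma norm_mul_polarPhase_le (c : ℂ) (x : Pos d × ℝ) : ‖c * polarPhase m x‖ ≤ ‖c‖ := by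
  rw [norm_mul]
  exact mul_le_of_le_one_right (norm_nonneg _) (norm_polarPhase_le m x)

/-- The propagator is the integral of `configIntegrand` over all configurations. -/
lemma hasSum_propagatorTerm [IsFiniteMeasure m.variation] (hm : SpaceTimeExpMoments m) (g : ℂ)
    (θ : TestFun d) (x₀ x : Pos d) {t₀ s b : ℝ} (hs : t₀ < s) (hsb : s ≤ b) :
    HasSum (propagatorTerm m g θ x s x₀ t₀)
      (∫ p, configIntegrand θ x₀ t₀ (stripWeight t₀ b fun q => -I * g * polarPhase m q) x s p
        ∂configMeasure m.variation) := by
  have h1 := hasSourceMoments_configWeight hm θ t₀ t₀ b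
    ((measurable_polarPhase m).const_mul (-I * g)) (norm_mul_polarPhase_le (-I * g))
  have h2 := hasSum_integral_configMeasure (integrable_configIntegrand θ x₀ x h1 hs)
  convert! h2 using 1
  ext n
  -- The coupling power `(-i g)^n` is absorbed into the one-point weight `-i g h`, and `1 / n!` into
  -- the configuration measure.
  have h3 : ∀ (p : Fin n → Pos d × ℝ) (A : ℂ), A * ∏ j, -I * g * polarPhase m (p j)
      = (-I * g) ^ n * (A * ∏ j, polarPhase m (p j)) := fun p A => by
    generalize -I * g = c
    rw [Finset.prod_mul_distrib, Finset.prod_const, Finset.card_univ, Fintype.card_fin,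
      mul_left_comm]
  simp only [configIntegrand_stripWeight θ x₀ x hs.le hsb, h3]
  rw [integral_const_mul, integral_const_mul, propagatorTerm, setIntegral_productMeasure m
    (measurableSet_timeBox t₀ s n) (integrableOn_integrand hm θ x₀ x hs n), real_smul]
  push_cast
  ring

end Propagator

/-! ### Time derivative coming from the kernel. -/

section TimeDerivative

open Complex Filter Topology

variable {d : ℕ} {Ω : Type*} [MeasurableSpace Ω] {μ : Measure Ω} {S M : Ω → Pos d} {W : Ω → ℂ}

lemma eventually_indicator_le_eq {l t : ℝ} (h : l ≠ t) :
    ∀ᶠ s in 𝓝 t, (l ≤ s ↔ l ≤ t) := by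
  rcases lt_or_gt_of_ne h with h | h
  · filter_upwards [lt_mem_nhds h] with s hs
    exact ⟨fun _ => h.le, fun _ => hs.le⟩
  · filter_upwards [gt_mem_nhds h] with s hs
    exact ⟨fun h' => absurd (h'.trans_lt hs) (lt_irrefl _), fun h' => absurd h' h.not_ge⟩

/-- The time derivative of an integral of free kernels over sources that are switched on at random
times, when the kernel is frozen at the moment `t` of the last switching. -/
lemma hasDerivAt_integral_freeKernel_sub (θ : TestFun d) (x₀ x : Pos d) {t₀ t : ℝ} (ht : t₀ < t)
    (h : HasSourceMoments μ S M W) {L : Ω → ℝ} (hL : Measurable L) (hLt : ∀ᵐ p ∂μ, L p ≠ t) :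
    HasDerivAt (fun s => ∫ p, (freeKernel θ x₀ t₀ x s (S p) (M p) -
        freeKernel θ x₀ t₀ x t (S p) (M p)) * {p | L p ≤ s}.indicator W p ∂μ)
      (∫ p, freeKernel θ x₀ t₀ x t (S p) (M p) * freeRate θ x₀ t₀ x t (S p) (M p) *
        {p | L p ≤ t}.indicator W p ∂μ) t := by
  obtain ⟨t₁, h₁, h₁t⟩ := exists_between ht
  obtain ⟨C, hC, hb⟩ := exists_freeKernel_bound (t₂ := t + 1) θ x₀ x h₁
  have hLs : ∀ s, MeasurableSet {p | L p ≤ s} := fun s => measurableSet_le hL measurable_const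
  have hm : ∀ s, AEStronglyMeasurable ({p | L p ≤ s}.indicator W) μ := fun s =>
    h.aestronglyMeasurable.indicator (hLs s)
  have hnhds : Icc t₁ (t + 1) ∈ 𝓝 t := Icc_mem_nhds h₁t (by linarith)
  have htmem : t ∈ Icc t₁ (t + 1) := ⟨h₁t.le, by linarith⟩
  have hK := fun s => h.comp_sources (continuous_freeKernel_sources θ x₀ (t₀ := t₀) x s)
  have hKR := h.comp_sources (k := fun a b => freeKernel θ x₀ t₀ x t a b *
    freeRate θ x₀ t₀ x t a b) ((continuous_freeKernel_sources θ x₀ (t₀ := t₀) x t).mul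
      (continuous_freeRate_sources θ x₀ (t₀ := t₀) x t))
  -- The indicator jumps in `s`, but the difference of kernels vanishes at `s = t`; hence a
  -- Lipschitz bound based at `t` holds for every configuration, and differentiability is needed at
  -- `t` only.
  have hmain := hasFDerivAt_integral_of_dominated_loc_of_lip' (μ := μ) (𝕜 := ℝ) (x₀ := t)
    (F := fun s p => (freeKernel θ x₀ t₀ x s (S p) (M p) -
        freeKernel θ x₀ t₀ x t (S p) (M p)) * {p | L p ≤ s}.indicator W p)
    (F' := fun p => ContinuousLinearMap.toSpanSingleton ℝ (freeKernel θ x₀ t₀ x t (S p) (M p) *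
      freeRate θ x₀ t₀ x t (S p) (M p) * {p | L p ≤ t}.indicator W p))
    (bound := fun p => C * (Real.exp (C * (‖S p‖ + ‖M p‖)) * ‖W p‖))
    hnhds (fun s _ => ((hK s).sub (hK t)).mul (hm s)) (by simp)
    ((ContinuousLinearMap.toSpanSingletonCLE (𝕜 := ℝ) (E := ℂ)).continuous.comp_aestronglyMeasurable
      (hKR.mul (hm t))) (Eventually.of_forall fun p s hs => ?_)
    ((h.integrable_exp C).const_mul C) ?_
  · have h2 := hmain.2.hasDerivAt
    rw [ContinuousLinearMap.integral_apply hmain.1] at h2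
    simpa using h2
  · rw [sub_self, zero_mul, sub_zero, norm_mul, ← mul_assoc, mul_right_comm]
    refine mul_le_mul ?_ (norm_indicator_le_norm_self _ _) (norm_nonneg _) (by positivity)
    exact (convex_Icc t₁ (t + 1)).norm_image_sub_le_of_norm_hasDerivWithin_le
      (fun r hr => (hasDerivAt_freeKernel θ x₀ (h₁.trans_le hr.1) x (S p) (M p)).hasDerivWithinAt)
      (fun r hr => (hb r hr (S p) (M p)).2) htmem hs
  -- Off the null event `L p = t` the indicator is constant for `s` near `t`.
  · filter_upwards [hLt] with p hp
    rw [hasFDerivAt_iff_hasDerivAt]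
    have h3 := ((hasDerivAt_freeKernel θ x₀ ht x (S p) (M p)).sub_const
      (freeKernel θ x₀ t₀ x t (S p) (M p))).mul_const ({p | L p ≤ t}.indicator W p)
    simp only [ContinuousLinearMap.toSpanSingleton_apply, one_smul]
    refine h3.congr_of_eventuallyEq ?_
    filter_upwards [eventually_indicator_le_eq hp] with s hs
    congr 1
    by_cases h4 : L p ≤ t
    · rw [indicator_of_mem (show p ∈ {p | L p ≤ t} from h4),
        indicator_of_mem (show p ∈ {p | L p ≤ s} from hs.2 h4)]
    · rw [indicator_of_notMem (show p ∉ {p | L p ≤ t} from h4),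
        indicator_of_notMem (show p ∉ {p | L p ≤ s} from fun h' => h4 (hs.1 h'))]

end TimeDerivative

/-! ### The effect of a further, latest source. -/

section LatestSource

open Complex Filter Topology

variable {d : ℕ} (θ : TestFun d) (x₀ x : Pos d) {t₀ t : ℝ}

/-- The change of the free kernel caused by a further source `q`. -/
noncomputable def insertKernel (t₀ t : ℝ) (q : Pos d × ℝ) (S M : Pos d) : ℂ :=
  freeKernel θ x₀ t₀ x t (S + q.1) (M + q.2 • q.1) * cexp (-sourceExponent θ t₀ q.2 q.1 S)

lemma continuous_insertKernel (t₀ t : ℝ) :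
    Continuous fun r : (Pos d × ℝ) × Pos d × Pos d => insertKernel θ x₀ x t₀ t r.1 r.2.1 r.2.2 := by
  have h := fun k => continuous_accum θ t₀ k
  have h2 : Continuous fun r : (Pos d × ℝ) × Pos d × Pos d =>
      freeKernel θ x₀ t₀ x t (r.2.1 + r.1.1) (r.2.2 + r.1.2 • r.1.1) :=
    (continuous_freeKernel_sources θ x₀ (t₀ := t₀) x t).comp
      (f := fun r : (Pos d × ℝ) × Pos d × Pos d => (r.2.1 + r.1.1, r.2.2 + r.1.2 • r.1.1))
      (by fun_prop)
  unfold insertKernel sourceExponent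
  fun_prop

/-- The bound factors into a function of the new source and one of the old sources, so that each can
be integrated separately. -/
lemma exists_insertKernel_bound (ht : t₀ < t) (a b : ℝ) :
    ∃ C, 0 ≤ C ∧ ∀ q : Pos d × ℝ, q.2 ∈ Icc a b → ∀ S M : Pos d,
      ‖insertKernel θ x₀ x t₀ t q S M‖
        ≤ C * Real.exp (C * ‖q.1‖) * Real.exp (C * (‖S‖ + ‖M‖)) := by
  obtain ⟨C, hC, hb⟩ := exists_freeKernel_bound (t₂ := t) θ x₀ x ht
  obtain ⟨c, hc, hs⟩ := exists_sourceExponent_bound θ t₀ a b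
  set R := |a| + |b|
  have hR : 0 ≤ R := by positivity
  refine ⟨C * (1 + R) + c, by positivity, fun q hq S M => ?_⟩
  have hqR : |q.2| ≤ R := by
    rw [abs_le]
    exact ⟨by linarith [hq.1, neg_abs_le a, abs_nonneg b],
      by linarith [hq.2, le_abs_self b, abs_nonneg a]⟩
  have h1 : ‖S + q.1‖ + ‖M + q.2 • q.1‖ ≤ (1 + R) * ‖q.1‖ + (‖S‖ + ‖M‖) := by
    have h2 := norm_add_le S q.1
    have h3 := norm_add_le M (q.2 • q.1)
    rw [norm_smul, Real.norm_eq_abs] at h3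
    have h4 := mul_le_mul_of_nonneg_right hqR (norm_nonneg q.1)
    linarith
  have h5 := (hb t (right_mem_Icc.2 le_rfl) (S + q.1) (M + q.2 • q.1)).1
  rw [insertKernel, norm_mul, mul_assoc, ← Real.exp_add]
  calc _ ≤ C * Real.exp (C * ((1 + R) * ‖q.1‖ + (‖S‖ + ‖M‖))) * Real.exp (c * ‖q.1‖) :=
        mul_le_mul (h5.trans (by gcongr)) (hs q.2 hq q.1 S) (norm_nonneg _) (by positivity)
    _ ≤ _ := by
        rw [mul_assoc, ← Real.exp_add]
        have h6 : C ≤ C * (1 + R) + c := by nlinarith [mul_nonneg hC hR]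
        refine mul_le_mul h6 (Real.exp_le_exp.2 ?_) (Real.exp_pos _).le (by positivity)
        have h7 := mul_le_mul_of_nonneg_right h6 (add_nonneg (norm_nonneg S) (norm_nonneg M))
        linarith

/-- At the current time the exponent from `freeKernel_add_source` cancels the one from the weight,
leaving the plane wave from which the potential is built. -/
lemma insertKernel_now (α S M : Pos d) :
    insertKernel θ x₀ x t₀ t (α, t) S M
      = cexp (inner ℝ α x : ℝ) * freeKernel θ x₀ t₀ x t S M := by
  rw [insertKernel, freeKernel_add_source, ← sourceExponent, Complex.exp_neg]
  have := exp_ne_zero (sourceExponent θ t₀ t α S)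
  field_simp

variable {ν : Measure (Pos d × ℝ)} {W : Config (Pos d × ℝ) → ℂ}

/-- The contribution of all configurations earlier than the source `q`. -/
noncomputable def latestSource (ν : Measure (Pos d × ℝ)) (W : Config (Pos d × ℝ) → ℂ) (t₀ t : ℝ)
    (q : Pos d × ℝ) : ℂ :=
  ∫ p, {p | latestTime t₀ p < q.2}.indicator
    (fun p => insertKernel θ x₀ x t₀ t q (totalMomentum p) (firstMoment p) * W p) p ∂configMeasure ν

lemma norm_latestSource_integrand_le {C : ℝ} {q : Pos d × ℝ}
    (hb : ∀ S M : Pos d, ‖insertKernel θ x₀ x t₀ t q S M‖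
        ≤ C * Real.exp (C * ‖q.1‖) * Real.exp (C * (‖S‖ + ‖M‖))) (p : Config (Pos d × ℝ)) :
    ‖{p | latestTime t₀ p < q.2}.indicator (fun p => insertKernel θ x₀ x t₀ t q
        (totalMomentum p) (firstMoment p) * W p) p‖
      ≤ C * Real.exp (C * ‖q.1‖) *
        (Real.exp (C * (‖totalMomentum p‖ + ‖firstMoment p‖)) * ‖W p‖) := by
  refine (norm_indicator_le_norm_self _ _).trans ?_
  rw [norm_mul, ← mul_assoc]
  exact mul_le_mul_of_nonneg_right (hb _ _) (norm_nonneg _)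

lemma measurable_latestSource_integrand (hW : Measurable W) :
    Measurable (fun r : (Pos d × ℝ) × Config (Pos d × ℝ) =>
      {p | latestTime t₀ p < r.1.2}.indicator (fun p => insertKernel θ x₀ x t₀ t r.1
        (totalMomentum p) (firstMoment p) * W p) r.2) := by
  have h1 : MeasurableSet {r : (Pos d × ℝ) × Config (Pos d × ℝ) | latestTime t₀ r.2 < r.1.2} :=
    measurableSet_lt ((measurable_latestTime t₀).comp measurable_snd)
      (measurable_snd.comp measurable_fst)
  have h2 : Measurable fun r : (Pos d × ℝ) × Config (Pos d × ℝ) =>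
      insertKernel θ x₀ x t₀ t r.1 (totalMomentum r.2) (firstMoment r.2) * W r.2 :=
    ((continuous_insertKernel θ x₀ x t₀ t).measurable.comp
      (measurable_fst.prodMk ((measurable_totalMomentum.comp measurable_snd).prodMk
        (measurable_firstMoment.comp measurable_snd)))).mul (hW.comp measurable_snd)
  exact h2.indicator h1

end LatestSource

/-! ### Bounds and continuity in time of the latest-source contribution. -/

section LatestSourceRegularity

open Complex Filter Topology

variable {d : ℕ} (θ : TestFun d) (x₀ x : Pos d) {t₀ t : ℝ} {ν : Measure (Pos d × ℝ)}
  {W : Config (Pos d × ℝ) → ℂ}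

lemma exists_latestSource_bound (h : HasSourceMoments (configMeasure ν) totalMomentum firstMoment W)
    (ht : t₀ < t) (a b : ℝ) :
    ∃ B C, ∀ q : Pos d × ℝ, q.2 ∈ Icc a b →
      ‖latestSource θ x₀ x ν W t₀ t q‖ ≤ B * Real.exp (C * ‖q.1‖) := by
  obtain ⟨C, hC, hb⟩ := exists_insertKernel_bound θ x₀ x ht a b
  refine ⟨C * ∫ p, Real.exp (C * (‖totalMomentum p‖ + ‖firstMoment p‖)) * ‖W p‖ ∂configMeasure ν, C,
    fun q hq => ?_⟩
  refine (norm_integral_le_of_norm_le ((h.integrable_exp C).const_mul _) (Eventually.of_forall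
    (norm_latestSource_integrand_le θ x₀ x (hb q hq)))).trans (le_of_eq ?_)
  rw [integral_const_mul]
  ring

variable [IsFiniteMeasure ν]

/-- The latest time is `t₀` or the time of some point. The value `t₀` must be excluded: the empty
configuration has positive mass and latest time `t₀`. -/
lemma ae_latestTime_ne (hν : ∀ c, ∀ᵐ q ∂ν, q.2 ≠ c) {r : ℝ} (hr : t₀ ≠ r) :
    ∀ᵐ p ∂configMeasure ν, latestTime t₀ p ≠ r := by
  filter_upwards [ae_configMeasure (hν r)] with p hp h
  rcases latestTime_eq t₀ p with h1 | ⟨j, h1⟩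
  · exact hr (h1.symm.trans h)
  · exact hp j (h1.symm.trans h)

lemma stronglyMeasurable_latestSource (hW : Measurable W) :
    StronglyMeasurable (latestSource θ x₀ x ν W t₀ t) :=
  StronglyMeasurable.integral_prod_right
    (measurable_latestSource_integrand θ x₀ x hW).stronglyMeasurable

/-- For a fixed configuration the only possible jump in `τ` is at its latest time, and the
configurations with latest time `r` form a null set. -/
lemma continuousAt_latestSource (hν : ∀ c, ∀ᵐ q ∂ν, q.2 ≠ c) (hW : Measurable W)
    (h : HasSourceMoments (configMeasure ν) totalMomentum firstMoment W) (ht : t₀ < t)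
    (α : Pos d) {r : ℝ} (hr : t₀ ≠ r) :
    ContinuousAt (fun τ => latestSource θ x₀ x ν W t₀ t (α, τ)) r := by
  obtain ⟨C, hC, hb⟩ := exists_insertKernel_bound θ x₀ x ht (r - 1) (r + 1)
  have hnhds : Icc (r - 1) (r + 1) ∈ 𝓝 r := Icc_mem_nhds (by linarith) (by linarith)
  refine continuousAt_of_dominated (Eventually.of_forall fun τ => ?_)
    (eventually_of_mem hnhds fun τ hτ => Eventually.of_forall
      (norm_latestSource_integrand_le θ x₀ x (hb (α, τ) hτ)))
    ((h.integrable_exp C).const_mul (C * Real.exp (C * ‖α‖))) ?_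
  · exact ((measurable_latestSource_integrand θ x₀ x hW).comp
      (measurable_const.prodMk measurable_id)).aestronglyMeasurable
  · filter_upwards [ae_latestTime_ne hν hr] with p hp
    have h1 : Continuous fun τ : ℝ =>
        insertKernel θ x₀ x t₀ t (α, τ) (totalMomentum p) (firstMoment p) * W p :=
      ((continuous_insertKernel θ x₀ x t₀ t).comp (f := fun τ : ℝ =>
        (((α, τ) : Pos d × ℝ), totalMomentum p, firstMoment p)) (by fun_prop)).mul_const _
    rcases lt_or_gt_of_ne hp with h2 | h2
    · refine h1.continuousAt.congr ?_
      filter_upwards [lt_mem_nhds h2] with τ hτ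
      exact (indicator_of_mem
        (show p ∈ {p | latestTime t₀ p < τ} from hτ)
        (fun p => insertKernel θ x₀ x t₀ t (α, τ) (totalMomentum p) (firstMoment p) * W p)).symm
    · refine (continuousAt_const (y := (0 : ℂ))).congr ?_
      filter_upwards [gt_mem_nhds h2] with τ hτ
      exact (indicator_of_notMem (s := {p | latestTime t₀ p < τ}) hτ.not_gt _).symm

/-- Strict and weak constraints at `t` differ by a null set, so the plane wave factors out and
leaves the same constrained integral. -/
lemma latestSource_now (hν : ∀ c, ∀ᵐ q ∂ν, q.2 ≠ c) (ht : t₀ < t) (α : Pos d) :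
    latestSource θ x₀ x ν W t₀ t (α, t) = cexp (inner ℝ α x : ℝ) *
      ∫ p, freeKernel θ x₀ t₀ x t (totalMomentum p) (firstMoment p) *
        {p | latestTime t₀ p ≤ t}.indicator W p ∂configMeasure ν := by
  rw [latestSource, ← integral_const_mul]
  refine integral_congr_ae ?_
  filter_upwards [ae_latestTime_ne hν ht.ne] with p hp
  by_cases h : latestTime t₀ p ≤ t
  · rw [indicator_of_mem (s := {p | latestTime t₀ p < t}) (lt_of_le_of_ne h hp),
      indicator_of_mem (s := {p | latestTime t₀ p ≤ t}) h, insertKernel_now, mul_assoc]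
  · rw [indicator_of_notMem (s := {p | latestTime t₀ p < t}) fun h' => h (le_of_lt h'),
      indicator_of_notMem (s := {p | latestTime t₀ p ≤ t}) h, mul_zero, mul_zero]

end LatestSourceRegularity

/-! ### Decomposition according to the latest source. -/

section LatestDecomposition

open Complex Filter Topology

variable {d : ℕ} (θ : TestFun d) (x₀ x : Pos d) {t₀ t b : ℝ} {m : ComplexMeasure (Pos d × ℝ)}
  [IsFiniteMeasure m.variation]

/-- Singling out the latest source. -/
lemma integral_freeKernel_indicator_eq (hm : SpaceTimeExpMoments m)
    (hν : ∀ c, ∀ᵐ q ∂m.variation, q.2 ≠ c) {f : Pos d × ℝ → ℂ} (hf : Measurable f) {γ : ℝ}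
    (hγ : ∀ q, ‖f q‖ ≤ γ) (ht : t₀ < t) {s : ℝ} (hs : t₀ ≤ s) :
    ∫ p, freeKernel θ x₀ t₀ x t (totalMomentum p) (firstMoment p) *
        {p | latestTime t₀ p ≤ s}.indicator (configWeight θ t₀ (stripWeight t₀ b f)) p
        ∂configMeasure m.variation
      = freeKernel θ x₀ t₀ x t 0 0 + ∫ q, {q | q.2 ≤ s}.indicator (stripWeight t₀ b f) q *
        latestSource θ x₀ x m.variation (configWeight θ t₀ (stripWeight t₀ b f)) t₀ t q
          ∂m.variation := by
  classical
  set w := stripWeight t₀ b f with hw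
  have hwm : Measurable w := measurable_stripWeight t₀ b hf
  have hWm := measurable_configWeight θ t₀ hwm
  have h := hasSourceMoments_configWeight hm θ t₀ t₀ b hf hγ
  rw [← hw] at h
  have hγ0 : 0 ≤ γ := (norm_nonneg _).trans (hγ (0, 0))
  obtain ⟨C₀, hC₀, hb₀⟩ := exists_freeKernel_bound (t₂ := t) θ x₀ x ht
  have hint := (h.indicator (measurableSet_latestTime_le t₀ s)).integrable_sources_mul
    (continuous_freeKernel_sources θ x₀ x t) fun a b => (hb₀ t (right_mem_Icc.2 le_rfl) a b).1
  obtain ⟨C, hC, hb⟩ := exists_insertKernel_bound θ x₀ x ht t₀ b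
  set J : Config (Pos d × ℝ) → Pos d × ℝ → ℂ := fun p q => {q | q.2 ≤ s}.indicator w q *
    {p | latestTime t₀ p < q.2}.indicator (fun p => insertKernel θ x₀ x t₀ t q
      (totalMomentum p) (firstMoment p) * configWeight θ t₀ w p) p with hJ
  have hsm : MeasurableSet {q : Pos d × ℝ | q.2 ≤ s} :=
    measurableSet_le measurable_snd measurable_const
  have hJm : Measurable (Function.uncurry J) :=
    ((hwm.indicator hsm).comp measurable_snd).mul
      ((measurable_latestSource_integrand θ x₀ x hWm).comp measurable_swap)
  have hJi : Integrable (Function.uncurry J) ((configMeasure m.variation).prod m.variation) := by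
    refine ((h.integrable_exp C).mul_prod ((integrable_exp_of_spaceTimeExpMoments hm C).const_mul
      (γ * C))).mono' hJm.aestronglyMeasurable (Eventually.of_forall fun r => ?_)
    obtain ⟨p, q⟩ := r
    by_cases hq : q.2 ∈ Icc t₀ b
    · have h1 : ‖{q | q.2 ≤ s}.indicator w q‖ ≤ γ :=
        (norm_indicator_le_norm_self _ _).trans (norm_stripWeight_le t₀ b hγ q)
      have h2 := norm_latestSource_integrand_le θ x₀ x (W := configWeight θ t₀ w) (hb q hq) p
      rw [Function.uncurry_apply_pair, hJ, norm_mul]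
      refine (mul_le_mul h1 h2 (norm_nonneg _) hγ0).trans (le_of_eq ?_)
      ring
    · have h1 : Function.uncurry J (p, q) = 0 := by
        have h2 : w q = 0 := stripWeight_of_notMem f hq
        rw [Function.uncurry_apply_pair, hJ]
        simp only [indicator_apply, h2, ite_self, zero_mul]
      rw [h1, norm_zero]
      positivity
  -- Points before `t₀` have zero weight and time `t₀` is null. For `q` after `t₀` and later than
  -- all of `p`, the latest time of the enlarged configuration is that of `q`, so the dependence on
  -- `s` moves to `q` alone.
  have hinsert : ∀ p : Config (Pos d × ℝ), (fun q => if ∀ k, (p.2 k).2 < q.2 then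
      freeKernel θ x₀ t₀ x t (totalMomentum (Config.insert q p)) (firstMoment (Config.insert q p)) *
        {p | latestTime t₀ p ≤ s}.indicator (configWeight θ t₀ w) (Config.insert q p) else 0)
      =ᵐ[m.variation] J p := fun p => by
    filter_upwards [hν t₀] with q hq
    rcases lt_or_gt_of_ne hq with hq | hq
    · have h2 : w q = 0 := stripWeight_of_notMem f fun h => hq.not_ge h.1
      have h3 : J p q = 0 := by simp only [hJ, indicator_apply, h2, ite_self, zero_mul]
      rw [h3]
      split_ifs with h4
      · rw [indicator_apply, configWeight_insert θ t₀ w q p fun j => (h4 j).le, h2]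
        simp
      · rfl
    · by_cases h4 : ∀ k, (p.2 k).2 < q.2
      · have h5 : latestTime t₀ p < q.2 := latestTime_lt_iff.2 ⟨hq, h4⟩
        rw [if_pos h4, hJ, totalMomentum_insert, firstMoment_insert]
        simp only [indicator_apply, mem_ofPred_eq, h5, if_true, latestTime_insert,
          max_eq_left h5.le, configWeight_insert θ t₀ w q p fun j => (h4 j).le, insertKernel]
        split_ifs
        · ring
        · ring
      · have h5 : ¬ latestTime t₀ p < q.2 := fun h5 => h4 (latestTime_lt_iff.1 h5).2
        rw [if_neg h4, hJ]
        simp only [indicator_apply, mem_ofPred_eq, h5, if_false, mul_zero]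
  have hinner := fun p => integral_congr_ae (hinsert p)
  rw [integral_configMeasure_latest measurable_snd hν hint ?_ ?_]
  · congr 1
    · have h6 : latestTime t₀ (⟨0, Fin.elim0⟩ : Config (Pos d × ℝ)) ≤ s :=
        latestTime_le_iff.2 ⟨hs, fun j => j.elim0⟩
      rw [indicator_of_mem (s := {p | latestTime t₀ p ≤ s}) h6]
      simp [totalMomentum, firstMoment, configWeight, selfAction]
    · rw [integral_congr_ae (Eventually.of_forall hinner), integral_integral_swap hJi]
      refine integral_congr_ae (Eventually.of_forall fun q => ?_)
      simp only [hJ]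
      rw [integral_const_mul, latestSource]
  · intro n j q p
    simp only [totalMomentum_insertNth, firstMoment_insertNth, totalMomentum_insert,
      firstMoment_insert, indicator_apply, mem_ofPred_eq, latestTime_insertNth, latestTime_insert,
      configWeight_insertNth]
  · exact hJi.integral_prod_left.congr (Eventually.of_forall fun p => (hinner p).symm)

end LatestDecomposition

/-! ### The time derivative and the Schrödinger equation. -/

section Schrodinger

open Complex Filter Topology

variable {d : ℕ} (θ : TestFun d) (x₀ x : Pos d) {t₀ t a b : ℝ} {m : ComplexMeasure (Pos d × ℝ)}
  [IsFiniteMeasure m.variation] {V : Pos d → ℝ → ℂ} {lam : Measure (Pos d)} [SigmaFinite lam]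
  {F : Pos d → ℝ → ℂ} {G : Pos d → ℝ}

/-- The latest source, integrated against the density of `m`. -/
lemma integral_latestSource_eq (h : HasTimeDensity a b m V lam F G)
    (hm : SpaceTimeExpMoments m) (c : ℂ) (ha : a ≤ t₀) (ht : t₀ < t) {W : Config (Pos d × ℝ) → ℂ}
    (hW : Measurable W)
    (hWs : HasSourceMoments (configMeasure m.variation) totalMomentum firstMoment W) {s : ℝ}
    (hs : s ∈ Icc t₀ b) :
    IntegrableOn (fun τ => ∫ α, c * latestSource θ x₀ x m.variation W t₀ t (α, τ) * F α τ ∂lam)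
      (Icc t₀ s) ∧
    ∫ q, {q | q.2 ≤ s}.indicator (stripWeight t₀ b fun q => c * polarPhase m q) q *
        latestSource θ x₀ x m.variation W t₀ t q ∂m.variation
      = ∫ τ in t₀..s, ∫ α, c * latestSource θ x₀ x m.variation W t₀ t (α, τ) * F α τ ∂lam := by
  obtain ⟨B, C, hb⟩ := exists_latestSource_bound θ x₀ x hWs ht t₀ s
  have hsm : MeasurableSet {q : Pos d × ℝ | q.2 ∈ Icc t₀ s} := measurable_snd measurableSet_Icc
  -- Restricting to `[t₀, s] ⊆ [a, b]` makes the exponential bound available and allows the density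
  -- of `m` to be used.
  set f : Pos d × ℝ → ℂ := {q | q.2 ∈ Icc t₀ s}.indicator
    fun q => c * latestSource θ x₀ x m.variation W t₀ t q with hf
  have hfi : Integrable f m.variation := by
    refine ((integrable_exp_of_spaceTimeExpMoments hm C).const_mul (‖c‖ * B)).mono'
      ((((stronglyMeasurable_latestSource θ x₀ x hW).const_mul c).indicator
        hsm).aestronglyMeasurable) (Eventually.of_forall fun q => ?_)
    by_cases hq : q.2 ∈ Icc t₀ s
    · rw [hf, indicator_of_mem (s := {q : Pos d × ℝ | q.2 ∈ Icc t₀ s}) hq, norm_mul, mul_assoc]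
      exact mul_le_mul_of_nonneg_left (hb q hq) (norm_nonneg _)
    · rw [hf, indicator_of_notMem (s := {q : Pos d × ℝ | q.2 ∈ Icc t₀ s}) hq, norm_zero]
      have h1 := (norm_nonneg _).trans (hb (q.1, s) (right_mem_Icc.2 hs.1))
      rw [mul_assoc]
      exact mul_nonneg (norm_nonneg _) h1
  obtain ⟨h1, h2⟩ := h.integral_mul_polarPhase hfi
  have h3 : ∀ τ, ∫ α, f (α, τ) * F α τ ∂lam = (Icc t₀ s).indicator (fun τ =>
      ∫ α, c * latestSource θ x₀ x m.variation W t₀ t (α, τ) * F α τ ∂lam) τ := fun τ => by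
    by_cases hτ : τ ∈ Icc t₀ s
    · rw [indicator_of_mem hτ]
      refine integral_congr_ae (Eventually.of_forall fun α => ?_)
      simp only [hf]
      rw [indicator_of_mem (s := {q : Pos d × ℝ | q.2 ∈ Icc t₀ s}) hτ]
    · rw [indicator_of_notMem hτ]
      refine (integral_congr_ae (Eventually.of_forall fun α => ?_)).trans (integral_zero _ _)
      simp only [hf]
      rw [indicator_of_notMem (s := {q : Pos d × ℝ | q.2 ∈ Icc t₀ s}) hτ, zero_mul]
  have hsub : Icc t₀ s ⊆ Icc a b := Icc_subset_Icc ha hs.2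
  have h4 := h1.integral_prod_right
  simp only [h3] at h4
  rw [integrable_indicator_iff measurableSet_Icc, IntegrableOn,
    Measure.restrict_restrict measurableSet_Icc, inter_eq_left.2 hsub] at h4
  refine ⟨h4, ?_⟩
  rw [integral_prod_symm _ h1] at h2
  simp only [h3] at h2
  rw [setIntegral_indicator measurableSet_Icc, inter_eq_right.2 hsub,
    integral_Icc_eq_integral_Ioc, ← intervalIntegral.integral_of_le hs.1] at h2
  rw [← h2]
  refine integral_congr_ae (Eventually.of_forall fun q => ?_)
  by_cases hq : q.2 ∈ Icc t₀ s
  · simp only [hf]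
    rw [indicator_of_mem (s := {q : Pos d × ℝ | q.2 ∈ Icc t₀ s}) hq,
      indicator_of_mem (s := {q : Pos d × ℝ | q.2 ≤ s}) hq.2,
      stripWeight_of_mem _ ⟨hq.1, hq.2.trans hs.2⟩]
    ring
  · simp only [hf]
    rw [indicator_of_notMem (s := {q : Pos d × ℝ | q.2 ∈ Icc t₀ s}) hq, zero_mul, mul_eq_zero]
    refine Or.inl (indicator_apply_eq_zero.2 fun hq' => stripWeight_of_notMem _ fun hq'' => ?_)
    exact hq ⟨hq''.1, hq'⟩

/-- Switching on the sources that appear around time `t` produces the potential. -/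
lemma hasDerivAt_integral_freeKernel_indicator (h : HasTimeDensity a b m V lam F G)
    (hm : SpaceTimeExpMoments m) (c : ℂ) (ha : a ≤ t₀) (ht : t₀ < t) (htb : t < b) :
    HasDerivAt (fun s => ∫ p, freeKernel θ x₀ t₀ x t (totalMomentum p) (firstMoment p) *
        {p | latestTime t₀ p ≤ s}.indicator
          (configWeight θ t₀ (stripWeight t₀ b fun q => c * polarPhase m q)) p
          ∂configMeasure m.variation)
      (c * V x t * ∫ p, configIntegrand θ x₀ t₀ (stripWeight t₀ b fun q => c * polarPhase m q) x t p
        ∂configMeasure m.variation) t := by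
  have hν := h.variation_snd_singleton
  have hf : Measurable fun q => c * polarPhase m q := (measurable_polarPhase m).const_mul c
  have hWs := hasSourceMoments_configWeight hm θ t₀ t₀ b hf (norm_mul_polarPhase_le c)
  have hW := measurable_configWeight θ t₀ (measurable_stripWeight t₀ b hf)
  set w := stripWeight t₀ b fun q => c * polarPhase m q with hw
  set Φ := latestSource θ x₀ x m.variation (configWeight θ t₀ w) t₀ t with hΦ
  have hmem : Icc t₀ b ∈ 𝓝 t := Icc_mem_nhds ht htb
  -- With the kernel frozen at `t`, the integrand in `τ` no longer involves `s`; the fundamental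
  -- theorem of calculus then only needs continuity at `τ = t`.
  have heq : (fun s => ∫ p, freeKernel θ x₀ t₀ x t (totalMomentum p) (firstMoment p) *
        {p | latestTime t₀ p ≤ s}.indicator (configWeight θ t₀ w) p ∂configMeasure m.variation)
      =ᶠ[𝓝 t] fun s => freeKernel θ x₀ t₀ x t 0 0 +
        ∫ τ in t₀..s, ∫ α, c * Φ (α, τ) * F α τ ∂lam := by
    filter_upwards [hmem] with s hs
    rw [hw, integral_freeKernel_indicator_eq θ x₀ x hm hν hf (norm_mul_polarPhase_le c) ht hs.1,
      ← hw, hw, (integral_latestSource_eq θ x₀ x h hm c ha ht hW hWs hs).2]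
  refine HasDerivAt.congr_of_eventuallyEq ?_ heq
  have hi := (integral_latestSource_eq θ x₀ x h hm c ha ht hW hWs (right_mem_Icc.2
    (ht.trans htb).le)).1
  have hΦm : ∀ τ, AEStronglyMeasurable (fun α => c * Φ (α, τ) * F α τ) lam := fun τ =>
    (((stronglyMeasurable_latestSource θ x₀ x hW).comp_measurable
      (measurable_id.prodMk measurable_const)).const_mul c).aestronglyMeasurable.mul
      (h.measurable.comp (measurable_id.prodMk measurable_const)).aestronglyMeasurable
  obtain ⟨B, C, hb⟩ := exists_latestSource_bound θ x₀ x hWs ht t₀ b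
  have hcont : ContinuousAt (fun τ => ∫ α, c * Φ (α, τ) * F α τ ∂lam) t := by
    refine continuousAt_of_dominated (Eventually.of_forall hΦm)
      (bound := fun α => ‖c‖ * B * (Real.exp (C * ‖α‖) * G α))
      (eventually_of_mem hmem fun τ hτ => Eventually.of_forall fun α => ?_)
      ((h.integrable_exp_mul C).const_mul _) (Eventually.of_forall fun α => ?_)
    · rw [norm_mul, norm_mul, mul_assoc, mul_assoc, ← mul_assoc B]
      exact mul_le_mul_of_nonneg_left (mul_le_mul (hb (α, τ) hτ)
        (h.norm_le α τ ⟨ha.trans hτ.1, hτ.2⟩) (norm_nonneg _)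
        ((norm_nonneg _).trans (hb (α, τ) hτ))) (norm_nonneg _)
    · exact (continuousAt_const.mul (continuousAt_latestSource θ x₀ x hν hW hWs ht α ht.ne)).mul
        ((h.continuousOn α).continuousAt (Icc_mem_nhds (ha.trans_lt ht) htb))
  have hint : IntervalIntegrable (fun τ => ∫ α, c * Φ (α, τ) * F α τ ∂lam) volume t₀ t := by
    rw [intervalIntegrable_iff_integrableOn_Icc_of_le ht.le]
    exact hi.mono_set (Icc_subset_Icc_right htb.le)
  -- `Φ (α, t)` is the plane wave times the propagator integral, and the plane waves integrated
  -- against `F` give `V`.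
  have hval : ∫ α, c * Φ (α, t) * F α t ∂lam
      = c * V x t * ∫ p, configIntegrand θ x₀ t₀ w x t p ∂configMeasure m.variation := by
    rw [h.potential_eq x t ⟨ha.trans ht.le, htb.le⟩, mul_right_comm, ← integral_const_mul]
    refine integral_congr_ae (Eventually.of_forall fun α => ?_)
    simp only [hΦ]
    rw [latestSource_now θ x₀ x hν ht α]
    unfold configIntegrand
    ring
  have hder := (intervalIntegral.integral_hasDerivAt_right hint
    ⟨Icc t₀ b, hmem, hi.aestronglyMeasurable⟩ hcont).const_add (freeKernel θ x₀ t₀ x t 0 0)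
  rwa [hval] at hder

/-- The propagator has a time derivative, given by the rate of the free kernel and the potential. -/
lemma hasDerivAt_integral_configIntegrand (h : HasTimeDensity a b m V lam F G)
    (hm : SpaceTimeExpMoments m) (c : ℂ) (ha : a ≤ t₀) (ht : t₀ < t) (htb : t < b) :
    HasDerivAt (fun s => ∫ p,
        configIntegrand θ x₀ t₀ (stripWeight t₀ b fun q => c * polarPhase m q) x s p
          ∂configMeasure m.variation)
      ((∫ p, freeKernel θ x₀ t₀ x t (totalMomentum p) (firstMoment p) *
        freeRate θ x₀ t₀ x t (totalMomentum p) (firstMoment p) * {p | latestTime t₀ p ≤ t}.indicator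
          (configWeight θ t₀ (stripWeight t₀ b fun q => c * polarPhase m q)) p
          ∂configMeasure m.variation) +
      c * V x t * ∫ p, configIntegrand θ x₀ t₀ (stripWeight t₀ b fun q => c * polarPhase m q) x t p
        ∂configMeasure m.variation) t := by
  have hf : Measurable fun q => c * polarPhase m q := (measurable_polarPhase m).const_mul c
  have hWs := hasSourceMoments_configWeight hm θ t₀ t₀ b hf (norm_mul_polarPhase_le c)
  -- Near `t` the integrand splits as `(k_s - k_t) 1_{L ≤ s} + k_t 1_{L ≤ s}`, where `L` is the
  -- latest time: one part for the moving kernel, one for the moving constraint.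
  have h1 := (hasDerivAt_integral_freeKernel_sub θ x₀ x ht hWs (measurable_latestTime t₀)
    (ae_latestTime_ne h.variation_snd_singleton ht.ne)).add
    (hasDerivAt_integral_freeKernel_indicator θ x₀ x h hm c ha ht htb)
  refine h1.congr_of_eventuallyEq ?_
  obtain ⟨C, hC, hb⟩ := exists_freeKernel_bound (t₂ := t) θ x₀ x ht
  filter_upwards [lt_mem_nhds ht] with s hs
  have hi2 := (hWs.indicator (measurableSet_latestTime_le t₀ s)).integrable_sources_mul
    (continuous_freeKernel_sources θ x₀ x t) fun a b => (hb t (right_mem_Icc.2 le_rfl) a b).1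
  have hi1 := integrable_configIntegrand θ x₀ x hWs hs
  rw [Pi.add_apply, ← sub_eq_iff_eq_add, ← integral_sub hi1 hi2]
  refine integral_congr_ae (Eventually.of_forall fun p => ?_)
  simp only [configIntegrand]
  ring

lemma propagator_eq (hm : SpaceTimeExpMoments m) (g : ℂ) {s : ℝ} (hs : t₀ < s) (hsb : s ≤ b) :
    propagator m g θ x s x₀ t₀ = ∫ p,
      configIntegrand θ x₀ t₀ (stripWeight t₀ b fun q => -I * g * polarPhase m q) x s p
        ∂configMeasure m.variation :=
  (hasSum_propagatorTerm hm g θ x₀ x hs hsb).tsum_eq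

/-- The propagator solves the Schrödinger equation with potential `x · θ' + g V`. -/
lemma HasTimeDensity.solvesSchrodingerAt (h : HasTimeDensity a b m V lam F G)
    (hm : SpaceTimeExpMoments m) (g : ℂ) (ha : a ≤ t₀) (ht : t₀ < t) (htb : t < b) :
    SolvesSchrodingerAt (fun y s => propagator m g θ y s x₀ t₀)
      (fun y s => dotC y (deriv (⇑θ) s) + g * V y s) x t := by
  have hf : Measurable fun q => -I * g * polarPhase m q := (measurable_polarPhase m).const_mul _
  have hWs := (hasSourceMoments_configWeight hm θ t₀ t₀ b hf
    (norm_mul_polarPhase_le (-I * g))).indicator (measurableSet_latestTime_le t₀ t)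
  have hK : (fun y => propagator m g θ y t x₀ t₀) = fun y => ∫ p, freeKernel θ x₀ t₀ y t
      (totalMomentum p) (firstMoment p) * {p | latestTime t₀ p ≤ t}.indicator
        (configWeight θ t₀ (stripWeight t₀ b fun q => -I * g * polarPhase m q)) p
        ∂configMeasure m.variation :=
    funext fun y => propagator_eq θ x₀ y hm g ht htb.le
  have hder : HasDerivAt (fun s => propagator m g θ x s x₀ t₀) _ t :=
    (hasDerivAt_integral_configIntegrand θ x₀ x h hm (-I * g) ha ht htb).congr_of_eventuallyEq (by
      filter_upwards [Ioo_mem_nhds ht htb] with s hs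
      exact propagator_eq θ x₀ x hm g hs.1 hs.2.le)
  obtain ⟨hΔi, hΔ⟩ := laplacian_integral_freeKernel θ x₀ hWs ht x
  refine ⟨?_, hder.differentiableAt, ?_⟩
  · change ContDiff ℝ 2 fun y => propagator m g θ y t x₀ t₀
    rw [hK]
    exact contDiff_integral_freeKernel θ x₀ hWs ht
  · have hKx : propagator m g θ x t x₀ t₀ = ∫ p, freeKernel θ x₀ t₀ x t
        (totalMomentum p) (firstMoment p) * {p | latestTime t₀ p ≤ t}.indicator
          (configWeight θ t₀ (stripWeight t₀ b fun q => -I * g * polarPhase m q)) p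
          ∂configMeasure m.variation := congrFun hK x
    obtain ⟨C, hC, hb⟩ := exists_freeKernel_bound (t₂ := t) θ x₀ x ht
    have hRi := hWs.integrable_sources_mul (k := fun a b => freeKernel θ x₀ t₀ x t a b *
      freeRate θ x₀ t₀ x t a b) ((continuous_freeKernel_sources θ x₀ (t₀ := t₀) x t).mul
      (continuous_freeRate_sources θ x₀ (t₀ := t₀) x t)) fun a b =>
        (hb t (right_mem_Icc.2 le_rfl) a b).2
    -- For each configuration the rate and the Laplacian combine by `freeKernel_schrodinger`, whose
    -- right-hand factor `x · θ'` does not depend on the sources.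
    have hfree : I * (∫ p, freeKernel θ x₀ t₀ x t (totalMomentum p) (firstMoment p) *
        freeRate θ x₀ t₀ x t (totalMomentum p) (firstMoment p) * {p | latestTime t₀ p ≤ t}.indicator
          (configWeight θ t₀ (stripWeight t₀ b fun q => -I * g * polarPhase m q)) p
          ∂configMeasure m.variation) + 1 / 2 * Laplacian.laplacian (fun y => ∫ p,
          freeKernel θ x₀ t₀ y t (totalMomentum p) (firstMoment p) *
          {p | latestTime t₀ p ≤ t}.indicator (configWeight θ t₀
            (stripWeight t₀ b fun q => -I * g * polarPhase m q)) p ∂configMeasure m.variation) x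
        = dotC x (deriv (⇑θ) t) * propagator m g θ x t x₀ t₀ := by
      rw [hΔ, hKx, ← integral_finsetSum _ fun k _ => hΔi k, ← integral_const_mul,
        ← integral_const_mul, ← integral_const_mul, ← integral_add (hRi.const_mul I)
          ((integrable_finsetSum _ fun k _ => hΔi k).const_mul _)]
      refine integral_congr_ae (Eventually.of_forall fun p => ?_)
      have h1 := freeKernel_schrodinger θ x₀ ht x (totalMomentum p) (firstMoment p)
      simp only [← Finset.sum_mul]
      rw [← mul_assoc (dotC _ _), ← h1]
      ring
    simp only [hK, hder.deriv]
    rw [← propagator_eq θ x₀ x hm g ht htb.le]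
    -- The contribution of the latest source is `i · (-i g) V K = g V K`, cancelling the potential
    -- term.
    linear_combination hfree - g * V x t * propagator m g θ x t x₀ t₀ * I_sq

end Schrodinger

end LaplaceFeynman

theorem mainTheorem5 (d : ℕ) (hd : 1 ≤ d) (t₀' t' : ℝ)
    (m : ComplexMeasure (LaplaceFeynman.Pos d × ℝ)) (V : LaplaceFeynman.Pos d → ℝ → ℂ)
    (hm : LaplaceFeynman.SpaceTimeExpMoments m)
    (hform : LaplaceFeynman.FirstForm t₀' t' m V ∨ LaplaceFeynman.SecondForm t₀' t' m V)
    (g : ℂ) (θ : LaplaceFeynman.TestFun d) (x x₀ : LaplaceFeynman.Pos d) (t₀ t : ℝ)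
    (ht₀' : t₀' < t₀) (ht₀ : t₀ < t) (ht : t < t') :
    (∀ n, (LaplaceFeynman.productMeasure m n).IntegrableOn
      (LaplaceFeynman.integrand θ x t x₀ t₀ n) (LaplaceFeynman.timeBox d t₀ t n)) ∧
    Summable (LaplaceFeynman.propagatorTerm m g θ x t x₀ t₀) ∧
    LaplaceFeynman.SolvesSchrodingerAt
      (fun y s => LaplaceFeynman.propagator m g θ y s x₀ t₀)
      (fun y s => LaplaceFeynman.dotC y (deriv (⇑θ) s) + g * V y s) x t := by
  have hfin := LaplaceFeynman.isFiniteMeasure_variation_of_spaceTimeExpMoments hm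
  refine ⟨fun n => LaplaceFeynman.integrableOn_productMeasure m
      (LaplaceFeynman.measurableSet_timeBox t₀ t n)
      (LaplaceFeynman.integrableOn_integrand hm θ x₀ x ht₀ n),
    (LaplaceFeynman.hasSum_propagatorTerm hm g θ x₀ x ht₀ ht.le).summable, ?_⟩
  -- Either form yields a density continuous in time; the equation holds at `t` since `t` is
  -- interior to `[t₀, t']`.
  obtain ⟨lam, F, G, _, h⟩ := hform.elim (fun h => h.exists_hasTimeDensity) fun h =>
    h.exists_hasTimeDensity ((ht₀'.trans ht₀).trans ht).le
  exact h.solvesSchrodingerAt θ x₀ x hm g ht₀'.le ht₀ ht
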